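/- **Setting (V-MST-U).** An input consists of a finite connected simple graph $G=(V,E)$, for each vertex $v$ a non-empty uncertainty set $A_v\subset\mathbb R^2$ that is either a singleton ($v$ is then called trivial) or an open set, and query costs $q_v>0$. Each vertex has an a priori unknown true position $p_v\in A_v$; querying $v$ costs $q_v$, reveals $p_v$ and replaces $A_v$ by $\{p_v\}$. For an edge $e=\{u,v\}$ put $A_e=\{\|x-y\| : x\in A_u,\ y\in A_v\}$, $L_e=\inf A_e$ and $U_e=\sup A_e\in[0,\infty]$, always with respect to the current sets $A_v$ (this is the associated edge instance). A set $Q\subset V$ is a *feasible query set* if, after querying all vertices in $Q$, there is a spanning tree $T$ of $G$ that is a minimum spanning tree for every weight function $w:E\to\mathbb R$ with $w(e)\in A_e$ for all $e\in E$. $OPT$ is the minimum of $\sum_{v\in Q}q_v$ over all feasible $Q$. A randomized algorithm sees $G$, the sets $A_v$ and the costs $q_v$, chooses its queries adaptively and at random, and always ends with a feasible set of queried vertices; it is *$c$-competitive* on a class of instances if its expected query cost is at most $c\cdot OPT$ for every instance of the class and all true positions. An instance is *cactus-like* if no two different cycles of $G$ share a non-trivial vertex. **The algorithm V-Random$_C$.**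 An edge $f$ of a cycle $C$ is always maximal in $C$ if $L_f\ge U_e$ for all $e\in C-f$; $C$ is solved if it has such an edge. Only non-trivial vertices are queried ("query the end vertices of $e$" means the non-trivial ones). A *deterministic round* on $C$ does nothing if $C$ is solved, and otherwise queries the end vertices of an edge of $C$ with largest $U_e$. All choices called arbitrary below may be made by any rule that depends on the information available so far. 1. *Preprocessing.* As long as no spanning tree is minimum both for the weights $L_e$ and for the weights $U_e$: take minimum spanning trees $T_L$ and $T_U$ for the weights $L_e$ and $U_e$ with $|T_L\setminus T_U|$ as small as possible, and query the end vertices of an (arbitrary) edge in $T_L\setminus T_U$. (A weight $U_e=\infty$ is read as an arbitrarily large number.) Then fix a tree $T$ that is minimum for both weights. 2. For each $f\in E\setminus T$, in arbitrary order, let $C$ be the cycle in $T+f$. If $C$ is solved, go to the next $f$. Otherwise let $X=\{e\in C-f: U_e>L_f\}$ and let $a$ be the size of a smallest vertex cover of $X$ that consists of non-trivial vertices not in $f$ ($a=\infty$ if there is none). - If $a=1$ (*Rand1*): query the non-trivial vertices that lie in $f$ or in all edges of $X$, in uniformly random order, stopping as soon as $C$ is solved; if $C$ is still not solved afterwards,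 query the remaining vertices of the edges in $X$. - Otherwise query the end vertices of $f$ (whose weight $w_f$ is then known), and let $g$ be an edge of $C$ that now has largest upper limit. - If $a\ge 3$ or $w_f\le L_g$ (*Rand3*): perform two deterministic rounds; if $C$ is not solved, take an edge with largest upper limit, query one of its non-trivial end vertices chosen uniformly at random and, if $C$ is still not solved, the other one (if there is one); then perform deterministic rounds until $C$ is solved. - Otherwise (*Rand2*): unless $C$ is solved, choose uniformly at random one of the smallest vertex covers $W$ of $X$ as above; query a vertex of $W\cap g$ and, if $C$ is still not solved, the rest of $W$; then perform deterministic rounds until $C$ is solved. **Theorem.** On all cactus-like instances of V-MST-U with uniform query costs (all $q_v$ equal), V-Random$_C$ always outputs a feasible query set and its expected query cost is at most $2.5\cdot OPT$. This is best possible: every randomized algorithm that is $c$-competitive on these instances has $c\ge 2.5$. -/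

import Mathlib

namespace VMST

/-- The Euclidean plane. -/
abbrev Plane : Type := EuclideanSpace ℝ (Fin 2)

/-! ### Spanning trees -/

section Trees

variable {V : Type} [Fintype V] [DecidableEq V]

/-- `T` is the edge set of a spanning tree of `G`. -/
def IsSpanningTree (G : SimpleGraph V) (T : Finset (Sym2 V)) : Prop :=
  (T : Set (Sym2 V)) ⊆ G.edgeSet ∧ (SimpleGraph.fromEdgeSet (T : Set (Sym2 V))).IsTree

/-- `T` is the edge set of a spanning tree of `G` of minimum total weight. -/
def IsMST (G : SimpleGraph V) (w : Sym2 V → ℝ) (T : Finset (Sym2 V)) : Prop :=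
  IsSpanningTree G T ∧ ∀ T', IsSpanningTree G T' → ∑ e ∈ T, w e ≤ ∑ e ∈ T', w e

/-- Minimum spanning trees for weights in the extended reals: a weight `+∞` (the upper limit of
an unbounded uncertainty set) is read as an arbitrarily large real number. For finite weights
this is `IsMST`. -/
def IsLimitTree (G : SimpleGraph V) (b : Sym2 V → EReal) (T : Finset (Sym2 V)) : Prop :=
  ∀ᶠ M : ℝ in Filter.atTop, IsMST G (fun e => (min (b e) (M : EReal)).toReal) T

open Classical in
/-- The edges of the cycle that is closed when `f` is added to the spanning tree `T`. -/
noncomputable def cycleEdges (T : Finset (Sym2 V)) (f : Sym2 V) : Finset (Sym2 V) :=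
  Finset.univ.filter fun e =>
    ∃ (u : V) (p : (SimpleGraph.fromEdgeSet ((insert f T : Finset (Sym2 V)) : Set (Sym2 V))).Walk
      u u), p.IsCycle ∧ e ∈ p.edges

end Trees

/-! ### Uncertainty areas and the associated edge instance -/

/-- Current uncertainty sets of the vertices: the set of a queried vertex is a singleton. -/
abbrev Areas (V : Type) : Type := V → Set Plane

section Areas

variable {V : Type} [Fintype V] [DecidableEq V]

/-- The uncertainty set of an edge in the associated edge instance: all possible distances
between its end vertices. -/
def edgeArea (A : Areas V) (e : Sym2 V) : Set ℝ :=
  {d | ∃ u v : V, e = s(u, v) ∧ ∃ x ∈ A u, ∃ y ∈ A v, d = dist x y}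

/-- The lower limit of an edge. -/
noncomputable def lower (A : Areas V) (e : Sym2 V) : EReal :=
  ⨅ d ∈ edgeArea A e, (d : EReal)

/-- The upper limit of an edge; it is `⊤` if the edge can be arbitrarily long. -/
noncomputable def upper (A : Areas V) (e : Sym2 V) : EReal :=
  ⨆ d ∈ edgeArea A e, (d : EReal)

/-- The uncertainty sets after the vertices in `Q`, which lie at `loc`, have been queried. -/
def reveal (A : Areas V) (loc : V → Plane) (Q : Finset V) : Areas V :=
  fun v => if v ∈ Q then {loc v} else A v

/-- The edge `f` is always maximal in the cycle `C`. -/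
def AlwaysMaximal (A : Areas V) (C : Finset (Sym2 V)) (f : Sym2 V) : Prop :=
  f ∈ C ∧ ∀ e ∈ C, e ≠ f → upper A e ≤ lower A f

/-- Some edge of the cycle `C` is always maximal. -/
def Solved (A : Areas V) (C : Finset (Sym2 V)) : Prop :=
  ∃ f, AlwaysMaximal A C f

/-- The edges of `C` with largest upper limit. -/
def maxUpperEdges (A : Areas V) (C : Finset (Sym2 V)) : Set (Sym2 V) :=
  {g | g ∈ C ∧ ∀ e ∈ C, upper A e ≤ upper A g}

open Classical in
/-- The neighbor set `X(f)` of `f` in the cycle `C`. -/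
noncomputable def neighbors (A : Areas V) (C : Finset (Sym2 V)) (f : Sym2 V) :
    Finset (Sym2 V) :=
  C.filter fun e => e ≠ f ∧ lower A f < upper A e

open Classical in
/-- The non-trivial end vertices of the edge `e`. -/
noncomputable def ends (A : Areas V) (e : Sym2 V) : Finset V :=
  Finset.univ.filter fun v => v ∈ e ∧ (A v).Nontrivial

/-- `W` is a vertex cover of `X` that consists of non-trivial vertices only and contains no
end vertex of `f`. -/
def IsCover (A : Areas V) (X : Finset (Sym2 V)) (f : Sym2 V) (W : Finset V) : Prop :=
  (∀ v ∈ W, (A v).Nontrivial ∧ v ∉ f) ∧ ∀ e ∈ X, ∃ v ∈ W, v ∈ e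

/-- The size of a smallest such vertex cover; it is `⊤` if there is none. -/
noncomputable def coverNumber (A : Areas V) (X : Finset (Sym2 V)) (f : Sym2 V) : ℕ∞ :=
  ⨅ (W : Finset V) (_ : IsCover A X f W), (W.card : ℕ∞)

open Classical in
/-- All smallest such vertex covers. -/
noncomputable def smallestCovers (A : Areas V) (X : Finset (Sym2 V)) (f : Sym2 V) :
    Finset (Finset V) :=
  Finset.univ.filter fun W => IsCover A X f W ∧ (W.card : ℕ∞) = coverNumber A X f

end Areas

/-! ### Instances of the problem -/

/-- What is known beforehand about an instance: a connected graph, a non-empty uncertainty set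
for every vertex, which is a singleton or an open subset of the plane, and query costs. -/
structure Input (V : Type) where
  graph : SimpleGraph V
  connected : graph.Connected
  area : Areas V
  area_nonempty : ∀ v, (area v).Nonempty
  area_spec : ∀ v, (∃ p, area v = {p}) ∨ IsOpen (area v)
  cost : V → ℝ
  cost_pos : ∀ v, 0 < cost v

namespace Input

variable {V : Type} [Fintype V] [DecidableEq V]

/-- No two different cycles of the graph share a non-trivial vertex. -/
def CactusLike (I : Input V) : Prop :=
  ∀ (u v : V) (p : I.graph.Walk u u) (q : I.graph.Walk v v), p.IsCycle → q.IsCycle →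
    (∃ x, x ∈ p.support ∧ x ∈ q.support ∧ (I.area x).Nontrivial) →
    ∀ e, e ∈ p.edges ↔ e ∈ q.edges

/-- All query costs are equal. -/
def UniformCost (I : Input V) : Prop :=
  ∀ u v, I.cost u = I.cost v

/-- The cost of querying all vertices in `Q`. -/
noncomputable def queryCost (I : Input V) (Q : Finset V) : ℝ :=
  ∑ v ∈ Q, I.cost v

/-- `loc` is a possible choice of the true vertex positions. -/
def Realizes (I : Input V) (loc : V → Plane) : Prop :=
  ∀ v, loc v ∈ I.area v

/-- `Q` is a feasible query set if, after the vertices in `Q` have been queried, some spanning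
tree is minimum for all weight functions of the associated edge instance. -/
def Feasible (I : Input V) (loc : V → Plane) (Q : Finset V) : Prop :=
  ∃ T : Finset (Sym2 V), ∀ w : Sym2 V → ℝ,
    (∀ e ∈ I.graph.edgeSet, w e ∈ edgeArea (reveal I.area loc Q) e) → IsMST I.graph w T

/-- The minimum cost of a feasible query set (there are finitely many, and the set of all
vertices is one). -/
noncomputable def opt (I : Input V) (loc : V → Plane) : ℝ :=
  sInf {c | ∃ Q, I.Feasible loc Q ∧ c = I.queryCost Q}

end Input

/-! ### Randomized query algorithms -/

/-- Randomized adaptive query strategies that return a value in `α`: return a value, query a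
vertex and continue depending on its position, or make a random choice and continue depending
on its outcome. -/
inductive QueryAlg (V : Type) (α : Type) : Type 1
  | done (a : α) : QueryAlg V α
  | query (v : V) (k : Plane → QueryAlg V α) : QueryAlg V α
  | rand (β : Type) (p : PMF β) (k : β → QueryAlg V α) : QueryAlg V α

namespace QueryAlg

variable {V : Type} [DecidableEq V] {α β : Type}

/-- Run the first strategy and continue with the second one. -/
def bind : QueryAlg V α → (α → QueryAlg V β) → QueryAlg V β
  | done a, g => g a
  | query v k, g => query v fun x => bind (k x) g
  | rand γ p k, g => rand γ p fun b => bind (k b) g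

instance : Monad (QueryAlg V) where
  pure := done
  bind := bind

/-- The distribution of the set of queried vertices, if the vertices lie at `loc` and those in
`Q` have been queried before. -/
noncomputable def law (loc : V → Plane) : QueryAlg V α → Finset V → PMF (Finset V)
  | done _, Q => PMF.pure Q
  | query v k, Q => law loc (k (loc v)) (insert v Q)
  | rand _ p k, Q => p.bind fun b => law loc (k b) Q

/-- A uniformly random element of `S`, passed on to `k` (`none` only if `S` is empty). -/
noncomputable def uniform (S : Finset β) (k : β → QueryAlg V α) (none : QueryAlg V α) :
    QueryAlg V α :=
  open Classical in
  if h : S.Nonempty then rand β (PMF.uniformOfFinset S h) k else none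

end QueryAlg

/-- A randomized algorithm: it sees the input, but positions only through queries. -/
def RandomizedAlgorithm : Type 1 :=
  ∀ (V : Type) [Fintype V] [DecidableEq V], Input V → QueryAlg V Unit

namespace RandomizedAlgorithm

/-- The distribution of the query set that the algorithm outputs. -/
noncomputable def output (ALG : RandomizedAlgorithm) {V : Type} [Fintype V] [DecidableEq V]
    (I : Input V) (loc : V → Plane) : PMF (Finset V) :=
  (ALG V I).law loc ∅

/-- The expected query cost of the algorithm. -/
noncomputable def expectedCost (ALG : RandomizedAlgorithm) {V : Type} [Fintype V]
    [DecidableEq V] (I : Input V) (loc : V → Plane) : ℝ :=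
  ∑ Q : Finset V, (ALG.output I loc Q).toReal * I.queryCost Q

/-- On all cactus-like instances with uniform query costs the algorithm outputs a feasible query
set, and its expected cost is at most `c` times the optimum. -/
def CompetitiveOnCactusLike (ALG : RandomizedAlgorithm) (c : ℝ) : Prop :=
  ∀ (V : Type) [Fintype V] [DecidableEq V] (I : Input V) (loc : V → Plane),
    I.CactusLike → I.UniformCost → I.Realizes loc →
      (∀ Q ∈ (ALG.output I loc).support, I.Feasible loc Q) ∧
      ALG.expectedCost I loc ≤ c * I.opt loc

end RandomizedAlgorithm

/-! ### The algorithm V-Random_C -/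

/-- A rule that resolves the arbitrary choices of the algorithm: it selects an element of any
non-empty set, depending on the current uncertainty sets. -/
structure TieBreak (V : Type) where
  pick : ∀ {α : Type} [Nonempty α], Areas V → Set α → α
  pick_mem : ∀ {α : Type} [Nonempty α] (A : Areas V) (S : Set α), S.Nonempty → pick A S ∈ S

section Algorithm

variable {V : Type} [Fintype V] [DecidableEq V]

instance [Nonempty V] : Nonempty (Sym2 V) :=
  ‹Nonempty V›.map fun v => s(v, v)

open QueryAlg

/-- Query the vertices in the list one after the other. -/
noncomputable def queryList : Areas V → List V → QueryAlg V (Areas V)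
  | A, [] => done A
  | A, v :: l => query v fun x => queryList (Function.update A v {x}) l

/-- Query all vertices in `S`. -/
noncomputable def querySet (A : Areas V) (S : Finset V) : QueryAlg V (Areas V) :=
  queryList A S.toList

open Classical in
/-- Query the vertices in the list one after the other, but stop as soon as an edge of `C` is
always maximal. -/
noncomputable def queryUntil (C : Finset (Sym2 V)) : Areas V → List V → QueryAlg V (Areas V)
  | A, [] => done A
  | A, v :: l => if Solved A C then done A else
      query v fun x => queryUntil C (Function.update A v {x}) l

variable [Nonempty V] (tb : TieBreak V)

open Classical in
/-- At most `n` rounds of the deterministic procedure: while no edge of `C` is always maximal,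
query the end vertices of an edge with largest upper limit. -/
noncomputable def detRounds (C : Finset (Sym2 V)) : ℕ → Areas V → QueryAlg V (Areas V)
  | 0, A => done A
  | n + 1, A => if Solved A C then done A else do
      let A' ← querySet A (ends A (tb.pick A (maxUpperEdges A C)))
      detRounds C n A'

/-- The deterministic procedure. Every round queries at least one new vertex, so that the bound
on the number of rounds is never active. -/
noncomputable def detLoop (C : Finset (Sym2 V)) (A : Areas V) : QueryAlg V (Areas V) :=
  detRounds tb C (Fintype.card V) A

open Classical in
/-- The subroutine Rand3: two deterministic rounds, one round in which a fair coin decides which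
end vertex is queried first, and then the deterministic procedure. -/
noncomputable def rand3 (C : Finset (Sym2 V)) (A : Areas V) : QueryAlg V (Areas V) := do
  let A₁ ← detRounds tb C 2 A
  if Solved A₁ C then done A₁ else do
    let S := ends A₁ (tb.pick A₁ (maxUpperEdges A₁ C))
    let A₂ ← uniform S
      (fun u => queryUntil C A₁ (u :: (S.erase u).toList))
      (done A₁)
    detLoop tb C A₂

open Classical in
/-- The subroutine Rand1: query the non-trivial vertices of `f` and the non-trivial vertices
common to all edges of `X` in uniformly random order until an edge of `C` is always maximal;
if this does not suffice, query the remaining vertices of `X`. -/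
noncomputable def rand1 (C X : Finset (Sym2 V)) (f : Sym2 V) (A : Areas V) :
    QueryAlg V (Areas V) := do
  let S : Finset V := Finset.univ.filter fun v =>
    (A v).Nontrivial ∧ (v ∈ f ∨ ∀ e ∈ X, v ∈ e)
  let A₁ ← uniform (Finset.univ : Finset (Fin S.card ≃ {v // v ∈ S}))
    (fun σ => queryUntil C A (List.ofFn fun i => (σ i : V)))
    (done A)
  if Solved A₁ C then done A₁ else querySet A₁ (X.biUnion (ends A₁))

open Classical in
/-- The subroutine Rand2, to be run after the end vertices of `f` have been queried, with
current uncertainty sets `A`: query a uniformly random element `W` of `covers`, beginning with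
a vertex of `g`, and proceed with the deterministic procedure. -/
noncomputable def rand2 (C : Finset (Sym2 V)) (covers : Finset (Finset V)) (g : Sym2 V)
    (A : Areas V) : QueryAlg V (Areas V) :=
  if Solved A C then done A else do
    let A₁ ← uniform covers
      (fun W =>
        let v : V := tb.pick A {v | v ∈ W ∧ v ∈ g}
        queryUntil C A (v :: (W.erase v).toList))
      (done A)
    detLoop tb C A₁

open Classical in
/-- The treatment of the cycle that `f` closes in the tree `T`. -/
noncomputable def cycleStep (T : Finset (Sym2 V)) (A : Areas V) (f : Sym2 V) :
    QueryAlg V (Areas V) :=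
  let C := cycleEdges T f
  let X := neighbors A C f
  let a := coverNumber A X f
  if Solved A C then done A
  else if a = 1 then rand1 C X f A
  else do
    let A' ← querySet A (ends A f)
    let g := tb.pick A' (maxUpperEdges A' C)
    -- both end vertices of `f` are known by now, so that `lower A' f` is the weight of `f`
    if 3 ≤ a ∨ lower A' f ≤ lower A' g then rand3 tb C A'
    else rand2 tb C (smallestCovers A X f) g A'

/-- The edge sets that are both a lower and an upper limit tree. -/
def commonTrees (G : SimpleGraph V) (A : Areas V) : Set (Finset (Sym2 V)) :=
  {T | IsLimitTree G (lower A) T ∧ IsLimitTree G (upper A) T}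

/-- The edges in `T_L \ T_U`, where `T_L` is a lower and `T_U` an upper limit tree, chosen such
that the two differ as little as possible. -/
def conflictEdges (G : SimpleGraph V) (A : Areas V) : Set (Sym2 V) :=
  {e | ∃ TL TU : Finset (Sym2 V), IsLimitTree G (lower A) TL ∧ IsLimitTree G (upper A) TU ∧
    (∀ SL SU : Finset (Sym2 V), IsLimitTree G (lower A) SL → IsLimitTree G (upper A) SU →
      (TL \ TU).card ≤ (SL \ SU).card) ∧
    e ∈ TL \ TU}

open Classical in
/-- At most `n` rounds of the preprocessing: while the lower and the upper limit tree differ,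
query the end vertices of an edge in their difference. -/
noncomputable def preprocess (G : SimpleGraph V) : ℕ → Areas V → QueryAlg V (Areas V)
  | 0, A => done A
  | n + 1, A => if (commonTrees G A).Nonempty then done A else do
      let A' ← querySet A (ends A (tb.pick A (conflictEdges G A)))
      preprocess G n A'

/-- V-Random_C on a given input. Every round of the preprocessing queries at least one new
vertex, so that the bound on the number of rounds is never active. -/
noncomputable def vRandomCOn (I : Input V) : QueryAlg V Unit := do
  let A ← preprocess tb I.graph (Fintype.card V) I.area
  let T := tb.pick A (commonTrees I.graph A)
  let fs := tb.pick A {l : List (Sym2 V) | l.Nodup ∧ ∀ e, e ∈ l ↔ e ∈ I.graph.edgeSet ∧ e ∉ T}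
  let _ ← fs.foldlM (cycleStep tb T) A
  done ()

end Algorithm

/-- The algorithm V-Random_C, for a given way of resolving its arbitrary choices. -/
noncomputable def vRandomC (tb : ∀ V : Type, TieBreak V) : RandomizedAlgorithm :=
  fun V _ _ I =>
    haveI := I.connected.nonempty
    vRandomCOn (tb V) I

end VMST

/-! Upper bound. Fix a feasible set `Q` and compare every cost with `|Q|`. The engine is
`alwaysMaximal_of_disjoint`: if `e` has the largest upper limit in an unsolved cycle and a solving
set avoids the non-trivial ends of `e`, then `e` itself must become always maximal, because limits
of open sets are not attained. By `not_disjoint_of_disjoint` such a miss can happen only once. Every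
other deterministic round queries at most two vertices, one of them in `Q`. Hence `|R| + κ|Q \ R| +
b` never increases, where `R` is the set of queried vertices, `κ` bounds the queries of a round and
`b` pays for the one possible miss (`exists_missBound_round`).

When a cycle is treated, its closing edge `f` has both the largest lower and the largest upper
limit. If `Q` avoids `f`, it must cover `X` (`isCover_of_disjoint`), so `|Q| ≥ a`, and after `f` has
been queried no further miss is possible. If `Q` meets `f`, a later miss costs at most one query
(`missBound_one`). The critical cases are `|Q| = 1` in Rand1 (a vertex among at most four in random
order has mean position at most 5/2), `|Q| = 2` in Rand2 (two queries for `f`, two for a random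
cover, on average at most one more) and `|Q| = 3` in Rand3 (2 + 4 queries and 3/2 for the coin
round). The remaining cases with small `|Q|` fit the same bound, and large `|Q|` leaves slack.

Globally, each preprocessing round hits every feasible set (`not_disjoint_conflictEdge`). In a
cactus-like graph the cycles with non-trivial vertices are fundamental cycles of every spanning
tree, and they share no non-trivial vertices, so their costs add up (`wp_foldlM_cycleStep_le`).
Infeasible outcomes are given cost `∞`, so the finite bound on the expectation also proves
feasibility.

Lower bound. On a four-cycle with two long edges, querying one special vertex decides which is
longer, but all other vertices answer in a way that carries no information. Any strategy needs `1 +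
2 + 3 + 4 = 10` expected queries in total over the four choices of this vertex
(`sum_range_le_sum_wp`), while the optimum is at most one each time. -/

namespace VMST

set_option linter.unusedSectionVars false

open scoped ENNReal
open QueryAlg

/-! ### Spanning trees, fundamental cycles and edge exchanges. -/

section Graphs

open SimpleGraph

variable {V : Type} [Fintype V] [DecidableEq V] {G : SimpleGraph V} {T : Finset (Sym2 V)}
  {f e : Sym2 V}

/-- The graph with edge set `T`. -/
abbrev graphOf (T : Finset (Sym2 V)) : SimpleGraph V :=
  SimpleGraph.fromEdgeSet (T : Set (Sym2 V))

theorem edgeSet_graphOf (hT : (T : Set (Sym2 V)) ⊆ G.edgeSet) :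
    (graphOf T).edgeSet = (T : Set (Sym2 V)) := by
  rw [edgeSet_fromEdgeSet]
  ext e
  simp only [Set.mem_sdiff, and_iff_left_iff_imp]
  exact fun he h => G.not_isDiag_of_mem_edgeSet (hT he) h

theorem mem_edgeSet_graphOf (hT : (T : Set (Sym2 V)) ⊆ G.edgeSet) :
    e ∈ (graphOf T).edgeSet ↔ e ∈ T := by
  rw [edgeSet_graphOf hT]; simp

theorem insert_subset_edgeSet (hT : (T : Set (Sym2 V)) ⊆ G.edgeSet) (hf : f ∈ G.edgeSet) :
    ((insert f T : Finset (Sym2 V)) : Set (Sym2 V)) ⊆ G.edgeSet := by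
  intro e he
  simp only [Finset.coe_insert, Set.mem_insert_iff] at he
  rcases he with rfl | he
  · exact hf
  · exact hT he

/-- An edge lies on a cycle exactly if it is not a bridge; this turns deletion of a cycle edge into
a statement about connectedness. -/
theorem mem_cycleEdges_iff (hT : (T : Set (Sym2 V)) ⊆ G.edgeSet) (hf : f ∈ G.edgeSet) :
    e ∈ cycleEdges T f ↔ e ∈ insert f T ∧ ¬ (graphOf (insert f T)).IsBridge e := by
  have hs := insert_subset_edgeSet hT hf
  have key := mem_edgeSet_graphOf (e := e) hs
  simp only [cycleEdges, Finset.mem_filter, Finset.mem_univ, true_and]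
  constructor
  · rintro ⟨u, p, hp, he⟩
    have h1 := p.edges_subset_edgeSet he
    refine ⟨key.1 h1, ?_⟩
    intro hb
    exact hb.notMem_edges_of_isCycle hp he
  · rintro ⟨h1, h2⟩
    rw [isBridge_iff_forall_cycle_notMem (key.2 h1)] at h2
    push Not at h2
    obtain ⟨u, p, hp, he⟩ := h2
    exact ⟨u, p, hp, he⟩

theorem isSpanningTree_iff_card [Nonempty V] :
    IsSpanningTree G T ↔ (T : Set (Sym2 V)) ⊆ G.edgeSet ∧ (graphOf T).Connected ∧
      T.card + 1 = Fintype.card V := by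
  unfold IsSpanningTree
  refine and_congr_right fun h => ?_
  rw [isTree_iff_connected_and_card, edgeSet_graphOf h]
  simp

theorem graphOf_erase : graphOf (T.erase e) = (graphOf T).deleteEdges {e} := by
  ext a b
  simp only [graphOf, fromEdgeSet_adj, deleteEdges_adj, Finset.coe_erase, Set.mem_sdiff,
    Set.mem_singleton_iff]
  tauto

theorem graphOf_mono {S : Finset (Sym2 V)} (h : T ⊆ S) : graphOf T ≤ graphOf S :=
  fromEdgeSet_mono (by exact_mod_cast h)

theorem cycleEdges_subset (hT : IsSpanningTree G T) (hf : f ∈ G.edgeSet) :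
    cycleEdges T f ⊆ insert f T :=
  fun _ he => ((mem_cycleEdges_iff hT.1 hf).1 he).1

theorem cycleEdges_subset_edgeSet (hT : IsSpanningTree G T) (hf : f ∈ G.edgeSet)
    (he : e ∈ cycleEdges T f) : e ∈ G.edgeSet :=
  insert_subset_edgeSet hT.1 hf (cycleEdges_subset hT hf he)

/-- Exchanging an edge of a spanning tree along a fundamental cycle. -/
theorem IsSpanningTree.exchange (hT : IsSpanningTree G T) (hf : f ∈ G.edgeSet) (hfT : f ∉ T)
    (he : e ∈ cycleEdges T f) : IsSpanningTree G ((insert f T).erase e) := by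
  have := hT.2.connected.nonempty
  obtain ⟨h1, h2, h3⟩ := isSpanningTree_iff_card.1 hT
  obtain ⟨he1, he2⟩ := (mem_cycleEdges_iff hT.1 hf).1 he
  refine isSpanningTree_iff_card.2 ⟨?_, ?_, ?_⟩
  · exact fun x hx => insert_subset_edgeSet h1 hf (Finset.mem_of_mem_erase hx)
  · rw [graphOf_erase]
    induction e with
    | h x y =>
      refine Connected.connected_delete_edge_of_not_isBridge ?_ he2
      exact h2.mono (graphOf_mono (Finset.subset_insert _ _))
  · rw [Finset.card_erase_of_mem he1, Finset.card_insert_of_notMem hfT]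
    simpa using h3

theorem self_mem_cycleEdges (hT : IsSpanningTree G T) (hf : f ∈ G.edgeSet) (hfT : f ∉ T) :
    f ∈ cycleEdges T f := by
  rw [mem_cycleEdges_iff hT.1 hf]
  refine ⟨Finset.mem_insert_self _ _, ?_⟩
  induction f with
  | h x y =>
    rw [isBridge_iff, not_not, ← graphOf_erase, Finset.erase_insert hfT]
    exact hT.2.connected.preconnected x y

/-- The fundamental cycle is the only cycle in the tree with the additional edge. -/
theorem mem_edges_of_mem_cycleEdges (hT : IsSpanningTree G T) (hf : f ∈ G.edgeSet) (hfT : f ∉ T)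
    {u : V} {p : (graphOf (insert f T)).Walk u u} (hp : p.IsCycle) (he : e ∈ cycleEdges T f) :
    e ∈ p.edges := by
  by_contra hep
  -- A cycle avoiding `e` would survive in the spanning tree obtained by exchanging `e` for `f`.
  have hT' := hT.exchange hf hfT he
  have hq : ∀ e' ∈ p.edges, e' ∈ (graphOf ((insert f T).erase e)).edgeSet := by
    intro e' he'
    rw [mem_edgeSet_graphOf hT'.1]
    exact Finset.mem_erase.2 ⟨fun h => hep (h ▸ he'),
      (mem_edgeSet_graphOf (insert_subset_edgeSet hT.1 hf)).1 (p.edges_subset_edgeSet he')⟩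
  exact hT'.2.isAcyclic _ (hp.transfer hq)

/-- The fundamental cycle is a cycle of the graph. -/
theorem exists_cycle_eq_cycleEdges (hT : IsSpanningTree G T) (hf : f ∈ G.edgeSet) (hfT : f ∉ T) :
    ∃ (u : V) (p : G.Walk u u), p.IsCycle ∧ ∀ e, e ∈ cycleEdges T f ↔ e ∈ p.edges := by
  have hfC := self_mem_cycleEdges hT hf hfT
  have hs := insert_subset_edgeSet hT.1 hf
  obtain ⟨u, p, hp, hfp⟩ := by simpa [cycleEdges] using hfC
  have hle : fromEdgeSet ((insert f T : Finset (Sym2 V)) : Set (Sym2 V)) ≤ G := by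
    intro a b hab
    exact hs hab.1
  refine ⟨u, p.map (Hom.ofLE (by simpa using hle)), ?_, ?_⟩
  · exact (Walk.isCycle_map_iff_of_injective (fun _ _ h => h)).2 hp
  · intro e
    have : (p.map (Hom.ofLE (by simpa using hle))).edges = p.edges := by
      rw [Walk.edges_map]
      convert List.map_id _
      simp [Hom.ofLE]
    rw [this]
    constructor
    · exact mem_edges_of_mem_cycleEdges hT hf hfT hp
    · intro he
      simp only [cycleEdges, Finset.mem_filter, Finset.mem_univ, true_and]
      exact ⟨u, p, hp, he⟩

/-- A walk in the graph that joins the ends of a tree edge, but avoids it, has an edge whose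
fundamental cycle contains the tree edge. -/
theorem exists_mem_cycleEdges_of_walk (hT : IsSpanningTree G T) {x y : V} (he : s(x, y) ∈ T)
    (p : G.Walk x y) (hp : s(x, y) ∉ p.edges) :
    ∃ f ∈ p.edges, f ∉ T ∧ s(x, y) ∈ cycleEdges T f := by
  -- `S` is the side of `x` in the tree without the edge. The walk has to leave `S` through another
  -- edge, and this edge cannot be a tree edge.
  set S : Set V := {z | ((graphOf T).deleteEdges {s(x, y)}).Reachable x z} with hS
  have heT : s(x, y) ∈ (graphOf T).edgeSet := (mem_edgeSet_graphOf hT.1).2 he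
  have hb : (graphOf T).IsBridge s(x, y) :=
    (isAcyclic_iff_forall_isBridge.1 hT.2.isAcyclic) heT
  have hy : y ∉ S := by
    rw [isBridge_iff] at hb
    exact hb
  obtain ⟨d, hd, hd1, hd2⟩ := p.exists_boundary_dart S (Reachable.refl x) hy
  have hdp : d.edge ∈ p.edges := List.mem_map_of_mem hd
  have hdG : d.edge ∈ G.edgeSet := p.edges_subset_edgeSet hdp
  have hne : d.edge ≠ s(x, y) := fun h => hp (h ▸ hdp)
  have hdT : d.edge ∉ T := by
    intro h
    apply hd2
    have hadj : ((graphOf T).deleteEdges {s(x, y)}).Adj d.fst d.snd := by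
      rw [deleteEdges_adj]
      refine ⟨?_, fun h => hne (Set.mem_singleton_iff.1 h)⟩
      exact (mem_edgeSet_graphOf (e := s(d.fst, d.snd)) hT.1).2 h
    exact Reachable.trans hd1 hadj.reachable
  refine ⟨d.edge, hdp, hdT, ?_⟩
  obtain ⟨q, hq⟩ := hT.2.connected.exists_isPath d.snd d.fst
  have heq : s(x, y) ∈ q.edges := by
    by_contra h
    apply hd2
    have : ((graphOf T).deleteEdges {s(x, y)}).Reachable d.snd d.fst :=
      reachable_deleteEdges_iff_exists_walk.2 ⟨q, h⟩
    exact Reachable.trans hd1 this.symm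
  simp only [cycleEdges, Finset.mem_filter, Finset.mem_univ, true_and]
  have hle : graphOf T ≤ graphOf (insert d.edge T) := graphOf_mono (Finset.subset_insert _ _)
  have hadj : (graphOf (insert d.edge T)).Adj d.fst d.snd := by
    rw [graphOf, fromEdgeSet_adj]
    exact ⟨by simp [Dart.edge, Sym2.mk], d.adj.ne⟩
  have hedges : (q.map (Hom.ofLE hle)).edges = q.edges := by
    rw [Walk.edges_map]
    convert List.map_id _
    simp [Hom.ofLE]
  have hpath : (q.map (Hom.ofLE hle)).IsPath := hq.map (fun _ _ h => h)
  refine ⟨d.fst, Walk.cons hadj (q.map (Hom.ofLE hle)), ?_, ?_⟩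
  · rw [Walk.cons_isCycle_iff]
    refine ⟨hpath, ?_⟩
    rw [hedges]
    intro h
    exact hdT ((mem_edgeSet_graphOf (e := s(d.fst, d.snd)) hT.1).1 (q.edges_subset_edgeSet h))
  · rw [Walk.edges_cons, hedges]
    exact List.mem_cons_of_mem _ heq

end Graphs

/-! ### Minimum spanning trees and limit trees via fundamental cycles. -/

section Minimum

open SimpleGraph

variable {V : Type} [Fintype V] [DecidableEq V] {G : SimpleGraph V} {T : Finset (Sym2 V)}
  {f e : Sym2 V}

/-- The path in `T₂` between the ends of `e` crosses the cut that `e` defines in `T₁`. The crossing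
edge lies on both fundamental cycles, so the exchange is possible in both trees. -/
theorem exists_symm_exchange {T₁ T₂ : Finset (Sym2 V)} (h₁ : IsSpanningTree G T₁)
    (h₂ : IsSpanningTree G T₂) (he : e ∈ T₁) (he' : e ∉ T₂) :
    ∃ f ∈ T₂, f ∉ T₁ ∧ e ∈ cycleEdges T₁ f ∧ f ∈ cycleEdges T₂ e := by
  induction e with
  | h x y =>
    have hle : graphOf T₂ ≤ G := fun a b hab => h₂.1 hab.1
    obtain ⟨q, hq⟩ := h₂.2.connected.exists_isPath x y
    have hedges : (q.map (Hom.ofLE hle)).edges = q.edges := by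
      rw [Walk.edges_map]
      convert List.map_id _
      simp [Hom.ofLE]
    have hsub : ∀ f ∈ q.edges, f ∈ T₂ := fun f hf =>
      (mem_edgeSet_graphOf h₂.1).1 (q.edges_subset_edgeSet hf)
    have hxy : (x ≠ y) := (h₁.1 he : G.Adj x y).ne
    obtain ⟨f, hf, hf₁, hf₂⟩ := exists_mem_cycleEdges_of_walk h₁ he (q.map (Hom.ofLE hle))
      (by rw [hedges]; exact fun h => he' (hsub _ h))
    rw [hedges] at hf
    refine ⟨f, hsub f hf, hf₁, hf₂, ?_⟩
    simp only [cycleEdges, Finset.mem_filter, Finset.mem_univ, true_and]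
    have hle' : graphOf T₂ ≤ graphOf (insert s(x, y) T₂) := graphOf_mono (Finset.subset_insert _ _)
    have hadj : (graphOf (insert s(x, y) T₂)).Adj y x := by
      rw [graphOf, fromEdgeSet_adj]
      exact ⟨by simp [Sym2.eq_swap], hxy.symm⟩
    have hedges' : (q.map (Hom.ofLE hle')).edges = q.edges := by
      rw [Walk.edges_map]
      convert List.map_id _
      simp [Hom.ofLE]
    refine ⟨y, Walk.cons hadj (q.map (Hom.ofLE hle')), ?_, ?_⟩
    · rw [Walk.cons_isCycle_iff]
      refine ⟨hq.map (fun _ _ h => h), ?_⟩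
      rw [hedges', Sym2.eq_swap]
      exact fun h => he' (hsub _ h)
    · rw [Walk.edges_cons, hedges']
      exact List.mem_cons_of_mem _ hf

theorem sum_exchange {M : Type*} [AddCommGroup M] (w : Sym2 V → M) (hfT : f ∉ T)
    (he : e ∈ insert f T) : ∑ x ∈ (insert f T).erase e, w x = ∑ x ∈ T, w x + w f - w e := by
  rw [Finset.sum_erase_eq_sub he, Finset.sum_insert hfT]
  abel

theorem IsMST.le_of_mem_cycleEdges {w : Sym2 V → ℝ} (hT : IsMST G w T) (hf : f ∈ G.edgeSet)
    (hfT : f ∉ T) (he : e ∈ cycleEdges T f) : w e ≤ w f := by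
  have h := hT.2 _ (hT.1.exchange hf hfT he)
  rw [sum_exchange w hfT (cycleEdges_subset hT.1 hf he)] at h
  linarith

/-- Any competing tree is moved towards `T` by symmetric exchanges, none of which increases its
weight; the induction is on the number of its edges outside `T`. -/
theorem isMST_of_forall_cycleEdges {w : Sym2 V → ℝ} (hT : IsSpanningTree G T)
    (h : ∀ f ∈ G.edgeSet, f ∉ T → ∀ e ∈ cycleEdges T f, w e ≤ w f) : IsMST G w T := by
  refine ⟨hT, fun T' hT' => ?_⟩
  induction hn : (T' \ T).card using Nat.strong_induction_on generalizing T' with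
  | _ n ih =>
    by_cases hsub : T' ⊆ T
    · have := hT.2.connected.nonempty
      have h1 := (isSpanningTree_iff_card.1 hT).2.2
      have h2 := (isSpanningTree_iff_card.1 hT').2.2
      rw [Finset.eq_of_subset_of_card_le hsub (by omega)]
    · obtain ⟨e, he, heT⟩ := Finset.not_subset.1 hsub
      obtain ⟨f, hf, hfT', hef, hfe⟩ := exists_symm_exchange hT' hT he heT
      have hT'' := hT'.exchange (hT.1 hf) hfT' hef
      have hlt : (((insert f T').erase e) \ T).card < n := by
        rw [← hn]
        refine Finset.card_lt_card ((Finset.ssubset_iff_of_subset ?_).2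
          ⟨e, Finset.mem_sdiff.2 ⟨he, heT⟩, by simp⟩)
        intro x hx
        simp only [Finset.mem_sdiff, Finset.mem_erase, Finset.mem_insert] at hx ⊢
        rcases hx with ⟨⟨_, rfl | hx⟩, hx'⟩
        · exact absurd hf hx'
        · exact ⟨hx, hx'⟩
      have h1 := ih _ hlt _ hT'' rfl
      rw [sum_exchange w hfT' (cycleEdges_subset hT' (hT.1 hf) hef)] at h1
      have h2 := h e (hT'.1 he) heT f hfe
      linarith

theorem exists_isMST (hG : G.Connected) (w : Sym2 V → ℝ) : ∃ T, IsMST G w T := by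
  classical
  obtain ⟨H, hle, hH⟩ := hG.exists_isTree_le
  have hne : (Finset.univ.filter fun T : Finset (Sym2 V) => IsSpanningTree G T).Nonempty := by
    refine ⟨H.edgeFinset, ?_⟩
    rw [Finset.mem_filter]
    refine ⟨Finset.mem_univ _, ?_, ?_⟩
    · simpa using hle
    · simpa using hH
  obtain ⟨T, hT, hmin⟩ := Finset.exists_min_image _ (fun T => ∑ e ∈ T, w e) hne
  rw [Finset.mem_filter] at hT
  exact ⟨T, hT.2, fun T' hT' => hmin T' (Finset.mem_filter.2 ⟨Finset.mem_univ _, hT'⟩)⟩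

theorem toReal_min_le_toReal_min {a b : EReal} (ha : a ≠ ⊥) (h : a ≤ b) (M : ℝ) :
    (min a (M : EReal)).toReal ≤ (min b (M : EReal)).toReal := by
  refine EReal.toReal_le_toReal (min_le_min_right _ h) ?_ ?_
  · rw [← bot_lt_iff_ne_bot, lt_min_iff]
    exact ⟨bot_lt_iff_ne_bot.2 ha, EReal.bot_lt_coe M⟩
  · rw [← lt_top_iff_ne_top]
    exact (min_le_right _ _).trans_lt (EReal.coe_lt_top M)

theorem toReal_min_lt_toReal_min {a b : EReal} (ha : a ≠ ⊥) (h : a < b) {M : ℝ}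
    (hM : a < (M : EReal)) : (min a (M : EReal)).toReal < (min b (M : EReal)).toReal := by
  rw [min_eq_left hM.le, ← EReal.coe_lt_coe_iff, EReal.coe_toReal (ne_top_of_lt h) ha,
    EReal.coe_toReal]
  · exact lt_min h hM
  · rw [← lt_top_iff_ne_top]
    exact (min_le_right _ _).trans_lt (EReal.coe_lt_top M)
  · rw [← bot_lt_iff_ne_bot]
    exact (bot_lt_iff_ne_bot.2 ha).trans (lt_min h hM)

theorem eventually_lt_coe {a b : EReal} (h : a < b) : ∀ᶠ M : ℝ in Filter.atTop, a < (M : EReal) := by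
  obtain ⟨r, hr, _⟩ := EReal.lt_iff_exists_real_btwn.1 h
  filter_upwards [Filter.eventually_ge_atTop r] with M hM
  exact hr.trans_le (EReal.coe_le_coe_iff.2 hM)

/-- Truncation at `M` preserves weak inequalities for every `M`, and preserves a given strict
inequality once `M` exceeds its smaller side. Hence the limit condition can be read off the extended
weights directly. -/
theorem isLimitTree_iff {b : Sym2 V → EReal} (hb : ∀ e, b e ≠ ⊥) :
    IsLimitTree G b T ↔ IsSpanningTree G T ∧
      ∀ f ∈ G.edgeSet, f ∉ T → ∀ e ∈ cycleEdges T f, b e ≤ b f := by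
  constructor
  · intro h
    obtain ⟨M, hM⟩ := h.exists
    refine ⟨hM.1, fun f hf hfT e he => ?_⟩
    by_contra hlt
    rw [not_le] at hlt
    obtain ⟨M, hM, hM'⟩ := (h.and (eventually_lt_coe hlt)).exists
    exact (hM.le_of_mem_cycleEdges hf hfT he).not_gt (toReal_min_lt_toReal_min (hb f) hlt hM')
  · rintro ⟨hT, h⟩
    refine Filter.Eventually.of_forall fun M => isMST_of_forall_cycleEdges hT ?_
    exact fun f hf hfT e he => toReal_min_le_toReal_min (hb e) (h f hf hfT e he) M

/-- There are finitely many pairs of edges, so one `M` preserves all strict comparisons; a minimum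
spanning tree for this truncation is a limit tree. -/
theorem exists_isLimitTree (hG : G.Connected) {b : Sym2 V → EReal} (hb : ∀ e, b e ≠ ⊥) :
    ∃ T, IsLimitTree G b T := by
  have h : ∀ᶠ M : ℝ in Filter.atTop, ∀ e f, b f < b e → b f < (M : EReal) := by
    rw [Filter.eventually_all]
    intro e
    rw [Filter.eventually_all]
    intro f
    by_cases hlt : b f < b e
    · filter_upwards [eventually_lt_coe hlt] with M hM _ using hM
    · exact Filter.Eventually.of_forall fun _ h => absurd h hlt
  obtain ⟨M, hM⟩ := h.exists
  obtain ⟨T, hT⟩ := exists_isMST hG fun e => (min (b e) (M : EReal)).toReal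
  refine ⟨T, (isLimitTree_iff hb).2 ⟨hT.1, fun f hf hfT e he => ?_⟩⟩
  by_contra hlt
  rw [not_le] at hlt
  exact (hT.le_of_mem_cycleEdges hf hfT he).not_gt
    (toReal_min_lt_toReal_min (hb f) hlt (hM e f hlt))

theorem IsLimitTree.exchange {b : Sym2 V → EReal} (hT : IsLimitTree G b T)
    (hf : f ∈ G.edgeSet) (hfT : f ∉ T) (he : e ∈ cycleEdges T f) (hef : b e = b f) :
    IsLimitTree G b ((insert f T).erase e) := by
  unfold IsLimitTree at hT ⊢
  filter_upwards [hT] with M hM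
  refine ⟨hM.1.exchange hf hfT he, fun T' hT' => ?_⟩
  rw [sum_exchange _ hfT (cycleEdges_subset hM.1 hf he), hef]
  simpa using hM.2 T' hT'

/-- An edge in the difference of a lower and an upper limit tree that differ as little as possible
has a partner with strictly smaller uncertainty. -/
theorem exists_conflict_partner {a b : Sym2 V → EReal} (ha : ∀ e, a e ≠ ⊥) (hb : ∀ e, b e ≠ ⊥)
    {S T : Finset (Sym2 V)} (hS : IsLimitTree G a S) (hT : IsLimitTree G b T)
    (hmin : ∀ S' T', IsLimitTree G a S' → IsLimitTree G b T' → (S \ T).card ≤ (S' \ T').card)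
    (he : e ∈ S \ T) :
    ∃ f ∈ T, f ∉ S ∧ e ∈ cycleEdges S f ∧ f ∈ cycleEdges T e ∧ a e < a f ∧ b f < b e := by
  obtain ⟨hS', hSa⟩ := (isLimitTree_iff ha).1 hS
  obtain ⟨hT', hTb⟩ := (isLimitTree_iff hb).1 hT
  obtain ⟨heS, heT⟩ := Finset.mem_sdiff.1 he
  obtain ⟨f, hf, hfS, hef, hfe⟩ := exists_symm_exchange hS' hT' heS heT
  refine ⟨f, hf, hfS, hef, hfe, lt_of_le_of_ne (hSa f (hT'.1 hf) hfS e hef) ?_,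
    lt_of_le_of_ne (hTb e (hS'.1 heS) heT f hfe) ?_⟩
  · intro h
    -- With equal lower limits, exchanging `e` for `f` in `S` would give a lower limit tree closer
    -- to `T`. The other bullet is the same argument with the exchange made in `T`.
    refine (hmin _ _ (hS.exchange (hT'.1 hf) hfS hef h) hT).not_gt ?_
    refine Finset.card_lt_card ((Finset.ssubset_iff_of_subset ?_).2 ⟨e, he, by simp⟩)
    intro x hx
    simp only [Finset.mem_sdiff, Finset.mem_erase, Finset.mem_insert] at hx ⊢
    rcases hx with ⟨⟨_, rfl | hx⟩, hx'⟩
    · exact absurd hf hx'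
    · exact ⟨hx, hx'⟩
  · intro h
    refine (hmin _ _ hS (hT.exchange (hS'.1 heS) heT hfe h)).not_gt ?_
    refine Finset.card_lt_card ((Finset.ssubset_iff_of_subset ?_).2 ⟨e, he, ?_⟩)
    · intro x hx
      simp only [Finset.mem_sdiff, Finset.mem_erase, Finset.mem_insert, not_and, not_or] at hx ⊢
      refine ⟨hx.1, fun hxT => ?_⟩
      by_cases hxf : x = f
      · exact hfS (hxf ▸ hx.1)
      · exact (hx.2 hxf).2 hxT
    · have hne : e ≠ f := fun h' => hfS (h' ▸ heS)
      simp [hne]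

end Minimum

/-! ### Cycles as edge sets with vertex degrees zero or two. -/

section Cycles

open SimpleGraph

variable {V : Type} [Fintype V] [DecidableEq V] {G : SimpleGraph V} {T : Finset (Sym2 V)}

/-- A set of edges in which every vertex has degree zero or two. -/
structure IsCycleSet (C : Finset (Sym2 V)) : Prop where
  not_isDiag : ∀ e ∈ C, ¬ e.IsDiag
  exists_ne : ∀ e ∈ C, ∀ v ∈ e, ∃ e' ∈ C, e' ≠ e ∧ v ∈ e'
  card_le_two : ∀ v, (C.filter fun e => v ∈ e).card ≤ 2

theorem isCycleSet_of_isCycle {u : V} {p : G.Walk u u} (hp : p.IsCycle) {C : Finset (Sym2 V)}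
    (hC : ∀ e, e ∈ C ↔ e ∈ p.edges) : IsCycleSet C := by
  classical
  have hfil : ∀ v, C.filter (fun e => v ∈ e) =
      ((p.toSubgraph.neighborSet v).toFinset).image (fun w => s(v, w)) := by
    intro v
    ext e
    simp only [Finset.mem_filter, hC, Finset.mem_image, Set.mem_toFinset,
      Subgraph.mem_neighborSet, ← Walk.mem_edges_toSubgraph]
    constructor
    · rintro ⟨he, hv⟩
      obtain ⟨w, rfl⟩ := Sym2.mem_iff_exists.1 hv
      exact ⟨w, he, rfl⟩
    · rintro ⟨w, hw, rfl⟩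
      exact ⟨hw, Sym2.mem_mk_left _ _⟩
  have hcard : ∀ v, v ∈ p.support → (C.filter (fun e => v ∈ e)).card = 2 := by
    intro v hv
    rw [hfil v, Finset.card_image_of_injective]
    · rw [← Set.ncard_eq_toFinset_card']
      exact hp.ncard_neighborSet_toSubgraph_eq_two hv
    · intro a b hab
      exact Sym2.congr_right.1 hab
  have hsupp : ∀ e ∈ C, ∀ v ∈ e, v ∈ p.support := by
    intro e he v hv
    obtain ⟨w, rfl⟩ := Sym2.mem_iff_exists.1 hv
    exact p.fst_mem_support_of_mem_edges ((hC _).1 he)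
  refine ⟨?_, ?_, ?_⟩
  · exact fun e he => G.not_isDiag_of_mem_edgeSet (p.edges_subset_edgeSet ((hC e).1 he))
  · intro e he v hv
    have h2 := hcard v (hsupp e he v hv)
    obtain ⟨e', he', hne⟩ := Finset.exists_mem_ne (by omega : 1 < (C.filter (v ∈ ·)).card) e
    exact ⟨e', (Finset.mem_filter.1 he').1, hne, (Finset.mem_filter.1 he').2⟩
  · intro v
    by_cases hv : v ∈ p.support
    · exact (hcard v hv).le
    · rw [Finset.filter_eq_empty_iff.2]
      · simp
      · exact fun e he hve => hv (hsupp e he v hve)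

theorem isCycleSet_cycleEdges (hT : IsSpanningTree G T) {f : Sym2 V} (hf : f ∈ G.edgeSet)
    (hfT : f ∉ T) : IsCycleSet (cycleEdges T f) := by
  obtain ⟨u, p, hp, hC⟩ := exists_cycle_eq_cycleEdges hT hf hfT
  exact isCycleSet_of_isCycle hp hC

end Cycles

/-! ### Edge limits, their behaviour under queries, and always maximal edges. -/

section Edges

variable {V : Type} [Fintype V] [DecidableEq V]

/-- `loc` is compatible with `A`, and every uncertainty set is a singleton or open. -/
structure Admissible (A : Areas V) (loc : V → Plane) : Prop where
  mem : ∀ v, loc v ∈ A v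
  spec : ∀ v, (∃ p, A v = {p}) ∨ IsOpen (A v)

/-- The distance of the true positions of the end vertices of `e`. -/
noncomputable def trueLength (loc : V → Plane) (e : Sym2 V) : ℝ :=
  Sym2.lift ⟨fun u v => dist (loc u) (loc v), fun _ _ => dist_comm _ _⟩ e

variable {A B : Areas V} {loc : V → Plane} {e f g : Sym2 V} {C : Finset (Sym2 V)}
  {Q R : Finset V} {v : V}

@[simp] theorem trueLength_mk (u v : V) : trueLength loc s(u, v) = dist (loc u) (loc v) := rfl

theorem Input.admissible {I : Input V} (h : I.Realizes loc) : Admissible I.area loc :=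
  ⟨h, I.area_spec⟩

theorem Admissible.reveal (h : Admissible A loc) (Q : Finset V) :
    Admissible (reveal A loc Q) loc := by
  refine ⟨fun v => ?_, fun v => ?_⟩ <;> unfold VMST.reveal <;> split_ifs
  · rfl
  · exact h.mem v
  · exact Or.inl ⟨_, rfl⟩
  · exact h.spec v

theorem Admissible.eq_singleton (h : Admissible A loc) (hv : ¬ (A v).Nontrivial) :
    A v = {loc v} :=
  (Set.not_nontrivial_iff.1 hv).eq_singleton_of_mem (h.mem v)

theorem Admissible.isOpen (h : Admissible A loc) (hv : (A v).Nontrivial) : IsOpen (A v) := by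
  rcases h.spec v with ⟨p, hp⟩ | h
  · rw [hp] at hv
    exact absurd hv Set.not_nontrivial_singleton
  · exact h

theorem Admissible.reveal_subset (h : Admissible A loc) (Q : Finset V) (v : V) :
    VMST.reveal A loc Q v ⊆ A v := by
  unfold VMST.reveal
  split_ifs
  · simpa using h.mem v
  · rfl

theorem reveal_reveal : reveal (reveal A loc R) loc Q = reveal A loc (R ∪ Q) := by
  ext v x
  unfold reveal
  by_cases h1 : v ∈ R <;> by_cases h2 : v ∈ Q <;> simp [h1, h2]

theorem reveal_empty : reveal A loc ∅ = A := by
  ext v x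
  simp [reveal]

theorem update_reveal : Function.update (reveal A loc R) v {loc v} = reveal A loc (insert v R) := by
  ext u x
  by_cases h : u = v
  · subst h; simp [reveal]
  · simp [reveal, h]

theorem mem_ends : v ∈ ends A e ↔ v ∈ e ∧ (A v).Nontrivial := by
  simp [ends]

theorem ends_reveal : ends (reveal A loc R) e = ends A e \ R := by
  ext v
  simp only [mem_ends, Finset.mem_sdiff, reveal]
  by_cases h : v ∈ R <;> simp [h]

theorem trueLength_mem (h : Admissible A loc) (e : Sym2 V) : trueLength loc e ∈ edgeArea A e := by
  induction e with
  | h u v => exact ⟨u, v, rfl, _, h.mem u, _, h.mem v, rfl⟩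

theorem lower_le_of_mem {d : ℝ} (hd : d ∈ edgeArea A e) : lower A e ≤ d :=
  iInf₂_le d hd

theorem le_upper_of_mem {d : ℝ} (hd : d ∈ edgeArea A e) : (d : EReal) ≤ upper A e :=
  le_iSup₂ (f := fun (d : ℝ) (_ : d ∈ edgeArea A e) => (d : EReal)) d hd

theorem lower_le_trueLength (h : Admissible A loc) (e : Sym2 V) : lower A e ≤ trueLength loc e :=
  lower_le_of_mem (trueLength_mem h e)

theorem trueLength_le_upper (h : Admissible A loc) (e : Sym2 V) :
    (trueLength loc e : EReal) ≤ upper A e :=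
  le_upper_of_mem (trueLength_mem h e)

theorem lower_le_upper (h : Admissible A loc) (e : Sym2 V) : lower A e ≤ upper A e :=
  (lower_le_trueLength h e).trans (trueLength_le_upper h e)

theorem trueLength_nonneg (loc : V → Plane) (e : Sym2 V) : 0 ≤ trueLength loc e := by
  induction e with
  | h u v =>
    rw [trueLength_mk]
    exact dist_nonneg

theorem lower_nonneg (A : Areas V) (e : Sym2 V) : 0 ≤ lower A e := by
  refine le_iInf₂ fun d hd => ?_
  obtain ⟨u, v, -, x, -, y, -, rfl⟩ := hd
  exact EReal.coe_nonneg.2 dist_nonneg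

theorem upper_nonneg (h : Admissible A loc) (e : Sym2 V) : 0 ≤ upper A e :=
  (lower_nonneg A e).trans (lower_le_upper h e)

theorem lower_ne_bot (A : Areas V) (e : Sym2 V) : lower A e ≠ ⊥ :=
  (EReal.bot_lt_zero.trans_le (lower_nonneg A e)).ne'

theorem upper_ne_bot (h : Admissible A loc) (e : Sym2 V) : upper A e ≠ ⊥ :=
  (EReal.bot_lt_zero.trans_le (upper_nonneg h e)).ne'

theorem edgeArea_mono (h : ∀ v ∈ e, B v ⊆ A v) : edgeArea B e ⊆ edgeArea A e := by
  rintro d ⟨u, v, rfl, x, hx, y, hy, rfl⟩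
  exact ⟨u, v, rfl, x, h u (Sym2.mem_mk_left _ _) hx, y, h v (Sym2.mem_mk_right _ _) hy, rfl⟩

theorem lower_mono (h : ∀ v ∈ e, B v ⊆ A v) : lower A e ≤ lower B e :=
  iInf_le_iInf_of_subset (edgeArea_mono h)

theorem upper_mono (h : ∀ v ∈ e, B v ⊆ A v) : upper B e ≤ upper A e :=
  iSup_le_iSup_of_subset (edgeArea_mono h)

theorem lower_congr (h : ∀ v ∈ e, B v = A v) : lower B e = lower A e :=
  le_antisymm (lower_mono fun v hv => (h v hv).ge) (lower_mono fun v hv => (h v hv).le)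

theorem upper_congr (h : ∀ v ∈ e, B v = A v) : upper B e = upper A e :=
  le_antisymm (upper_mono fun v hv => (h v hv).le) (upper_mono fun v hv => (h v hv).ge)

theorem lower_le_lower_reveal (h : Admissible A loc) (Q : Finset V) (e : Sym2 V) :
    lower A e ≤ lower (reveal A loc Q) e :=
  lower_mono fun v _ => h.reveal_subset Q v

theorem upper_reveal_le_upper (h : Admissible A loc) (Q : Finset V) (e : Sym2 V) :
    upper (reveal A loc Q) e ≤ upper A e :=
  upper_mono fun v _ => h.reveal_subset Q v

theorem reveal_eq_of_disjoint (h : Admissible A loc) (hd : Disjoint (ends A e) Q) (hv : v ∈ e) :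
    reveal A loc Q v = A v := by
  unfold reveal
  split_ifs with hQ
  · refine (h.eq_singleton fun hn => ?_).symm
    exact Finset.disjoint_left.1 hd (mem_ends.2 ⟨hv, hn⟩) hQ
  · rfl

theorem lower_reveal_of_disjoint (h : Admissible A loc) (hd : Disjoint (ends A e) Q) :
    lower (reveal A loc Q) e = lower A e :=
  lower_congr fun _ hv => reveal_eq_of_disjoint h hd hv

theorem upper_reveal_of_disjoint (h : Admissible A loc) (hd : Disjoint (ends A e) Q) :
    upper (reveal A loc Q) e = upper A e :=
  upper_congr fun _ hv => reveal_eq_of_disjoint h hd hv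

theorem eq_trueLength_of_ends_eq_empty (h : Admissible A loc) (he : ends A e = ∅) {d : ℝ}
    (hd : d ∈ edgeArea A e) : d = trueLength loc e := by
  have ht : ∀ v ∈ e, A v = {loc v} := fun v hv => h.eq_singleton fun hn =>
    Finset.notMem_empty v (he ▸ mem_ends.2 ⟨hv, hn⟩)
  obtain ⟨u, v, rfl, x, hx, y, hy, rfl⟩ := hd
  rw [ht u (Sym2.mem_mk_left _ _)] at hx
  rw [ht v (Sym2.mem_mk_right _ _)] at hy
  rw [Set.mem_singleton_iff.1 hx, Set.mem_singleton_iff.1 hy, trueLength_mk]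

theorem lower_eq_trueLength (h : Admissible A loc) (he : ends A e = ∅) :
    lower A e = trueLength loc e := by
  refine le_antisymm (lower_le_trueLength h e) (le_iInf₂ fun d hd => ?_)
  rw [eq_trueLength_of_ends_eq_empty h he hd]

theorem upper_eq_trueLength (h : Admissible A loc) (he : ends A e = ∅) :
    upper A e = trueLength loc e := by
  refine le_antisymm (iSup₂_le fun d hd => ?_) (trueLength_le_upper h e)
  rw [eq_trueLength_of_ends_eq_empty h he hd]

/-- Moving `x` slightly away from `y` on the ray from `y` stays in `U`. If `x = y`, any other point
will do, which is why non-triviality is needed. -/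
theorem exists_dist_gt {U : Set Plane} (hU : IsOpen U) {x y : Plane} (hx : x ∈ U)
    (hne : U.Nontrivial) : ∃ x' ∈ U, dist x y < dist x' y := by
  by_cases hxy : x = y
  · obtain ⟨x', hx', hn⟩ := hne.exists_ne x
    refine ⟨x', hx', ?_⟩
    rw [← hxy, dist_self]
    exact dist_pos.2 hn
  · have hc : Continuous fun t : ℝ => AffineMap.lineMap y x t := AffineMap.lineMap_continuous
    have h1 : ∀ᶠ t in nhds (1 : ℝ), AffineMap.lineMap y x t ∈ U :=
      hc.continuousAt.eventually_mem (by simpa using hU.mem_nhds hx)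
    obtain ⟨t, ht, ht1⟩ := ((h1.filter_mono nhdsWithin_le_nhds).and
      (self_mem_nhdsWithin : Set.Ioi (1 : ℝ) ∈ nhdsWithin 1 (Set.Ioi 1))).exists
    refine ⟨_, ht, ?_⟩
    have hp : 0 < dist x y := dist_pos.2 hxy
    rw [dist_lineMap_left, dist_comm y x, Real.norm_eq_abs]
    have : t ≤ |t| := le_abs_self t
    have ht1' : 1 < t := ht1
    nlinarith

theorem exists_dist_lt {U : Set Plane} (hU : IsOpen U) {x y : Plane} (hx : x ∈ U)
    (hxy : x ≠ y) : ∃ x' ∈ U, dist x' y < dist x y := by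
  have hc : Continuous fun t : ℝ => AffineMap.lineMap y x t := AffineMap.lineMap_continuous
  have h1 : ∀ᶠ t in nhds (1 : ℝ), AffineMap.lineMap y x t ∈ U :=
    hc.continuousAt.eventually_mem (by simpa using hU.mem_nhds hx)
  have h2 : Set.Ioo (0 : ℝ) 1 ∈ nhdsWithin 1 (Set.Iio 1) := Ioo_mem_nhdsLT zero_lt_one
  obtain ⟨t, ht, ht1⟩ := ((h1.filter_mono nhdsWithin_le_nhds).and h2).exists
  refine ⟨_, ht, ?_⟩
  have hp : 0 < dist x y := dist_pos.2 hxy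
  rw [dist_lineMap_left, dist_comm y x, Real.norm_eq_abs, abs_of_pos ht1.1]
  nlinarith [ht1.2]

theorem exists_mk_of_mem_ends (hv : v ∈ ends A e) (hd : ¬ e.IsDiag) :
    ∃ u, e = s(v, u) ∧ v ≠ u ∧ (A v).Nontrivial := by
  obtain ⟨hve, hn⟩ := mem_ends.1 hv
  obtain ⟨u, rfl⟩ := Sym2.mem_iff_exists.1 hve
  exact ⟨u, rfl, by simpa using hd, hn⟩

/-- The upper limit of an edge with a non-trivial end vertex is not attained. -/
theorem trueLength_lt_upper (h : Admissible A loc) (hd : ¬ e.IsDiag) (he : (ends A e).Nonempty) :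
    (trueLength loc e : EReal) < upper A e := by
  obtain ⟨v, hv⟩ := he
  obtain ⟨u, rfl, -, hn⟩ := exists_mk_of_mem_ends hv hd
  obtain ⟨x, hx, hlt⟩ := exists_dist_gt (y := loc u) (h.isOpen hn) (h.mem v) hn
  refine lt_of_lt_of_le (EReal.coe_lt_coe_iff.2 hlt) (le_upper_of_mem ?_)
  exact ⟨v, u, rfl, x, hx, _, h.mem u, rfl⟩

/-- The lower limit of an edge with a non-trivial end vertex is only attained if it is zero. -/
theorem lower_lt_trueLength (h : Admissible A loc) (hd : ¬ e.IsDiag) (he : (ends A e).Nonempty)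
    (hpos : 0 < trueLength loc e) : lower A e < trueLength loc e := by
  obtain ⟨v, hv⟩ := he
  obtain ⟨u, rfl, -, hn⟩ := exists_mk_of_mem_ends hv hd
  obtain ⟨x, hx, hlt⟩ := exists_dist_lt (h.isOpen hn) (h.mem v) (dist_pos.1 hpos)
  refine lt_of_le_of_lt (lower_le_of_mem ?_) (EReal.coe_lt_coe_iff.2 hlt)
  exact ⟨v, u, rfl, x, hx, _, h.mem u, rfl⟩

theorem AlwaysMaximal.mono (hf : AlwaysMaximal A C f) (h : ∀ v, B v ⊆ A v) :
    AlwaysMaximal B C f :=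
  ⟨hf.1, fun e he hne => (upper_mono fun v _ => h v).trans
    ((hf.2 e he hne).trans (lower_mono fun v _ => h v))⟩

theorem Solved.mono (hs : Solved A C) (h : ∀ v, B v ⊆ A v) : Solved B C :=
  hs.imp fun _ hf => hf.mono h

theorem reveal_anti (h : Admissible A loc) (hRQ : R ⊆ Q) (v : V) :
    reveal A loc Q v ⊆ reveal A loc R v := by
  rw [← Finset.union_eq_right.2 hRQ, ← reveal_reveal]
  exact (h.reveal R).reveal_subset Q v

theorem Solved.reveal_mono (hs : Solved (reveal A loc R) C) (h : Admissible A loc) (hRQ : R ⊆ Q) :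
    Solved (reveal A loc Q) C :=
  hs.mono (reveal_anti h hRQ)

theorem solved_congr (h : ∀ e ∈ C, ∀ v ∈ e, B v = A v) : Solved B C ↔ Solved A C := by
  refine exists_congr fun f => and_congr_right fun hf => ?_
  refine forall₂_congr fun e he => imp_congr_right fun _ => ?_
  rw [upper_congr (h e he), lower_congr (h f hf)]

theorem ends_nonempty_of_mem_maxUpperEdges (h : Admissible A loc) (hs : ¬ Solved A C)
    (he : e ∈ maxUpperEdges A C) : (ends A e).Nonempty := by
  by_contra hne
  rw [Finset.not_nonempty_iff_eq_empty] at hne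
  refine hs ⟨e, he.1, fun g hg _ => (he.2 g hg).trans ?_⟩
  rw [lower_eq_trueLength h hne, upper_eq_trueLength h hne]

theorem maxUpperEdges_nonempty (hC : C.Nonempty) : (maxUpperEdges A C).Nonempty := by
  obtain ⟨g, hg, hmax⟩ := C.exists_max_image (upper A) hC
  exact ⟨g, hg, hmax⟩

/-- The other cycle edge at a non-trivial end of `e` has a positive upper limit, and `e` dominates
it. Positivity matters because a lower limit zero may be attained even by open sets. -/
theorem lower_pos_of_alwaysMaximal (h : Admissible A loc) (hC : IsCycleSet C)
    (he : AlwaysMaximal A C e) (hne : (ends A e).Nonempty) : 0 < lower A e := by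
  obtain ⟨v, hv⟩ := hne
  obtain ⟨g, hg, hge, hvg⟩ := hC.exists_ne e he.1 v (mem_ends.1 hv).1
  have h1 := trueLength_lt_upper h (hC.not_isDiag g hg)
    ⟨v, mem_ends.2 ⟨hvg, (mem_ends.1 hv).2⟩⟩
  refine lt_of_lt_of_le (lt_of_le_of_lt ?_ h1) (he.2 g hg hge)
  exact_mod_cast trueLength_nonneg loc g

/-- If a query set solves the cycle, but contains no end vertex of an edge with largest upper
limit, then this edge becomes always maximal. -/
theorem alwaysMaximal_of_disjoint (h : Admissible A loc) (hC : IsCycleSet C) (hs : ¬ Solved A C)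
    (he : e ∈ maxUpperEdges A C) (hQ : Solved (reveal A loc Q) C)
    (hd : Disjoint (ends A e) Q) :
    AlwaysMaximal (reveal A loc Q) C e ∧ 0 < lower A e ∧ lower A e < trueLength loc e := by
  have hne := ends_nonempty_of_mem_maxUpperEdges h hs he
  obtain ⟨k, hk⟩ := hQ
  -- For `k ≠ e`, the unchanged upper limit of `e` would be at most the true length of `k`. If `k`
  -- is uncertain, this is strictly below its upper limit, hence below that of `e`; if `k` is known,
  -- the cycle was solved already.
  have hke : k = e := by
    by_contra hke
    have h1 := hk.2 e he.1 (Ne.symm hke)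
    rw [upper_reveal_of_disjoint h hd] at h1
    by_cases hkn : (ends A k).Nonempty
    · have h2 := trueLength_lt_upper h (hC.not_isDiag k hk.1) hkn
      have h3 := lower_le_trueLength (h.reveal Q) k
      exact absurd (h1.trans h3) (h2.trans_le (he.2 k hk.1)).not_ge
    · rw [Finset.not_nonempty_iff_eq_empty] at hkn
      rw [lower_reveal_of_disjoint h (by simp [hkn])] at h1
      exact hs ⟨k, hk.1, fun g hg _ => (he.2 g hg).trans h1⟩
  subst hke
  have hpos : 0 < lower A k := by
    rw [← lower_reveal_of_disjoint h hd]
    refine lower_pos_of_alwaysMaximal (h.reveal Q) hC hk ?_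
    rw [ends_reveal, Finset.sdiff_eq_self_of_disjoint hd]
    exact hne
  refine ⟨hk, hpos, lower_lt_trueLength h (hC.not_isDiag k hk.1) hne ?_⟩
  exact_mod_cast hpos.trans_le (lower_le_trueLength h k)

/-- The situation of `alwaysMaximal_of_disjoint` occurs at most once. -/
theorem not_disjoint_of_disjoint (h : Admissible A loc) (hC : IsCycleSet C) (hs : ¬ Solved A C)
    (he : e ∈ maxUpperEdges A C) (hQ : Solved (reveal A loc Q) C)
    (hd : Disjoint (ends A e) Q) (hR : ends A e ⊆ R) (hsR : ¬ Solved (reveal A loc R) C)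
    (hg : g ∈ maxUpperEdges (reveal A loc R) C) :
    ¬ Disjoint (ends (reveal A loc R) g) Q := by
  intro hdg
  obtain ⟨h1, -, h2⟩ := alwaysMaximal_of_disjoint h hC hs he hQ hd
  have hQ' : Solved (reveal (reveal A loc R) loc Q) C := by
    rw [reveal_reveal]
    exact hQ.reveal_mono h Finset.subset_union_right
  obtain ⟨h3, -, -⟩ := alwaysMaximal_of_disjoint (h.reveal R) hC hsR hg hQ' hdg
  have hge : g ≠ e := by
    rintro rfl
    have := ends_nonempty_of_mem_maxUpperEdges (h.reveal R) hsR hg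
    rw [ends_reveal, Finset.sdiff_eq_empty_iff_subset.2 hR] at this
    exact Finset.not_nonempty_empty this
  have h4 := h3.2 e h1.1 hge.symm
  have h5 := h1.2 g h3.1 hge
  rw [lower_reveal_of_disjoint h hd] at h5
  rw [reveal_reveal] at h3 h4
  have h6 := lower_le_upper (h.reveal (R ∪ Q)) g
  have h7 : upper (reveal A loc (R ∪ Q)) g ≤ upper (reveal A loc Q) g :=
    upper_mono fun v _ => reveal_anti h Finset.subset_union_right v
  have h8 := trueLength_le_upper (h.reveal (R ∪ Q)) e
  -- Two misses give a circle: the true length of `e` is at most the limits of `g` (`g` becomes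
  -- maximal), these are at most the old lower limit of `e` (`e` becomes maximal), which is strictly
  -- below its true length.
  exact absurd h2 ((h8.trans h4).trans (h6.trans (h7.trans h5))).not_gt

end Edges

/-! ### Expected values of query strategies. -/

namespace QueryAlg

variable {V : Type} [DecidableEq V] {α β : Type} {loc : V → Plane} {R : Finset V}

/-- The expected value of `K a Q`, where `a` is the result of the strategy and `Q` the set of all
vertices that have been queried in the end. -/
noncomputable def wp (loc : V → Plane) :
    QueryAlg V α → (α → Finset V → ℝ≥0∞) → Finset V → ℝ≥0∞
  | done a, K, R => K a R
  | query v k, K, R => wp loc (k (loc v)) K (insert v R)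
  | rand _ p k, K, R => ∑' b, p b * wp loc (k b) K R

variable {K : α → Finset V → ℝ≥0∞}

theorem wp_done (a : α) : wp loc (done a) K R = K a R := rfl

theorem wp_query (v : V) (k : Plane → QueryAlg V α) :
    wp loc (query v k) K R = wp loc (k (loc v)) K (insert v R) := rfl

theorem wp_rand (p : PMF β) (k : β → QueryAlg V α) :
    wp loc (rand β p k) K R = ∑' b, p b * wp loc (k b) K R := rfl

theorem wp_bind (m : QueryAlg V α) (g : α → QueryAlg V β) {K : β → Finset V → ℝ≥0∞} :
    wp loc (m >>= g) K R = wp loc m (fun a Q => wp loc (g a) K Q) R := by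
  change wp loc (bind m g) K R = _
  induction m generalizing R with
  | done a => rfl
  | query v k ih => exact ih _
  | rand γ p k ih => exact tsum_congr fun b => by rw [← ih b]

/-- Links the recursive expectation with the output distribution that defines the expected cost. -/
theorem wp_law (m : QueryAlg V α) (K : Finset V → ℝ≥0∞) :
    wp loc m (fun _ => K) R = ∑' Q, m.law loc R Q * K Q := by
  induction m generalizing R with
  | done a =>
    rw [wp_done, law, tsum_eq_single R]
    · simp
    · intro Q hQ
      simp [PMF.pure_apply, hQ]
  | query v k ih => exact ih _
  | rand γ p k ih =>
    simp only [wp_rand, law, PMF.bind_apply, ← ENNReal.tsum_mul_right]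
    rw [ENNReal.tsum_comm]
    refine tsum_congr fun b => ?_
    rw [ih b, ← ENNReal.tsum_mul_left]
    exact tsum_congr fun Q => (mul_assoc _ _ _).symm

theorem le_wp {c : ℝ≥0∞} (h : ∀ a Q, R ⊆ Q → c ≤ K a Q) (m : QueryAlg V α) :
    c ≤ wp loc m K R := by
  induction m generalizing R with
  | done a => exact h a R subset_rfl
  | query v k ih => exact ih _ fun a Q hQ => h a Q ((Finset.subset_insert _ _).trans hQ)
  | rand γ p k ih =>
    calc c = ∑' b, p b * c := by rw [ENNReal.tsum_mul_right, p.tsum_coe, one_mul]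
      _ ≤ _ := ENNReal.tsum_le_tsum fun b => mul_le_mul_right (ih b h) _

/-- The bound `g` may depend on the random choice; only its average has to be at most `c`. Rand1,
Rand2 and the coin round use this with non-constant `g`. -/
theorem wp_uniform_le {S : Finset β} {k : β → QueryAlg V α} {m : QueryAlg V α} (hS : S.Nonempty)
    {g : β → ℝ} {c : ℝ} (hk : ∀ b ∈ S, wp loc (k b) K R ≤ ENNReal.ofReal (g b))
    (hg : ∀ b ∈ S, 0 ≤ g b) (hc : ∑ b ∈ S, g b ≤ S.card * c) :
    wp loc (uniform S k m) K R ≤ ENNReal.ofReal c := by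
  classical
  unfold uniform
  rw [dif_pos hS, wp_rand, tsum_eq_sum (s := S)]
  · have hpos : (0 : ℝ) < S.card := by exact_mod_cast hS.card_pos
    calc ∑ b ∈ S, PMF.uniformOfFinset S hS b * wp loc (k b) K R
        ≤ ∑ b ∈ S, (S.card : ℝ≥0∞)⁻¹ * ENNReal.ofReal (g b) := by
          refine Finset.sum_le_sum fun b hb => ?_
          rw [PMF.uniformOfFinset_apply_of_mem hS hb]
          exact mul_le_mul_right (hk b hb) _
      _ = (S.card : ℝ≥0∞)⁻¹ * ENNReal.ofReal (∑ b ∈ S, g b) := by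
          rw [← Finset.mul_sum, ENNReal.ofReal_sum_of_nonneg hg]
      _ ≤ (S.card : ℝ≥0∞)⁻¹ * ENNReal.ofReal (S.card * c) :=
          mul_le_mul_right (ENNReal.ofReal_le_ofReal hc) _
      _ = ENNReal.ofReal c := by
          rw [ENNReal.ofReal_mul hpos.le, ENNReal.ofReal_natCast, ← mul_assoc,
            ENNReal.inv_mul_cancel, one_mul]
          · exact_mod_cast hS.card_pos.ne'
          · exact ENNReal.natCast_ne_top _
  · intro b hb
    rw [PMF.uniformOfFinset_apply_of_notMem hS hb, zero_mul]

end QueryAlg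

/-! ### Results of the elementary query procedures. -/

section Procedures

open QueryAlg

variable {V : Type} [Fintype V] [DecidableEq V] {A : Areas V} {loc : V → Plane}
  {R S : Finset V} {C : Finset (Sym2 V)} {K : Areas V → Finset V → ℝ≥0∞}

theorem wp_queryList (l : List V) (R : Finset V) :
    wp loc (queryList (reveal A loc R) l) K R = K (reveal A loc (R ∪ l.toFinset)) (R ∪ l.toFinset) := by
  induction l generalizing R with
  | nil => simp [queryList, wp_done]
  | cons v l ih =>
    rw [queryList, wp_query, update_reveal, ih, List.toFinset_cons, Finset.union_insert,
      Finset.insert_union]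

theorem wp_querySet :
    wp loc (querySet (reveal A loc R) S) K R = K (reveal A loc (R ∪ S)) (R ∪ S) := by
  rw [querySet, wp_queryList, Finset.toList_toFinset]

/-- `queryUntil` queries a prefix of the list, the shortest one that solves the cycle. -/
theorem exists_wp_queryUntil (l : List V) (R : Finset V) :
    ∃ j ≤ l.length,
      wp loc (queryUntil C (reveal A loc R) l) K R =
        K (reveal A loc (R ∪ (l.take j).toFinset)) (R ∪ (l.take j).toFinset) ∧
      (Solved (reveal A loc (R ∪ (l.take j).toFinset)) C ∨ j = l.length) ∧
      ∀ i < j, ¬ Solved (reveal A loc (R ∪ (l.take i).toFinset)) C := by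
  induction l generalizing R with
  | nil => exact ⟨0, le_rfl, by simp [queryUntil, wp_done], Or.inr rfl, by simp⟩
  | cons v l ih =>
    by_cases hs : Solved (reveal A loc R) C
    · exact ⟨0, Nat.zero_le _, by simp [queryUntil, wp_done, hs], by simp [hs], by simp⟩
    · obtain ⟨j, hj, h1, h2, h3⟩ := ih (insert v R)
      have hu : ∀ i, insert v R ∪ (l.take i).toFinset = R ∪ ((v :: l).take (i + 1)).toFinset := by
        intro i
        rw [List.take_succ_cons, List.toFinset_cons, Finset.union_insert, Finset.insert_union]
      refine ⟨j + 1, by simpa using hj, ?_, ?_, ?_⟩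
      · rw [queryUntil, if_neg hs, wp_query, update_reveal, h1, hu]
      · rw [← hu]
        simpa using h2
      · intro i hi
        cases i with
        | zero => simpa using hs
        | succ i => rw [← hu]; exact h3 i (by omega)

end Procedures

/-! ### Amortized analysis of deterministic rounds and of the coin round. -/

section Deterministic

variable {V : Type} [Fintype V] [DecidableEq V] {A : Areas V} {loc : V → Plane}
  {Q R S U : Finset V} {C : Finset (Sym2 V)} {e f g : Sym2 V} {b κ : ℕ}

theorem card_toFinset_le_two (e : Sym2 V) : e.toFinset.card ≤ 2 := by
  rw [Sym2.card_toFinset]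
  split_ifs <;> omega

theorem ends_subset_toFinset : ends A e ⊆ e.toFinset := fun v hv => by
  simpa using (mem_ends.1 hv).1

theorem card_ends_le_two : (ends A e).card ≤ 2 :=
  (Finset.card_le_card ends_subset_toFinset).trans (card_toFinset_le_two e)

/-- Every edge with largest upper limit that is chosen when at least the vertices in `R` have
been queried, but has no unqueried end vertex in `Q`, has at most `b` unqueried end vertices. -/
def MissBound (A : Areas V) (loc : V → Plane) (C : Finset (Sym2 V)) (Q R : Finset V) (b : ℕ) :
    Prop :=
  ∀ S, R ⊆ S → ¬ Solved (reveal A loc S) C → ∀ e ∈ maxUpperEdges (reveal A loc S) C,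
    Disjoint (ends (reveal A loc S) e) Q → (ends (reveal A loc S) e).card ≤ b

theorem MissBound.mono (h : MissBound A loc C Q R b) (hRS : R ⊆ S) : MissBound A loc C Q S b :=
  fun S' hS' => h S' (hRS.trans hS')

/-- After the vertices in `R` have been queried, every chosen edge has at most `κ` unqueried end
vertices. -/
def EndsBound (A : Areas V) (loc : V → Plane) (C : Finset (Sym2 V)) (R : Finset V) (κ : ℕ) :
    Prop :=
  ∀ S, R ⊆ S → ¬ Solved (reveal A loc S) C → ∀ e ∈ maxUpperEdges (reveal A loc S) C,
    (ends (reveal A loc S) e).card ≤ κ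

theorem EndsBound.mono (h : EndsBound A loc C R κ) (hRS : R ⊆ S) : EndsBound A loc C S κ :=
  fun S' hS' => h S' (hRS.trans hS')

theorem endsBound_two : EndsBound A loc C R 2 := fun _ _ _ _ _ => card_ends_le_two

/-- The amortized cost of a deterministic round. -/
theorem exists_missBound_round (h : Admissible A loc) (hC : IsCycleSet C)
    (hQ : Solved (reveal A loc Q) C) (hs : ¬ Solved (reveal A loc R) C)
    (hm : MissBound A loc C Q R b) (hκ : EndsBound A loc C R κ)
    (he : e ∈ maxUpperEdges (reveal A loc R) C) :
    ∃ b' ≤ b, MissBound A loc C Q (R ∪ ends (reveal A loc R) e) b' ∧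
      (R ∪ ends (reveal A loc R) e).card + κ * (Q \ (R ∪ ends (reveal A loc R) e)).card + b' ≤
        R.card + κ * (Q \ R).card + b := by
  set E := ends (reveal A loc R) e with hE
  have hsub : Q \ (R ∪ E) ⊆ Q \ R := Finset.sdiff_subset_sdiff subset_rfl Finset.subset_union_left
  by_cases hd : Disjoint E Q
  · have h1 := hm R subset_rfl hs e he hd
    rw [← hE] at h1
    have h2 := Finset.card_union_le R E
    have h3 := Nat.mul_le_mul_left κ (Finset.card_le_card hsub)
    -- The miss is paid from `b`, and no second miss can follow, so the new allowance is zero.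
    refine ⟨0, Nat.zero_le _, ?_, by omega⟩
    intro S hS hsS g hg hdg
    have hQ' : Solved (reveal (reveal A loc R) loc Q) C := by
      rw [reveal_reveal]
      exact hQ.reveal_mono h Finset.subset_union_right
    have hSR : reveal (reveal A loc R) loc S = reveal A loc S := by
      rw [reveal_reveal, Finset.union_eq_right.2 (Finset.subset_union_left.trans hS)]
    rw [← hSR] at hsS hg hdg
    exact absurd hdg (not_disjoint_of_disjoint (h.reveal R) hC hs he hQ' hd
      (Finset.subset_union_right.trans hS) hsS hg)
  · have h1 := hκ R subset_rfl hs e he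
    rw [← hE] at h1
    have h2 := Finset.card_union_le R E
    obtain ⟨x, hxE, hxQ⟩ := Finset.not_disjoint_iff.1 hd
    have hxR : x ∉ R := by
      rw [hE, ends_reveal] at hxE
      exact (Finset.mem_sdiff.1 hxE).2
    have h3 : (Q \ (R ∪ E)).card < (Q \ R).card := by
      refine Finset.card_lt_card ((Finset.ssubset_iff_of_subset hsub).2 ⟨x, ?_, ?_⟩)
      · exact Finset.mem_sdiff.2 ⟨hxQ, hxR⟩
      · simp [hxE]
    refine ⟨b, le_rfl, hm.mono Finset.subset_union_left, ?_⟩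
    have h4 := Nat.mul_le_mul_left κ (Nat.succ_le_of_lt h3)
    rw [Nat.mul_succ] at h4
    omega

variable [Nonempty V] {tb : TieBreak V} {K : Areas V → Finset V → ℝ≥0∞} {d : ℝ}

theorem pick_maxUpperEdges_mem (hC : C.Nonempty) :
    tb.pick A (maxUpperEdges A C) ∈ maxUpperEdges A C :=
  tb.pick_mem A _ (maxUpperEdges_nonempty hC)

theorem nonempty_of_solved (hQ : Solved A C) : C.Nonempty :=
  hQ.imp fun _ h => h.1

theorem wp_detRounds_succ_le {n : ℕ} {c : ℝ≥0∞} (hC : C.Nonempty)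
    (h₁ : Solved (reveal A loc R) C → K (reveal A loc R) R ≤ c)
    (h₂ : ¬ Solved (reveal A loc R) C → ∀ e ∈ maxUpperEdges (reveal A loc R) C,
      wp loc (detRounds tb C n (reveal A loc (R ∪ ends (reveal A loc R) e))) K
        (R ∪ ends (reveal A loc R) e) ≤ c) :
    wp loc (detRounds tb C (n + 1) (reveal A loc R)) K R ≤ c := by
  rw [detRounds]
  split_ifs with hs
  · exact h₁ hs
  · rw [wp_bind, wp_querySet]
    exact h₂ hs _ (pick_maxUpperEdges_mem hC)

/-- `K` is the cost of what follows, `d` a reserve for it, and `U` confines the queries to the cycle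
so that other cycles remain untouched. The potential is passed on to the continuation, so that a
further randomized round can be analysed from it. -/
theorem wp_detRounds_le (h : Admissible A loc) (hC : IsCycleSet C)
    (hQ : Solved (reveal A loc Q) C) (hU : ∀ e ∈ C, ends A e ⊆ U) (n : ℕ) (hRU : R ⊆ U)
    (hm : MissBound A loc C Q R b) (hκ : EndsBound A loc C R κ)
    (hK : ∀ S b', R ⊆ S → S ⊆ U → MissBound A loc C Q S b' →
      Solved (reveal A loc S) C ∨ R.card + n ≤ S.card →
      S.card + κ * (Q \ S).card + b' ≤ R.card + κ * (Q \ R).card + b →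
      K (reveal A loc S) S ≤ ENNReal.ofReal (d + (S.card + κ * (Q \ S).card + b' : ℕ))) :
    wp loc (detRounds tb C n (reveal A loc R)) K R ≤
      ENNReal.ofReal (d + (R.card + κ * (Q \ R).card + b : ℕ)) := by
  induction n generalizing R b with
  | zero =>
    rw [detRounds, wp_done]
    exact hK R b subset_rfl hRU hm (Or.inr le_rfl) le_rfl
  | succ n ih =>
    refine wp_detRounds_succ_le (nonempty_of_solved hQ) ?_ ?_
    · exact fun hs => hK R b subset_rfl hRU hm (Or.inl hs) le_rfl
    · intro hs e he
      obtain ⟨b', -, hm', hle⟩ := exists_missBound_round h hC hQ hs hm hκ he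
      have hEU : ends (reveal A loc R) e ⊆ U := by
        rw [ends_reveal]
        exact Finset.sdiff_subset.trans (hU e he.1)
      have hcard : R.card + 1 ≤ (R ∪ ends (reveal A loc R) e).card := by
        obtain ⟨x, hx⟩ := ends_nonempty_of_mem_maxUpperEdges (h.reveal R) hs he
        refine Finset.card_lt_card ((Finset.ssubset_iff_of_subset Finset.subset_union_left).2
          ⟨x, Finset.mem_union_right _ hx, ?_⟩)
        rw [ends_reveal] at hx
        exact (Finset.mem_sdiff.1 hx).2
      refine (ih (Finset.union_subset hRU hEU) hm' (hκ.mono Finset.subset_union_left) ?_).trans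
        (ENNReal.ofReal_le_ofReal (by gcongr))
      intro S b'' hS hSU hmS hor hleS
      refine hK S b'' (Finset.subset_union_left.trans hS) hSU hmS ?_ (hleS.trans hle)
      rcases hor with h | h
      · exact Or.inl h
      · exact Or.inr (by omega)

theorem solved_univ (h : Admissible A loc) (hC : C.Nonempty) :
    Solved (reveal A loc Finset.univ) C := by
  by_contra hs
  obtain ⟨e, he⟩ := maxUpperEdges_nonempty (A := reveal A loc Finset.univ) hC
  obtain ⟨x, hx⟩ := ends_nonempty_of_mem_maxUpperEdges (h.reveal _) hs he
  rw [ends_reveal] at hx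
  simp at hx

/-- Unless the cycle is solved earlier, `Fintype.card V` rounds with a new vertex each would exhaust
all vertices, and then the cycle is solved anyway. -/
theorem wp_detLoop_le (h : Admissible A loc) (hC : IsCycleSet C)
    (hQ : Solved (reveal A loc Q) C) (hU : ∀ e ∈ C, ends A e ⊆ U) (hRU : R ⊆ U)
    (hm : MissBound A loc C Q R b) (hκ : EndsBound A loc C R κ)
    (hK : ∀ S, R ⊆ S → S ⊆ U → Solved (reveal A loc S) C →
      K (reveal A loc S) S ≤ ENNReal.ofReal (d + S.card)) :
    wp loc (detLoop tb C (reveal A loc R)) K R ≤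
      ENNReal.ofReal (d + (R.card + κ * (Q \ R).card + b : ℕ)) := by
  refine wp_detRounds_le h hC hQ hU _ hRU hm hκ fun S b' hS hSU _ hor _ => ?_
  have hs : Solved (reveal A loc S) C := by
    rcases hor with hs | hc
    · exact hs
    · have : S = Finset.univ := by
        rw [← Finset.card_eq_iff_eq_univ]
        have := Finset.card_le_univ S
        omega
      rw [this]
      exact solved_univ h (nonempty_of_solved hQ)
  refine (hK S hS hSU hs).trans (ENNReal.ofReal_le_ofReal ?_)
  push_cast
  have : (0 : ℝ) ≤ κ * (Q \ S).card := by positivity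
  have : (0 : ℝ) ≤ b' := by positivity
  linarith

theorem wp_detLoop_of_solved (hs : Solved A C) : wp loc (detLoop tb C A) K R = K A R := by
  unfold detLoop
  cases Fintype.card V with
  | zero => rfl
  | succ n => rw [detRounds, if_pos hs, wp_done]

open Classical in
/-- The part of the subroutine Rand3 that follows the first two deterministic rounds. -/
noncomputable def coinRound (tb : TieBreak V) (C : Finset (Sym2 V)) (A : Areas V) :
    QueryAlg V (Areas V) :=
  if Solved A C then done A else do
    let S := ends A (tb.pick A (maxUpperEdges A C))
    let A₂ ← uniform S (fun u => queryUntil C A (u :: (S.erase u).toList)) (done A)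
    detLoop tb C A₂

theorem rand3_eq : rand3 tb C A = detRounds tb C 2 A >>= coinRound tb C := rfl

/-- Bounds for the result of querying a set of vertices until the cycle is solved, and continuing
with the deterministic procedure. -/
theorem wp_queryUntil_detLoop_le {l : List V} {c : ℝ} (hl : l.toFinset ⊆ U) (hRU : R ⊆ U)
    (hK : ∀ S, R ⊆ S → S ⊆ U → Solved (reveal A loc S) C →
      K (reveal A loc S) S ≤ ENNReal.ofReal (d + S.card))
    (h₁ : d + (R ∪ l.toFinset).card ≤ c)
    (h₂ : ¬ Solved (reveal A loc (R ∪ l.toFinset)) C →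
      wp loc (detLoop tb C (reveal A loc (R ∪ l.toFinset))) K (R ∪ l.toFinset) ≤
        ENNReal.ofReal c) :
    wp loc (queryUntil C (reveal A loc R) l >>= detLoop tb C) K R ≤ ENNReal.ofReal c := by
  rw [wp_bind]
  obtain ⟨j, hj, h3, h4, -⟩ := exists_wp_queryUntil (A := A) (loc := loc) (C := C)
    (K := fun a Q => wp loc (detLoop tb C a) K Q) l R
  rw [h3]
  by_cases hs : Solved (reveal A loc (R ∪ (l.take j).toFinset)) C
  · have hsub : (l.take j).toFinset ⊆ l.toFinset := fun x hx => by
      rw [List.mem_toFinset] at hx ⊢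
      exact List.mem_of_mem_take hx
    rw [wp_detLoop_of_solved hs]
    refine (hK _ Finset.subset_union_left (Finset.union_subset hRU (hsub.trans hl)) hs).trans
      (ENNReal.ofReal_le_ofReal (le_trans ?_ h₁))
    gcongr
  · have hj' := h4.resolve_left hs
    subst hj'
    rw [List.take_length] at hs ⊢
    exact h₂ hs

/-- In the worst case the coin is useless and the round costs no more than a deterministic one. -/
theorem wp_coinRound_le (h : Admissible A loc) (hC : IsCycleSet C)
    (hQ : Solved (reveal A loc Q) C) (hU : ∀ e ∈ C, ends A e ⊆ U) (hRU : R ⊆ U) (hd : 0 ≤ d)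
    (hm : MissBound A loc C Q R b) (hκ : EndsBound A loc C R κ)
    (hK : ∀ S, R ⊆ S → S ⊆ U → Solved (reveal A loc S) C →
      K (reveal A loc S) S ≤ ENNReal.ofReal (d + S.card)) :
    wp loc (coinRound tb C (reveal A loc R)) K R ≤
      ENNReal.ofReal (d + (R.card + κ * (Q \ R).card + b : ℕ)) := by
  rw [coinRound]
  split_ifs with hs
  · refine (hK R subset_rfl hRU hs).trans (ENNReal.ofReal_le_ofReal ?_)
    push_cast
    have : (0 : ℝ) ≤ κ * (Q \ R).card := by positivity
    have : (0 : ℝ) ≤ b := by positivity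
    linarith
  · have he := pick_maxUpperEdges_mem (tb := tb) (A := reveal A loc R) (nonempty_of_solved hQ)
    set e := tb.pick (reveal A loc R) (maxUpperEdges (reveal A loc R) C)
    have hne := ends_nonempty_of_mem_maxUpperEdges (h.reveal R) hs he
    obtain ⟨b', -, hm', hle⟩ := exists_missBound_round h hC hQ hs hm hκ he
    have hEU : ends (reveal A loc R) e ⊆ U := by
      rw [ends_reveal]
      exact Finset.sdiff_subset.trans (hU e he.1)
    dsimp only
    rw [wp_bind]
    refine wp_uniform_le (g := fun _ => d + (R.card + κ * (Q \ R).card + b : ℕ)) hne ?_ ?_ ?_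
    · intro u hu
      rw [← wp_bind]
      have hl : (u :: ((ends (reveal A loc R) e).erase u).toList).toFinset =
          ends (reveal A loc R) e := by
        rw [List.toFinset_cons, Finset.toList_toFinset, Finset.insert_erase hu]
      refine wp_queryUntil_detLoop_le (d := d) (by rw [hl]; exact hEU) hRU hK ?_ ?_
      · rw [hl]
        gcongr
        omega
      · rw [hl]
        intro _
        refine (wp_detLoop_le h hC hQ hU (Finset.union_subset hRU hEU) hm'
          (hκ.mono Finset.subset_union_left) ?_).trans (ENNReal.ofReal_le_ofReal (by gcongr))
        exact fun S hS => hK S (Finset.subset_union_left.trans hS)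
    · intro _ _
      positivity
    · rw [Finset.sum_const, nsmul_eq_mul]

/-- If only one vertex of the query set is missing, a fair coin finds it with probability at least
one half. -/
theorem wp_coinRound_le_of_card_le_one (h : Admissible A loc)
    (hQ : Solved (reveal A loc Q) C) (hU : ∀ e ∈ C, ends A e ⊆ U) (hRU : R ⊆ U) (hd : 0 ≤ d)
    (hm : MissBound A loc C Q R 0) (hcard : (Q \ R).card ≤ 1)
    (hK : ∀ S, R ⊆ S → S ⊆ U → Solved (reveal A loc S) C →
      K (reveal A loc S) S ≤ ENNReal.ofReal (d + S.card)) :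
    wp loc (coinRound tb C (reveal A loc R)) K R ≤ ENNReal.ofReal (d + R.card + 3 / 2) := by
  rw [coinRound]
  split_ifs with hs
  · exact (hK R subset_rfl hRU hs).trans (ENNReal.ofReal_le_ofReal (by linarith))
  · have he := pick_maxUpperEdges_mem (tb := tb) (A := reveal A loc R) (nonempty_of_solved hQ)
    set e := tb.pick (reveal A loc R) (maxUpperEdges (reveal A loc R) C)
    have hne := ends_nonempty_of_mem_maxUpperEdges (h.reveal R) hs he
    have hnd : ¬ Disjoint (ends (reveal A loc R) e) Q := fun hd => by
      have := hm R subset_rfl hs e he hd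
      have := hne.card_pos
      omega
    set E := ends (reveal A loc R) e with hE
    obtain ⟨q, hqE, hqQ⟩ := Finset.not_disjoint_iff.1 hnd
    have hqR : q ∉ R := by
      rw [hE, ends_reveal] at hqE
      exact (Finset.mem_sdiff.1 hqE).2
    have hQR : Q ⊆ insert q R := by
      intro x hx
      by_cases hxR : x ∈ R
      · exact Finset.mem_insert_of_mem hxR
      · rw [Finset.card_le_one.1 hcard x (Finset.mem_sdiff.2 ⟨hx, hxR⟩) q
          (Finset.mem_sdiff.2 ⟨hqQ, hqR⟩)]
        exact Finset.mem_insert_self _ _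
    have hsq : ∀ S, q ∈ S → Solved (reveal A loc (R ∪ S)) C := fun S hS =>
      hQ.reveal_mono h (hQR.trans (Finset.insert_subset (Finset.mem_union_right _ hS)
        Finset.subset_union_left))
    have hEU : E ⊆ U := by
      rw [hE, ends_reveal]
      exact Finset.sdiff_subset.trans (hU e he.1)
    have hE2 : E.card ≤ 2 := card_ends_le_two
    dsimp only
    rw [wp_bind]
    -- If the missing vertex `q` comes first, one query solves the cycle; otherwise at most two do.
    -- As `E` has at most two elements, subtracting 1 for a single outcome lowers the average by at
    -- least 1/2.
    refine wp_uniform_le (g := fun u => d + R.card + 2 - if u = q then 1 else 0) hne ?_ ?_ ?_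
    · intro u hu
      have hl : (u :: (E.erase u).toList).toFinset = E := by
        rw [List.toFinset_cons, Finset.toList_toFinset, Finset.insert_erase hu]
      by_cases huq : u = q
      · subst huq
        obtain ⟨j, hj, h3, h4, h5⟩ := exists_wp_queryUntil (A := A) (loc := loc) (C := C)
          (K := fun a Q => wp loc (detLoop tb C a) K Q) (u :: (E.erase u).toList) R
        have hj1 : j ≤ 1 := by
          by_contra hj1
          exact h5 1 (by omega) (hsq _ (by simp))
        have hs' : Solved (reveal A loc (R ∪ ((u :: (E.erase u).toList).take j).toFinset)) C := by
          rcases h4 with h4 | h4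
          · exact h4
          · rw [h4, List.take_length]
            exact hsq _ (by simp)
        rw [h3, wp_detLoop_of_solved hs']
        refine (hK _ Finset.subset_union_left (Finset.union_subset hRU ?_) hs').trans
          (ENNReal.ofReal_le_ofReal ?_)
        · refine Finset.Subset.trans (fun x hx => ?_) (hl.subset.trans hEU)
          rw [List.mem_toFinset] at hx ⊢
          exact List.mem_of_mem_take hx
        · have h6 := Finset.card_union_le R ((u :: (E.erase u).toList).take j).toFinset
          have h7 := List.toFinset_card_le ((u :: (E.erase u).toList).take j)
          rw [List.length_take] at h7
          have h8 : (R ∪ ((u :: (E.erase u).toList).take j).toFinset).card ≤ R.card + 1 := by omega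
          have h9 : ((R ∪ ((u :: (E.erase u).toList).take j).toFinset).card : ℝ) ≤ R.card + 1 := by
            exact_mod_cast h8
          simp only [if_true]
          linarith
      · rw [← wp_bind, if_neg huq]
        refine wp_queryUntil_detLoop_le (d := d) (by rw [hl]; exact hEU) hRU hK ?_ ?_
        · rw [hl]
          have h6 : (R ∪ E).card ≤ R.card + 2 := (Finset.card_union_le _ _).trans (by omega)
          have h7 : ((R ∪ E).card : ℝ) ≤ R.card + 2 := by exact_mod_cast h6
          linarith
        · rw [hl]
          exact fun hn => absurd (hsq E hqE) hn
    · intro u _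
      have : (0 : ℝ) ≤ R.card := by positivity
      split_ifs <;> linarith
    · rw [Finset.sum_sub_distrib, Finset.sum_const, Finset.sum_ite_eq' E q, if_pos hqE,
        nsmul_eq_mul]
      have : (E.card : ℝ) ≤ 2 := by exact_mod_cast hE2
      linarith

theorem wp_rand3_le (h : Admissible A loc) (hC : IsCycleSet C)
    (hQ : Solved (reveal A loc Q) C) (hU : ∀ e ∈ C, ends A e ⊆ U) (hRU : R ⊆ U) (hd : 0 ≤ d)
    (hm : MissBound A loc C Q R b)
    (hK : ∀ S, R ⊆ S → S ⊆ U → Solved (reveal A loc S) C →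
      K (reveal A loc S) S ≤ ENNReal.ofReal (d + S.card)) :
    wp loc (rand3 tb C (reveal A loc R)) K R ≤
      ENNReal.ofReal (d + (R.card + 2 * (Q \ R).card + b : ℕ)) := by
  rw [rand3_eq, wp_bind]
  refine wp_detRounds_le h hC hQ hU _ hRU hm endsBound_two fun S b' hS hSU hmS _ _ => ?_
  exact wp_coinRound_le h hC hQ hU hSU hd hmS endsBound_two fun S' hS' => hK S' (hS.trans hS')

/-- With no miss possible, the two deterministic rounds cost at most four queries and leave at most
one vertex of `Q`, which the coin round finds at expected cost at most 3/2; `4 + 3/2 = 11/2`. -/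
theorem wp_rand3_le_of_card_eq_three (h : Admissible A loc)
    (hQ : Solved (reveal A loc Q) C) (hU : ∀ e ∈ C, ends A e ⊆ U) (hRU : R ⊆ U) (hd : 0 ≤ d)
    (hm : MissBound A loc C Q R 0) (hcard : (Q \ R).card ≤ 3)
    (hK : ∀ S, R ⊆ S → S ⊆ U → Solved (reveal A loc S) C →
      K (reveal A loc S) S ≤ ENNReal.ofReal (d + S.card)) :
    wp loc (rand3 tb C (reveal A loc R)) K R ≤ ENNReal.ofReal (d + R.card + 11 / 2) := by
  have step : ∀ {S : Finset V} {e : Sym2 V}, R ⊆ S → S ⊆ U → ¬ Solved (reveal A loc S) C →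
      e ∈ maxUpperEdges (reveal A loc S) C →
      S ∪ ends (reveal A loc S) e ⊆ U ∧ (S ∪ ends (reveal A loc S) e).card ≤ S.card + 2 ∧
      (Q \ (S ∪ ends (reveal A loc S) e)).card + 1 ≤ (Q \ S).card := by
    intro S e hS hSU hs he
    refine ⟨Finset.union_subset hSU ?_, ?_, ?_⟩
    · rw [ends_reveal]
      exact Finset.sdiff_subset.trans (hU e he.1)
    · exact (Finset.card_union_le _ _).trans (by gcongr; exact card_ends_le_two)
    · have hnd : ¬ Disjoint (ends (reveal A loc S) e) Q := fun hd => by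
        have h1 := hm S hS hs e he hd
        have := (ends_nonempty_of_mem_maxUpperEdges (h.reveal S) hs he).card_pos
        omega
      obtain ⟨x, hxE, hxQ⟩ := Finset.not_disjoint_iff.1 hnd
      refine Finset.card_lt_card ((Finset.ssubset_iff_of_subset ?_).2 ⟨x, ?_, ?_⟩)
      · exact Finset.sdiff_subset_sdiff subset_rfl Finset.subset_union_left
      · rw [ends_reveal] at hxE
        exact Finset.mem_sdiff.2 ⟨hxQ, (Finset.mem_sdiff.1 hxE).2⟩
      · simp [hxE]
  have hCne := nonempty_of_solved hQ
  have hsolved : ∀ S, S.card ≤ R.card + 4 → R ⊆ S → S ⊆ U → Solved (reveal A loc S) C →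
      wp loc (coinRound tb C (reveal A loc S)) K S ≤ ENNReal.ofReal (d + R.card + 11 / 2) := by
    intro S hc hS hSU hs
    rw [coinRound, if_pos hs, wp_done]
    refine (hK S hS hSU hs).trans (ENNReal.ofReal_le_ofReal ?_)
    have : (S.card : ℝ) ≤ R.card + 4 := by exact_mod_cast hc
    linarith
  rw [rand3_eq, wp_bind]
  refine wp_detRounds_succ_le hCne (hsolved R (by omega) subset_rfl hRU) ?_
  intro hs e he
  obtain ⟨h1, h2, h3⟩ := step subset_rfl hRU hs he
  have hR1 : R ⊆ R ∪ ends (reveal A loc R) e := Finset.subset_union_left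
  generalize R ∪ ends (reveal A loc R) e = R₁ at *
  refine wp_detRounds_succ_le hCne (hsolved R₁ (by omega) hR1 h1) ?_
  intro hs' e' he'
  obtain ⟨h1', h2', h3'⟩ := step hR1 h1 hs' he'
  have hR2 : R ⊆ R₁ ∪ ends (reveal A loc R₁) e' := hR1.trans Finset.subset_union_left
  generalize R₁ ∪ ends (reveal A loc R₁) e' = R₂ at *
  rw [detRounds, wp_done]
  refine (wp_coinRound_le_of_card_le_one h hQ hU h1' hd (hm.mono hR2) (by omega)
    fun S hS => hK S (hR2.trans hS)).trans (ENNReal.ofReal_le_ofReal ?_)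
  have h4 : R₂.card ≤ R.card + 4 := by omega
  have : (R₂.card : ℝ) ≤ R.card + 4 := by exact_mod_cast h4
  linarith

end Deterministic

/-! ### Smallest vertex covers. -/

section Cover

variable {V : Type} [Fintype V] [DecidableEq V] {A : Areas V} {X : Finset (Sym2 V)}
  {f : Sym2 V} {W W' : Finset V}

theorem coverNumber_le (h : IsCover A X f W) : coverNumber A X f ≤ W.card :=
  iInf₂_le W h

theorem exists_isCover_of_coverNumber_ne_top (h : coverNumber A X f ≠ ⊤) :
    ∃ W, IsCover A X f W ∧ (W.card : ℕ∞) = coverNumber A X f := by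
  obtain ⟨W, hW⟩ := exists_eq_ciInf_of_finite
    (f := fun W : Finset V => ⨅ (_ : IsCover A X f W), (W.card : ℕ∞))
  have hW' : (⨅ (_ : IsCover A X f W), (W.card : ℕ∞)) = coverNumber A X f := hW
  by_cases hc : IsCover A X f W
  · exact ⟨W, hc, by rw [← hW', iInf_pos hc]⟩
  · rw [iInf_neg hc] at hW'
    exact absurd hW'.symm h

theorem mem_smallestCovers :
    W ∈ smallestCovers A X f ↔ IsCover A X f W ∧ (W.card : ℕ∞) = coverNumber A X f := by
  simp [smallestCovers]

/-- A smallest cover that is disjoint from another one is determined by the latter. -/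
theorem eq_of_disjoint_smallestCovers {W₀ : Finset V} (h₀ : W₀ ∈ smallestCovers A X f)
    (h : W ∈ smallestCovers A X f) (h' : W' ∈ smallestCovers A X f) (hd : Disjoint W W₀)
    (hd' : Disjoint W' W₀) : W = W' := by
  rw [mem_smallestCovers] at h₀ h h'
  -- A cover disjoint from `W₀` remains one after intersecting it with the endpoints of `X` outside
  -- `W₀`; minimality makes it a subset of these endpoints.
  have key : ∀ {Z : Finset V}, IsCover A X f Z ∧ (Z.card : ℕ∞) = coverNumber A X f →
      Disjoint Z W₀ → Finset.univ.filter (fun v => v ∉ W₀ ∧ ∃ e ∈ X, v ∈ e) ∩ Z = Z := by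
    intro Z hZ hdZ
    refine Finset.eq_of_subset_of_card_le Finset.inter_subset_right ?_
    have hc : IsCover A X f
        (Finset.univ.filter (fun v => v ∉ W₀ ∧ ∃ e ∈ X, v ∈ e) ∩ Z) := by
      refine ⟨fun v hv => hZ.1.1 v (Finset.mem_inter.1 hv).2, fun e he => ?_⟩
      obtain ⟨v, hv, hve⟩ := hZ.1.2 e he
      refine ⟨v, Finset.mem_inter.2 ⟨?_, hv⟩, hve⟩
      simp only [Finset.mem_filter, Finset.mem_univ, true_and]
      exact ⟨Finset.disjoint_left.1 hdZ hv, e, he, hve⟩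
    have := coverNumber_le hc
    rw [← hZ.2] at this
    exact_mod_cast this
  -- Every edge of `X` has one end in `W₀` and another in `Z`, so all its ends outside `W₀` lie in
  -- `Z`. Together with `key`, `Z` equals this set of endpoints.
  have other : ∀ {Z : Finset V}, IsCover A X f Z → Disjoint Z W₀ →
      Finset.univ.filter (fun v => v ∉ W₀ ∧ ∃ e ∈ X, v ∈ e) ⊆ Z := by
    intro Z hZ hdZ v hv
    simp only [Finset.mem_filter, Finset.mem_univ, true_and] at hv
    obtain ⟨hv₀, e, he, hve⟩ := hv
    obtain ⟨u, hu, hue⟩ := h₀.1.2 e he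
    obtain ⟨z, hz, hze⟩ := hZ.2 e he
    have hzu : z ≠ u := fun hzu => Finset.disjoint_left.1 hdZ hz (hzu ▸ hu)
    have huv : u ≠ v := fun huv => hv₀ (huv ▸ hu)
    rw [(Sym2.mem_and_mem_iff huv).1 ⟨hue, hve⟩, Sym2.mem_iff] at hze
    rcases hze with hze | hze
    · exact absurd hze hzu
    · exact hze ▸ hz
  have e1 := key h hd
  have e2 := key h' hd'
  rw [Finset.inter_eq_left.2 (other h.1 hd)] at e1
  rw [Finset.inter_eq_left.2 (other h'.1 hd')] at e2
  exact e1.symm.trans e2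

/-- On average, a smallest cover of size two misses at most one vertex of a given one. -/
theorem sum_card_sdiff_smallestCovers_le (h2 : coverNumber A X f = 2)
    (h : W ∈ smallestCovers A X f) :
    ∑ Z ∈ smallestCovers A X f, (W \ Z).card ≤ (smallestCovers A X f).card := by
  classical
  have hW2 : W.card = 2 := by
    have := (mem_smallestCovers.1 h).2
    rw [h2] at this
    exact_mod_cast this
  set D := (smallestCovers A X f).filter fun Z => Disjoint Z W with hD
  have hD1 : D.card ≤ 1 := by
    refine Finset.card_le_one.2 fun Z hZ Z' hZ' => ?_
    rw [hD, Finset.mem_filter] at hZ hZ'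
    exact eq_of_disjoint_smallestCovers h hZ.1 hZ'.1 hZ.2 hZ'.2
  -- `W` itself misses nothing, a cover meeting `W` misses at most one vertex, and the at most one
  -- disjoint cover misses two; its excess is balanced by `W`.
  have hle : ∀ Z ∈ smallestCovers A X f,
      (W \ Z).card + (if Z = W then 1 else 0) ≤ 1 + (if Disjoint Z W then 1 else 0) := by
    intro Z hZ
    have h1 := Finset.card_sdiff_add_card_inter W Z
    by_cases hZW : Z = W
    · subst hZW
      simp
    · by_cases hd : Disjoint Z W
      · simp only [hZW, hd, if_true, if_false]
        omega
      · have : 0 < (W ∩ Z).card := by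
          rw [Finset.card_pos, Finset.inter_comm]
          exact Finset.not_disjoint_iff_nonempty_inter.1 hd
        simp only [hZW, hd, if_false]
        omega
  have hsum := Finset.sum_le_sum hle
  rw [Finset.sum_add_distrib, Finset.sum_add_distrib, Finset.sum_ite_eq' _ W, if_pos h,
    Finset.sum_const, smul_eq_mul, mul_one, ← Finset.card_filter] at hsum
  have : (Finset.filter (fun Z => Disjoint Z W) (smallestCovers A X f)).card ≤ 1 := hD1
  omega

end Cover

/-! ### Consequences of the closing edge having both largest limits. -/

section CycleFacts

variable {V : Type} [Fintype V] [DecidableEq V] {A : Areas V} {loc : V → Plane}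
  {Q R S : Finset V} {C : Finset (Sym2 V)} {e f g : Sym2 V}

/-- The edge `f` has the largest lower and the largest upper limit in the unsolved cycle `C`. -/
structure IsTop (A : Areas V) (loc : V → Plane) (C : Finset (Sym2 V)) (f : Sym2 V) : Prop where
  admissible : Admissible A loc
  isCycleSet : IsCycleSet C
  not_solved : ¬ Solved A C
  mem_maxUpper : f ∈ maxUpperEdges A C
  lower_le : ∀ e ∈ C, lower A e ≤ lower A f

theorem mem_neighbors : e ∈ neighbors A C f ↔ e ∈ C ∧ e ≠ f ∧ lower A f < upper A e := by
  simp [neighbors]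

namespace IsTop

variable (t : IsTop A loc C f)

include t

theorem ends_nonempty : (ends A f).Nonempty :=
  ends_nonempty_of_mem_maxUpperEdges t.admissible t.not_solved t.mem_maxUpper

theorem neighbors_nonempty : (neighbors A C f).Nonempty := by
  by_contra hX
  rw [Finset.not_nonempty_iff_eq_empty] at hX
  refine t.not_solved ⟨f, t.mem_maxUpper.1, fun e he hef => ?_⟩
  by_contra hlt
  exact Finset.notMem_empty e (hX ▸ mem_neighbors.2 ⟨he, hef, not_le.1 hlt⟩)

/-- Without a query at `f`, only `f` can become always maximal, and with its old lower limit. Every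
edge whose upper limit exceeds this has to be touched. -/
theorem isCover_of_disjoint (hQ : Solved (reveal A loc Q) C) (hQn : ∀ v ∈ Q, (A v).Nontrivial)
    (hd : Disjoint (ends A f) Q) : IsCover A (neighbors A C f) f Q := by
  refine ⟨fun v hv => ⟨hQn v hv, fun hvf => ?_⟩, fun e he => ?_⟩
  · exact Finset.disjoint_left.1 hd (mem_ends.2 ⟨hvf, hQn v hv⟩) hv
  · obtain ⟨heC, hef, hlt⟩ := mem_neighbors.1 he
    by_contra hne
    push Not at hne
    have hde : Disjoint (ends A e) Q :=
      Finset.disjoint_left.2 fun v hv hvQ => hne v hvQ (mem_ends.1 hv).1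
    have h1 := (alwaysMaximal_of_disjoint t.admissible t.isCycleSet t.not_solved t.mem_maxUpper
      hQ hd).1.2 e heC hef
    rw [upper_reveal_of_disjoint t.admissible hde, lower_reveal_of_disjoint t.admissible hd] at h1
    exact h1.not_gt hlt

theorem trueLength_lt_of_disjoint (hQ : Solved (reveal A loc Q) C) (hd : Disjoint (ends A f) Q)
    (he : e ∈ C) (hef : e ≠ f) : trueLength loc e < trueLength loc f := by
  obtain ⟨h1, -, h2⟩ := alwaysMaximal_of_disjoint t.admissible t.isCycleSet t.not_solved
    t.mem_maxUpper hQ hd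
  have h3 := h1.2 e he hef
  rw [lower_reveal_of_disjoint t.admissible hd] at h3
  have h4 := trueLength_le_upper (t.admissible.reveal Q) e
  exact EReal.coe_lt_coe_iff.1 ((h4.trans h3).trans_lt h2)

theorem missBound_zero_of_disjoint (hQ : Solved (reveal A loc Q) C)
    (hd : Disjoint (ends A f) Q) (hR : ends A f ⊆ R) : MissBound A loc C Q R 0 :=
  fun _ hS hsS _ hg hdg => absurd hdg (not_disjoint_of_disjoint t.admissible t.isCycleSet
    t.not_solved t.mem_maxUpper hQ hd (hR.trans hS) hsS hg)

theorem lower_lt_trueLength (hpos : 0 < trueLength loc f) : lower A f < trueLength loc f :=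
  VMST.lower_lt_trueLength t.admissible (t.isCycleSet.not_isDiag f t.mem_maxUpper.1)
    t.ends_nonempty hpos

theorem ne_of_mem_maxUpperEdges (hR : ends A f ⊆ R) (hs : ¬ Solved (reveal A loc R) C)
    (hg : g ∈ maxUpperEdges (reveal A loc R) C) : g ≠ f := by
  rintro rfl
  have := ends_nonempty_of_mem_maxUpperEdges (t.admissible.reveal R) hs hg
  rw [ends_reveal, Finset.sdiff_eq_empty_iff_subset.2 hR] at this
  exact Finset.not_nonempty_empty this

theorem lower_reveal_eq (hR : ends A f ⊆ R) : lower (reveal A loc R) f = trueLength loc f :=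
  lower_eq_trueLength (t.admissible.reveal R)
    (by rw [ends_reveal, Finset.sdiff_eq_empty_iff_subset.2 hR])

/-- Suppose a missed edge `e` had two unqueried ends. Its lower limit would be the original one,
hence at most that of `f` and strictly below the true length of `f`. But the miss makes `e` dominate
`f`. -/
theorem missBound_one (hQ : Solved (reveal A loc Q) C) (hR : ends A f ⊆ R) :
    MissBound A loc C Q R 1 := by
  intro S hS hs e he hd
  have hQ' : Solved (reveal (reveal A loc S) loc Q) C := by
    rw [reveal_reveal]
    exact hQ.reveal_mono t.admissible Finset.subset_union_right
  obtain ⟨h1, h2, -⟩ := alwaysMaximal_of_disjoint (t.admissible.reveal S) t.isCycleSet hs he hQ' hd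
  by_contra hcard
  have hall : ∀ v ∈ e, v ∈ ends (reveal A loc S) e := by
    have heq : ends (reveal A loc S) e = e.toFinset := by
      refine Finset.eq_of_subset_of_card_le ends_subset_toFinset ?_
      have := card_toFinset_le_two e
      omega
    intro v hv
    rw [heq]
    simpa using hv
  have hlow : lower (reveal A loc S) e = lower A e := by
    refine lower_congr fun v hv => ?_
    have := hall v hv
    rw [ends_reveal, Finset.mem_sdiff] at this
    simp [reveal, this.2]
  have hfe := (t.ne_of_mem_maxUpperEdges (hR.trans hS) hs he).symm
  have h3 := h1.2 f t.mem_maxUpper.1 hfe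
  rw [lower_reveal_of_disjoint (t.admissible.reveal S) hd, hlow] at h3
  have h4 := trueLength_le_upper ((t.admissible.reveal S).reveal Q) f
  rw [hlow] at h2
  have h5 := t.lower_le e he.1
  have hpos : (0 : EReal) < trueLength loc f :=
    (h2.trans_le h5).trans_le (lower_le_trueLength t.admissible f)
  have h6 := t.lower_lt_trueLength (by exact_mod_cast hpos)
  exact absurd h6 ((h4.trans h3).trans h5).not_gt

/-- If the query set contains an end vertex of `f`, only edges that it touches can become always
maximal without a query of an end vertex by the query set. -/
theorem not_disjoint_ends (hQ : Solved (reveal A loc Q) C)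
    (hs : ¬ Solved (reveal A loc R) C) (he : e ∈ maxUpperEdges (reveal A loc R) C)
    (hd : Disjoint (ends (reveal A loc R) e) Q) (hfQ : ¬ Disjoint (ends A f) Q) :
    ¬ Disjoint (ends A e) Q := by
  intro hde
  have h := t.admissible
  have hQ' : Solved (reveal (reveal A loc R) loc Q) C := by
    rw [reveal_reveal]
    exact hQ.reveal_mono h Finset.subset_union_right
  obtain ⟨h1, -, -⟩ := alwaysMaximal_of_disjoint (h.reveal R) t.isCycleSet hs he hQ' hd
  have hne : (ends A e).Nonempty := by
    refine (ends_nonempty_of_mem_maxUpperEdges (h.reveal R) hs he).mono ?_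
    rw [ends_reveal]
    exact Finset.sdiff_subset
  obtain ⟨k, hk⟩ := hQ
  have hfe : f ≠ e := fun hfe => hfQ (hfe ▸ hde)
  -- If `e` is maximal after `Q`, it dominates `f` with its original lower limit, although the true
  -- length of `f` is larger. If another `k` is, then `k` is at least the original upper limit of
  -- `e`, while the miss makes it at most the true length of `e`.
  by_cases hke : k = e
  · subst hke
    have hpos : 0 < lower (reveal A loc Q) k := by
      refine lower_pos_of_alwaysMaximal (h.reveal Q) t.isCycleSet hk ?_
      rwa [ends_reveal, Finset.sdiff_eq_self_of_disjoint hde]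
    have h2 := hk.2 f t.mem_maxUpper.1 hfe
    rw [lower_reveal_of_disjoint h hde] at h2 hpos
    have h3 := trueLength_le_upper (h.reveal Q) f
    have h4 := t.lower_le k hk.1
    have hpos' : (0 : EReal) < trueLength loc f :=
      (hpos.trans_le h4).trans_le (lower_le_trueLength h f)
    have h6 := t.lower_lt_trueLength (by exact_mod_cast hpos')
    exact absurd h6 ((h3.trans h2).trans h4).not_gt
  · have h2 := hk.2 e he.1 (Ne.symm hke)
    rw [upper_reveal_of_disjoint h hde] at h2
    have h3 := lower_le_trueLength (h.reveal Q) k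
    have h4 := h1.2 k hk.1 hke
    have h5 := trueLength_le_upper ((h.reveal R).reveal Q) k
    have h6 := lower_le_trueLength ((h.reveal R).reveal Q) e
    have h7 := trueLength_lt_upper h (t.isCycleSet.not_isDiag e he.1) hne
    exact absurd h7 ((h2.trans h3).trans ((h5.trans h4).trans h6)).not_gt

/-- Once `f` is known, an edge outside `X` has upper limit at most the length of `f`; if such an
edge had the largest upper limit, `f` would be always maximal. Hence a cover of `X` meets every edge
that is chosen later. -/
theorem mem_neighbors_of_mem_maxUpperEdges (hR : ends A f ⊆ R)
    (hs : ¬ Solved (reveal A loc R) C) (hg : g ∈ maxUpperEdges (reveal A loc R) C) :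
    g ∈ neighbors A C f := by
  refine mem_neighbors.2 ⟨hg.1, t.ne_of_mem_maxUpperEdges hR hs hg, ?_⟩
  by_contra hlt
  rw [not_lt] at hlt
  refine hs ⟨f, t.mem_maxUpper.1, fun e he _ => ?_⟩
  rw [t.lower_reveal_eq hR]
  exact (hg.2 e he).trans ((upper_reveal_le_upper t.admissible R g).trans
    (hlt.trans (lower_le_trueLength t.admissible f)))

theorem solved_of_subset (hR : ends A f ⊆ R) (hX : ∀ e ∈ neighbors A C f, ends A e ⊆ R) :
    Solved (reveal A loc R) C := by
  by_contra hs
  obtain ⟨g, hg⟩ := maxUpperEdges_nonempty (A := reveal A loc R) ⟨f, t.mem_maxUpper.1⟩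
  have h1 := ends_nonempty_of_mem_maxUpperEdges (t.admissible.reveal R) hs hg
  have h2 := hX g (t.mem_neighbors_of_mem_maxUpperEdges hR hs hg)
  rw [ends_reveal, Finset.sdiff_eq_empty_iff_subset.2 h2] at h1
  exact Finset.not_nonempty_empty h1

theorem coverNumber_ne_zero : coverNumber A (neighbors A C f) f ≠ 0 := by
  intro h0
  obtain ⟨W, hW, hc⟩ := exists_isCover_of_coverNumber_ne_top (A := A) (X := neighbors A C f)
    (f := f) (by rw [h0]; exact ENat.zero_ne_top)
  rw [h0] at hc
  have hW0 : W = ∅ := by simpa using hc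
  obtain ⟨e, he⟩ := t.neighbors_nonempty
  obtain ⟨v, hv, -⟩ := hW.2 e he
  simp [hW0] at hv

end IsTop

end CycleFacts

/-! ### Random orders and the subroutine Rand1. -/

section Subroutines

variable {V : Type} [Fintype V] [DecidableEq V] {A : Areas V} {loc : V → Plane}
  {Q R S U : Finset V} {C : Finset (Sym2 V)} {e f g : Sym2 V}
  {K : Areas V → Finset V → ℝ≥0∞} {d : ℝ}

/-- Reversing an order replaces index `i` by `n - 1 - i`, so twice the average index is `n - 1`. The
average position, counted from one, is thus `(n + 1) / 2`. -/
theorem sum_symm_val {n : ℕ} {β : Type*} [Fintype β] [DecidableEq β] (q : β) :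
    ∑ σ : Fin n ≃ β, (2 * ((σ.symm q : Fin n) : ℕ) + 1) = Fintype.card (Fin n ≃ β) * n := by
  have h : ∑ σ : Fin n ≃ β, ((σ.symm q : Fin n) : ℕ) =
      ∑ σ : Fin n ≃ β, ((Fin.rev (σ.symm q) : Fin n) : ℕ) := by
    refine Fintype.sum_equiv (Equiv.equivCongr Fin.revPerm (Equiv.refl β)) _ _ fun σ => ?_
    simp [Equiv.equivCongr]
  have h2 : ∑ σ : Fin n ≃ β, (2 * ((σ.symm q : Fin n) : ℕ) + 1) =
      ∑ σ : Fin n ≃ β, (((σ.symm q : Fin n) : ℕ) + ((Fin.rev (σ.symm q) : Fin n) : ℕ) + 1) := by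
    simp only [two_mul, Finset.sum_add_distrib, h]
  rw [h2, Finset.sum_congr rfl (g := fun _ => n), Finset.sum_const, smul_eq_mul, Finset.card_univ]
  intro σ _
  have := (σ.symm q).isLt
  rw [Fin.val_rev]
  omega

theorem card_biUnion_toFinset_le {X : Finset (Sym2 V)} {w : V} (hw : ∀ e ∈ X, w ∈ e) :
    (X.biUnion Sym2.toFinset).card ≤ X.card + 1 := by
  have hsub : X.biUnion Sym2.toFinset ⊆ insert w (X.biUnion fun e => e.toFinset.erase w) := by
    intro v hv
    obtain ⟨e, he, hve⟩ := Finset.mem_biUnion.1 hv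
    by_cases hvw : v = w
    · rw [hvw]
      exact Finset.mem_insert_self _ _
    · exact Finset.mem_insert_of_mem
        (Finset.mem_biUnion.2 ⟨e, he, Finset.mem_erase.2 ⟨hvw, hve⟩⟩)
  have h1 : (X.biUnion fun e => e.toFinset.erase w).card ≤ X.card * 1 := by
    refine Finset.card_biUnion_le_card_mul _ _ _ fun e he => ?_
    rw [Finset.card_erase_of_mem (by simpa using hw e he)]
    have := card_toFinset_le_two e
    omega
  have h2 := Finset.card_le_card hsub
  have h3 := Finset.card_insert_le w (X.biUnion fun e => e.toFinset.erase w)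
  omega

theorem card_ends_reveal_le_one {w : V} (hw : w ∈ e) (hR : w ∈ R) :
    (ends (reveal A loc R) e).card ≤ 1 := by
  have hsub : ends (reveal A loc R) e ⊆ e.toFinset.erase w := by
    intro v hv
    rw [ends_reveal, Finset.mem_sdiff] at hv
    exact Finset.mem_erase.2 ⟨fun h => hv.2 (h ▸ hR), ends_subset_toFinset hv.1⟩
  have h1 := Finset.card_le_card hsub
  rw [Finset.card_erase_of_mem (by simpa using hw)] at h1
  have := card_toFinset_le_two e
  omega

namespace IsTop

variable (t : IsTop A loc C f)

include t

theorem query_nonempty (hQ : Solved (reveal A loc Q) C) : Q.Nonempty := by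
  by_contra hne
  rw [Finset.not_nonempty_iff_eq_empty] at hne
  rw [hne, reveal_empty] at hQ
  exact t.not_solved hQ

/-- If `|Q| = 1`, its vertex is in `f` or common to all of `X`, hence one of at most four vertices
in random order, with mean position at most 5/2. If `|Q| ≥ 2`, it suffices that at most five
vertices are queried at all. The hypothesis `reveal A loc R = A` says that `A` already contains the
results of the queries in `R`. -/
theorem wp_rand1_le (hQ : Solved (reveal A loc Q) C) (hQn : ∀ v ∈ Q, (A v).Nontrivial)
    (hU : ∀ e ∈ C, ends A e ⊆ U) (hRU : R ⊆ U) (hRA : reveal A loc R = A) (hd : 0 ≤ d)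
    (ha : coverNumber A (neighbors A C f) f = 1)
    (hK : ∀ S, R ⊆ S → S ⊆ U → Solved (reveal A loc S) C →
      K (reveal A loc S) S ≤ ENNReal.ofReal (d + S.card)) :
    wp loc (rand1 C (neighbors A C f) f A) K R ≤ ENNReal.ofReal (d + R.card + 5 / 2 * Q.card) := by
  classical
  have hQpos := (t.query_nonempty hQ).card_pos
  obtain ⟨W, hW, hWc⟩ := exists_isCover_of_coverNumber_ne_top (A := A) (X := neighbors A C f)
    (f := f) (by rw [ha]; exact ENat.one_ne_top)
  have hW1 : W.card = 1 := by
    rw [ha] at hWc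
    exact_mod_cast hWc
  obtain ⟨w, rfl⟩ := Finset.card_eq_one.1 hW1
  have hw : ∀ e ∈ neighbors A C f, w ∈ e := by
    intro e he
    obtain ⟨v, hv, hve⟩ := hW.2 e he
    rwa [Finset.mem_singleton.1 hv] at hve
  -- All edges of `X` pass through `w`, and a vertex of a cycle has degree two.
  have hX2 : (neighbors A C f).card ≤ 2 := by
    refine (Finset.card_le_card fun e he => ?_).trans (t.isCycleSet.card_le_two w)
    exact Finset.mem_filter.2 ⟨(mem_neighbors.1 he).1, hw e he⟩
  have hXne := t.neighbors_nonempty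
  set X := neighbors A C f with hX
  rw [rand1]
  rw [wp_bind]
  generalize hSdef : (Finset.univ.filter fun v => (A v).Nontrivial ∧ (v ∈ f ∨ ∀ e ∈ X, v ∈ e)) = S
  have hmemS : ∀ v, v ∈ S ↔ (A v).Nontrivial ∧ (v ∈ f ∨ ∀ e ∈ X, v ∈ e) := by
    intro v
    rw [← hSdef]
    simp
  obtain ⟨e₀, he₀⟩ := hXne
  have hSU : S ⊆ U := by
    intro v hv
    obtain ⟨h1, h2⟩ := (hmemS v).1 hv
    rcases h2 with h2 | h2
    · exact hU f t.mem_maxUpper.1 (mem_ends.2 ⟨h2, h1⟩)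
    · exact hU e₀ (mem_neighbors.1 he₀).1 (mem_ends.2 ⟨h2 e₀ he₀, h1⟩)
  have hS4 : S.card ≤ 4 := by
    have hsub : S ⊆ f.toFinset ∪ e₀.toFinset := by
      intro v hv
      rcases ((hmemS v).1 hv).2 with h2 | h2
      · exact Finset.mem_union_left _ (by simpa using h2)
      · exact Finset.mem_union_right _ (by simpa using h2 e₀ he₀)
    have := Finset.card_le_card hsub
    have := Finset.card_union_le f.toFinset e₀.toFinset
    have := card_toFinset_le_two f
    have := card_toFinset_le_two e₀
    omega
  -- Two vertices of `f`, and at most three of two edges with the common vertex `w`.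
  have hall5 : (S ∪ X.biUnion Sym2.toFinset).card ≤ 5 := by
    have hsub : S ∪ X.biUnion Sym2.toFinset ⊆ f.toFinset ∪ X.biUnion Sym2.toFinset := by
      refine Finset.union_subset (fun v hv => ?_) Finset.subset_union_right
      rcases ((hmemS v).1 hv).2 with h2 | h2
      · exact Finset.mem_union_left _ (by simpa using h2)
      · exact Finset.mem_union_right _ (Finset.mem_biUnion.2 ⟨e₀, he₀, by simpa using h2 e₀ he₀⟩)
    have := Finset.card_le_card hsub
    have := Finset.card_union_le f.toFinset (X.biUnion Sym2.toFinset)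
    have := card_toFinset_le_two f
    have := card_biUnion_toFinset_le hw
    omega
  have hfS : ends A f ⊆ S := fun v hv =>
    (hmemS v).2 ⟨(mem_ends.1 hv).2, Or.inl (mem_ends.1 hv).1⟩
  set K' : Areas V → Finset V → ℝ≥0∞ := fun a P => wp loc
    (if Solved a C then done a else querySet a (X.biUnion (ends a))) K P with hK'
  have hlist : ∀ σ : Fin S.card ≃ {v // v ∈ S}, ∀ v, v ∈ List.ofFn (fun i => (σ i : V)) ↔ v ∈ S := by
    intro σ v
    rw [List.mem_ofFn]
    constructor
    · rintro ⟨i, rfl⟩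
      exact (σ i).2
    · exact fun hv => ⟨σ.symm ⟨v, hv⟩, by simp⟩
  have hfin : ∀ P, P ⊆ S → (Solved (reveal A loc (R ∪ P)) C ∨ P = S) →
      K' (reveal A loc (R ∪ P)) (R ∪ P) ≤ ENNReal.ofReal (d + R.card + 5) := by
    intro P hPS hor
    simp only [hK']
    split_ifs with hs
    · rw [wp_done]
      refine (hK _ Finset.subset_union_left (Finset.union_subset hRU (hPS.trans hSU)) hs).trans
        (ENNReal.ofReal_le_ofReal ?_)
      have h1 : (R ∪ P).card ≤ R.card + 4 :=
        (Finset.card_union_le _ _).trans (by have := Finset.card_le_card hPS; omega)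
      have : ((R ∪ P).card : ℝ) ≤ R.card + 4 := by exact_mod_cast h1
      linarith
    · have hP := hor.resolve_left hs
      subst hP
      rw [wp_querySet]
      have hE : X.biUnion (ends (reveal A loc (R ∪ P))) ⊆ X.biUnion Sym2.toFinset := by
        intro v hv
        obtain ⟨e, he, hve⟩ := Finset.mem_biUnion.1 hv
        exact Finset.mem_biUnion.2 ⟨e, he, ends_subset_toFinset hve⟩
      refine (hK _ (Finset.subset_union_left.trans Finset.subset_union_left)
        (Finset.union_subset (Finset.union_subset hRU hSU) ?_) ?_).trans
        (ENNReal.ofReal_le_ofReal ?_)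
      · intro v hv
        obtain ⟨e, he, hve⟩ := Finset.mem_biUnion.1 hv
        rw [ends_reveal, Finset.mem_sdiff] at hve
        exact hU e (mem_neighbors.1 he).1 hve.1
      · refine t.solved_of_subset ?_ fun e he v hv => ?_
        · exact hfS.trans (Finset.subset_union_right.trans Finset.subset_union_left)
        · by_cases hvR : v ∈ R ∪ P
          · exact Finset.mem_union_left _ hvR
          · refine Finset.mem_union_right _ (Finset.mem_biUnion.2 ⟨e, he, ?_⟩)
            rw [ends_reveal]
            exact Finset.mem_sdiff.2 ⟨hv, hvR⟩
      · have h1 : (R ∪ P ∪ X.biUnion (ends (reveal A loc (R ∪ P)))).card ≤ R.card + 5 := by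
          rw [Finset.union_assoc]
          refine (Finset.card_union_le _ _).trans ?_
          have := Finset.card_le_card (Finset.union_subset_union_right (s := P) hE)
          omega
        have h2 : ((R ∪ P ∪ X.biUnion (ends (reveal A loc (R ∪ P)))).card : ℝ) ≤ R.card + 5 := by
          exact_mod_cast h1
        linarith
  have huniv : (Finset.univ : Finset (Fin S.card ≃ {v // v ∈ S})).Nonempty :=
    ⟨S.equivFin.symm, Finset.mem_univ _⟩
  by_cases hQ1 : Q.card = 1
  · obtain ⟨q, rfl⟩ := Finset.card_eq_one.1 hQ1
    have hqS : q ∈ S := by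
      refine (hmemS q).2 ⟨hQn q (Finset.mem_singleton_self q), ?_⟩
      by_cases hqf : q ∈ f
      · exact Or.inl hqf
      · refine Or.inr fun e he => ?_
        obtain ⟨v, hv, hve⟩ := (t.isCover_of_disjoint hQ hQn
          (Finset.disjoint_singleton_right.2 fun h => hqf (mem_ends.1 h).1)).2 e he
        rwa [Finset.mem_singleton.1 hv] at hve
    refine wp_uniform_le (g := fun σ => d + R.card +
      (((σ.symm ⟨q, hqS⟩ : Fin S.card) : ℕ) + 1 : ℕ)) huniv ?_ ?_ ?_
    · intro σ _
      obtain ⟨j, hj, h3, h4, h5⟩ := exists_wp_queryUntil (A := A) (loc := loc) (C := C)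
        (K := K') (List.ofFn fun i => (σ i : V)) R
      rw [hRA] at h3
      rw [h3]
      set i := (σ.symm ⟨q, hqS⟩ : Fin S.card) with hi
      have hq : ∀ k, (i : ℕ) < k → Solved (reveal A loc
          (R ∪ ((List.ofFn fun i => (σ i : V)).take k).toFinset)) C := by
        intro k hk
        refine hQ.reveal_mono t.admissible (Finset.singleton_subset_iff.2
          (Finset.mem_union_right _ (List.mem_toFinset.2 ?_)))
        rw [List.mem_take_iff_getElem]
        refine ⟨i, by simp [hk], ?_⟩
        simp [hi]
      have hji : j ≤ i + 1 := by
        by_contra hlt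
        exact h5 (i + 1) (by omega) (hq _ (by omega))
      have hs : Solved (reveal A loc (R ∪ ((List.ofFn fun i => (σ i : V)).take j).toFinset)) C := by
        rcases h4 with h4 | h4
        · exact h4
        · refine hq j ?_
          rw [h4, List.length_ofFn]
          exact i.isLt
      simp only [hK', if_pos hs, wp_done]
      refine (hK _ Finset.subset_union_left (Finset.union_subset hRU fun v hv => hSU ?_) hs).trans
        (ENNReal.ofReal_le_ofReal ?_)
      · exact (hlist σ v).1 (List.mem_of_mem_take (List.mem_toFinset.1 hv))
      · have h6 := Finset.card_union_le R ((List.ofFn fun i => (σ i : V)).take j).toFinset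
        have h7 := List.toFinset_card_le ((List.ofFn fun i => (σ i : V)).take j)
        rw [List.length_take] at h7
        have h8 : (R ∪ ((List.ofFn fun i => (σ i : V)).take j).toFinset).card ≤
            R.card + (i + 1) := by omega
        have h9 : ((R ∪ ((List.ofFn fun i => (σ i : V)).take j).toFinset).card : ℝ) ≤
            R.card + ((i + 1 : ℕ) : ℝ) := by exact_mod_cast h8
        linarith
    · intro _ _
      positivity
    · have h6 := sum_symm_val (n := S.card) (⟨q, hqS⟩ : {v // v ∈ S})
      have h7 : ∑ σ : Fin S.card ≃ {v // v ∈ S},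
          (2 * (((σ.symm ⟨q, hqS⟩ : Fin S.card) : ℕ) : ℝ) + 1) =
          Fintype.card (Fin S.card ≃ {v // v ∈ S}) * S.card := by exact_mod_cast h6
      rw [Finset.sum_add_distrib, ← Finset.mul_sum, Finset.sum_const, nsmul_eq_mul,
        Finset.card_univ] at h7
      push_cast
      simp only [Finset.sum_add_distrib, Finset.sum_const, Finset.card_univ, nsmul_eq_mul]
      have h8 : (S.card : ℝ) ≤ 4 := by exact_mod_cast hS4
      have h9 : (0 : ℝ) ≤ Fintype.card (Fin S.card ≃ {v // v ∈ S}) := by positivity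
      have h10 := mul_le_mul_of_nonneg_left h8 h9
      simp only [Finset.card_singleton, Nat.cast_one]
      linarith
  · have hQ2 : (2 : ℝ) ≤ Q.card := by
      have : 2 ≤ Q.card := by omega
      exact_mod_cast this
    refine wp_uniform_le (g := fun σ => d + R.card + 5) huniv ?_ ?_ ?_
    · intro σ _
      obtain ⟨j, hj, h3, h4, h5⟩ := exists_wp_queryUntil (A := A) (loc := loc) (C := C)
        (K := K') (List.ofFn fun i => (σ i : V)) R
      rw [hRA] at h3
      rw [h3]
      refine hfin _ (fun v hv => ?_) (h4.imp_right fun h4 => ?_)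
      · exact (hlist σ v).1 (List.mem_of_mem_take (List.mem_toFinset.1 hv))
      · rw [h4, List.take_length]
        ext v
        rw [List.mem_toFinset]
        exact hlist σ v
    · intro _ _
      positivity
    · rw [Finset.sum_const, nsmul_eq_mul]
      gcongr
      linarith

end IsTop

end Subroutines

/-! ### The subroutines Rand2 and Rand3 and the treatment of one cycle. -/

section Step

variable {V : Type} [Fintype V] [DecidableEq V] [Nonempty V] {tb : TieBreak V}
  {A : Areas V} {loc : V → Plane}
  {Q R S U : Finset V} {C : Finset (Sym2 V)} {e f g : Sym2 V}
  {K : Areas V → Finset V → ℝ≥0∞} {d : ℝ}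

theorem wp_rand3_of_solved (hs : Solved A C) : wp loc (rand3 tb C A) K R = K A R := by
  rw [rand3_eq, wp_bind, detRounds, if_pos hs, wp_done, coinRound, if_pos hs, wp_done]

namespace IsTop

variable (t : IsTop A loc C f)

include t

/-- If the only vertex of `Q` were an end of `f`, the query of `f` would have solved the cycle. -/
theorem one_lt_card (hQ : Solved (reveal A loc Q) C) (hR : ends A f ⊆ R)
    (hs : ¬ Solved (reveal A loc R) C) (hfQ : ¬ Disjoint (ends A f) Q) : 2 ≤ Q.card := by
  by_contra hlt
  obtain ⟨x, hxf, hxQ⟩ := Finset.not_disjoint_iff.1 hfQ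
  refine hs (hQ.reveal_mono t.admissible fun y hy => ?_)
  rw [Finset.card_le_one.1 (by omega) y hy x hxQ]
  exact hR hxf

theorem card_sdiff_lt (hR : ends A f ⊆ R) (hfQ : ¬ Disjoint (ends A f) Q) :
    (Q \ R).card + 1 ≤ Q.card := by
  obtain ⟨x, hxf, hxQ⟩ := Finset.not_disjoint_iff.1 hfQ
  exact Finset.card_lt_card ((Finset.ssubset_iff_of_subset Finset.sdiff_subset).2
    ⟨x, hxQ, by simp [hR hxf]⟩)

/-- A missed edge must contain a vertex of `Q` that is already queried. If it differs from the
vertex of `Q` in `f`, all of `Q` is known and the cycle is solved. If it is the same, the missed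
edge joins it to a vertex of `W`, so both ends are known, and such an edge is never chosen. -/
theorem missBound_zero_of_card_eq_two (hQ : Solved (reveal A loc Q) C)
    (hfQ : ¬ Disjoint (ends A f) Q) (hQ2 : Q.card = 2) {W : Finset V}
    (hW : IsCover A (neighbors A C f) f W) (hR : ends A f ⊆ R) (hWR : W ⊆ R) :
    MissBound A loc C Q R 0 := by
  intro S hS hs e he hd
  exfalso
  have hSf := hR.trans hS
  obtain ⟨y, hye, hyQ⟩ := Finset.not_disjoint_iff.1 (t.not_disjoint_ends hQ hs he hd hfQ)
  obtain ⟨x, hxf, hxQ⟩ := Finset.not_disjoint_iff.1 hfQ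
  have hyS : y ∈ S := by
    by_contra hyS
    refine Finset.disjoint_left.1 hd ?_ hyQ
    rw [ends_reveal]
    exact Finset.mem_sdiff.2 ⟨hye, hyS⟩
  have hxy : x = y := by
    by_contra hxy
    have hsub : ({x, y} : Finset V) ⊆ Q := by
      intro z hz
      rcases Finset.mem_insert.1 hz with rfl | hz
      · exact hxQ
      · rwa [Finset.mem_singleton.1 hz]
    have hQe : Q = {x, y} :=
      (Finset.eq_of_subset_of_card_le hsub (by rw [hQ2, Finset.card_pair hxy])).symm
    refine hs (hQ.reveal_mono t.admissible ?_)
    rw [hQe]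
    exact Finset.insert_subset (hSf hxf) (Finset.singleton_subset_iff.2 hyS)
  subst hxy
  obtain ⟨w, hw, hwe⟩ := hW.2 e (t.mem_neighbors_of_mem_maxUpperEdges hSf hs he)
  have hxw : x ≠ w := fun h => (hW.1 w hw).2 (h ▸ (mem_ends.1 hxf).1)
  obtain ⟨z, hz⟩ := ends_nonempty_of_mem_maxUpperEdges (t.admissible.reveal S) hs he
  rw [ends_reveal, Finset.mem_sdiff, mem_ends,
    (Sym2.mem_and_mem_iff hxw).1 ⟨(mem_ends.1 hye).1, hwe⟩, Sym2.mem_iff] at hz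
  rcases hz.1.1 with rfl | rfl
  · exact hz.2 (hSf hxf)
  · exact hz.2 (hS (hWR hw))

/-- Querying `f` and a cover costs at most four. If `Q` is a smallest cover of size two avoiding
`f`, a random cover misses on average at most one of its vertices. If `|Q| = 2` and `Q` meets `f`,
at most one vertex remains and no miss occurs. If `|Q| ≥ 3`, at most `|Q|` further queries are
needed and `4 + |Q| ≤ 5/2 * |Q|`. -/
theorem wp_rand2_le (hQ : Solved (reveal A loc Q) C) (hQn : ∀ v ∈ Q, (A v).Nontrivial)
    (hU : ∀ e ∈ C, ends A e ⊆ U) (hRU : R ⊆ U) (hd : 0 ≤ d)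
    (ha : coverNumber A (neighbors A C f) f = 2)
    (hg : g ∈ maxUpperEdges (reveal A loc (R ∪ ends A f)) C)
    (hK : ∀ S, R ⊆ S → S ⊆ U → Solved (reveal A loc S) C →
      K (reveal A loc S) S ≤ ENNReal.ofReal (d + S.card)) :
    wp loc (rand2 tb C (smallestCovers A (neighbors A C f) f) g
      (reveal A loc (R ∪ ends A f))) K (R ∪ ends A f) ≤
      ENNReal.ofReal (d + R.card + 5 / 2 * Q.card) := by
  have h := t.admissible
  have hQpos := (t.query_nonempty hQ).card_pos
  have hR₁U : R ∪ ends A f ⊆ U := Finset.union_subset hRU (hU f t.mem_maxUpper.1)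
  have hR₁c : (R ∪ ends A f).card ≤ R.card + 2 :=
    (Finset.card_union_le _ _).trans (by gcongr; exact card_ends_le_two)
  have hfR₁ : ends A f ⊆ R ∪ ends A f := Finset.subset_union_right
  have hRR₁ : R ⊆ R ∪ ends A f := Finset.subset_union_left
  generalize R ∪ ends A f = R₁ at *
  rw [rand2]
  split_ifs with hs
  · rw [wp_done]
    refine (hK R₁ hRR₁ hR₁U hs).trans (ENNReal.ofReal_le_ofReal ?_)
    have h1 : (R₁.card : ℝ) ≤ R.card + 2 := by exact_mod_cast hR₁c
    have h2 : (1 : ℝ) ≤ Q.card := by exact_mod_cast hQpos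
    linarith
  have hgX := t.mem_neighbors_of_mem_maxUpperEdges hfR₁ hs hg
  have hne : (smallestCovers A (neighbors A C f) f).Nonempty := by
    obtain ⟨W, hW⟩ := exists_isCover_of_coverNumber_ne_top (A := A) (X := neighbors A C f)
      (f := f) (by rw [ha]; exact ENat.ofNat_ne_top 2)
    exact ⟨W, mem_smallestCovers.2 hW⟩
  have key : ∀ W ∈ smallestCovers A (neighbors A C f) f, ∀ b,
      MissBound A loc C Q (R₁ ∪ W) b →
      wp loc (queryUntil C (reveal A loc R₁)
        (tb.pick (reveal A loc R₁) {v | v ∈ W ∧ v ∈ g} ::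
          (W.erase (tb.pick (reveal A loc R₁) {v | v ∈ W ∧ v ∈ g})).toList)) (fun a P =>
            wp loc (detLoop tb C a) K P) R₁ ≤
        ENNReal.ofReal (d + (R.card + 4 + (Q \ (R₁ ∪ W)).card + b : ℕ)) := by
    intro W hW b hm
    obtain ⟨hWc, hWn⟩ := mem_smallestCovers.1 hW
    rw [ha] at hWn
    have hW2 : W.card = 2 := by exact_mod_cast hWn
    obtain ⟨v, hv, hvg⟩ := hWc.2 g hgX
    have hv' : tb.pick (reveal A loc R₁) {v | v ∈ W ∧ v ∈ g} ∈ W :=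
      (tb.pick_mem (reveal A loc R₁) {v | v ∈ W ∧ v ∈ g} ⟨v, hv, hvg⟩).1
    generalize tb.pick (reveal A loc R₁) {v | v ∈ W ∧ v ∈ g} = u at hv'
    have hl : (u :: (W.erase u).toList).toFinset = W := by
      rw [List.toFinset_cons, Finset.toList_toFinset, Finset.insert_erase hv']
    have hWU : W ⊆ U := by
      intro x hx
      by_contra hxU
      have hX : IsCover A (neighbors A C f) f (W.erase x) := by
        refine ⟨fun v hv => hWc.1 v (Finset.mem_of_mem_erase hv), fun e he => ?_⟩
        obtain ⟨v, hv, hve⟩ := hWc.2 e he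
        refine ⟨v, Finset.mem_erase.2 ⟨?_, hv⟩, hve⟩
        rintro rfl
        exact hxU (hU e (mem_neighbors.1 he).1 (mem_ends.2 ⟨hve, (hWc.1 v hv).1⟩))
      have h1 := coverNumber_le hX
      rw [ha, Finset.card_erase_of_mem hx, hW2] at h1
      exact absurd h1 (by decide)
    have hcard : (R₁ ∪ W).card ≤ R.card + 4 := (Finset.card_union_le _ _).trans (by omega)
    rw [← wp_bind]
    refine wp_queryUntil_detLoop_le (d := d) (by rwa [hl]) hR₁U
      (fun S hS => hK S (hRR₁.trans hS)) ?_ ?_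
    · rw [hl]
      gcongr
      omega
    · rw [hl]
      intro _
      -- Every edge chosen from now on lies in `X` and so has one end in the queried cover; a round
      -- costs one query instead of two.
      have hκ : EndsBound A loc C (R₁ ∪ W) 1 := by
        intro S hS hsS e he
        obtain ⟨w, hw, hwe⟩ := hWc.2 e (t.mem_neighbors_of_mem_maxUpperEdges
          (hfR₁.trans (Finset.subset_union_left.trans hS)) hsS he)
        exact card_ends_reveal_le_one hwe (hS (Finset.mem_union_right _ hw))
      refine (wp_detLoop_le h t.isCycleSet hQ hU (Finset.union_subset hR₁U hWU) hm hκ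
        fun S hS => hK S (hRR₁.trans (Finset.subset_union_left.trans hS))).trans
        (ENNReal.ofReal_le_ofReal ?_)
      rw [one_mul]
      gcongr
  dsimp only
  rw [wp_bind]
  have const : ∀ m : ℕ, (∀ W ∈ smallestCovers A (neighbors A C f) f, ∃ b,
      MissBound A loc C Q (R₁ ∪ W) b ∧ (Q \ (R₁ ∪ W)).card + b ≤ m) →
      (4 + m : ℝ) ≤ 5 / 2 * Q.card →
      wp loc (uniform (smallestCovers A (neighbors A C f) f) (fun W =>
        queryUntil C (reveal A loc R₁) (tb.pick (reveal A loc R₁) {v | v ∈ W ∧ v ∈ g} ::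
          (W.erase (tb.pick (reveal A loc R₁) {v | v ∈ W ∧ v ∈ g})).toList))
        (done (reveal A loc R₁))) (fun a P => wp loc (detLoop tb C a) K P) R₁ ≤
        ENNReal.ofReal (d + R.card + 5 / 2 * Q.card) := by
    intro m hm hle
    refine wp_uniform_le (g := fun _ => d + R.card + 5 / 2 * Q.card) hne ?_ ?_ ?_
    · intro W hW
      obtain ⟨b, hb, hbm⟩ := hm W hW
      refine (key W hW b hb).trans (ENNReal.ofReal_le_ofReal ?_)
      have : ((R.card + 4 + (Q \ (R₁ ∪ W)).card + b : ℕ) : ℝ) ≤ R.card + 4 + m := by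
        exact_mod_cast (by omega : R.card + 4 + (Q \ (R₁ ∪ W)).card + b ≤ R.card + 4 + m)
      linarith
    · intro _ _
      positivity
    · rw [Finset.sum_const, nsmul_eq_mul]
  by_cases hfQ : Disjoint (ends A f) Q
  · have hcov := t.isCover_of_disjoint hQ hQn hfQ
    have hm : ∀ W, MissBound A loc C Q (R₁ ∪ W) 0 := fun W =>
      t.missBound_zero_of_disjoint hQ hfQ (hfR₁.trans Finset.subset_union_left)
    have hQ2 : 2 ≤ Q.card := by
      have := coverNumber_le hcov
      rw [ha] at this
      exact_mod_cast this
    by_cases hQ3 : Q.card = 2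
    · have hQS : Q ∈ smallestCovers A (neighbors A C f) f := by
        rw [mem_smallestCovers, ha, hQ3]
        exact ⟨hcov, rfl⟩
      refine wp_uniform_le (g := fun W => d + R.card + 4 + ((Q \ W).card : ℝ)) hne ?_ ?_ ?_
      · intro W hW
        refine (key W hW 0 (hm W)).trans (ENNReal.ofReal_le_ofReal ?_)
        have h1 := Finset.card_le_card
          (Finset.sdiff_subset_sdiff (subset_refl Q) (Finset.subset_union_right (s₁ := R₁) (s₂ := W)))
        have h2 : ((Q \ (R₁ ∪ W)).card : ℝ) ≤ (Q \ W).card := by exact_mod_cast h1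
        push_cast
        linarith
      · intro _ _
        positivity
      · have h1 := sum_card_sdiff_smallestCovers_le ha hQS
        have h2 : ∑ W ∈ smallestCovers A (neighbors A C f) f, ((Q \ W).card : ℝ) ≤
            (smallestCovers A (neighbors A C f) f).card := by exact_mod_cast h1
        rw [Finset.sum_add_distrib, Finset.sum_const, nsmul_eq_mul, hQ3]
        push_cast
        linarith
    · refine const Q.card (fun W _ => ⟨0, hm W, ?_⟩) ?_
      · exact Finset.card_le_card Finset.sdiff_subset
      · have : (3 : ℝ) ≤ Q.card := by
          exact_mod_cast (by omega : 3 ≤ Q.card)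
        linarith
  · have hQ2 := t.one_lt_card hQ hfR₁ hs hfQ
    have hsd : ∀ W, (Q \ (R₁ ∪ W)).card + 1 ≤ Q.card := fun W =>
      t.card_sdiff_lt (hfR₁.trans Finset.subset_union_left) hfQ
    by_cases hQ3 : Q.card = 2
    · refine const 1 (fun W hW => ⟨0, ?_, ?_⟩) ?_
      · exact t.missBound_zero_of_card_eq_two hQ hfQ hQ3 (mem_smallestCovers.1 hW).1
          (hfR₁.trans Finset.subset_union_left) Finset.subset_union_right
      · have := hsd W
        omega
      · rw [hQ3]
        norm_num
    · refine const Q.card (fun W _ => ⟨1, ?_, hsd W⟩) ?_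
      · exact t.missBound_one hQ (hfR₁.trans Finset.subset_union_left)
      · have : (3 : ℝ) ≤ Q.card := by
          exact_mod_cast (by omega : 3 ≤ Q.card)
        linarith

/-- If `Q` avoids `f`, then `|Q| ≥ 3`: either `a ≥ 3`, or `f` is not longer than `g`, contradicting
that `f` becomes always maximal. The cost is `2 + 11/2 = 15/2` for `|Q| = 3` and at most `2 + 2|Q|`
for `|Q| ≥ 4`. If `Q` meets `f`, then `|Q| ≥ 2` and the cost is at most `2 + 2(|Q| - 1) + 1`. -/
theorem wp_rand3_le (hQ : Solved (reveal A loc Q) C) (hQn : ∀ v ∈ Q, (A v).Nontrivial)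
    (hU : ∀ e ∈ C, ends A e ⊆ U) (hRU : R ⊆ U) (hd : 0 ≤ d)
    (hg : g ∈ maxUpperEdges (reveal A loc (R ∪ ends A f)) C)
    (ha : 3 ≤ coverNumber A (neighbors A C f) f ∨
      lower (reveal A loc (R ∪ ends A f)) f ≤ lower (reveal A loc (R ∪ ends A f)) g)
    (hK : ∀ S, R ⊆ S → S ⊆ U → Solved (reveal A loc S) C →
      K (reveal A loc S) S ≤ ENNReal.ofReal (d + S.card)) :
    wp loc (rand3 tb C (reveal A loc (R ∪ ends A f))) K (R ∪ ends A f) ≤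
      ENNReal.ofReal (d + R.card + 5 / 2 * Q.card) := by
  have h := t.admissible
  have hQpos := (t.query_nonempty hQ).card_pos
  have hR₁U : R ∪ ends A f ⊆ U := Finset.union_subset hRU (hU f t.mem_maxUpper.1)
  have hR₁c : (R ∪ ends A f).card ≤ R.card + 2 :=
    (Finset.card_union_le _ _).trans (by gcongr; exact card_ends_le_two)
  have hfR₁ : ends A f ⊆ R ∪ ends A f := Finset.subset_union_right
  have hRR₁ : R ⊆ R ∪ ends A f := Finset.subset_union_left
  generalize R ∪ ends A f = R₁ at *
  have h1 : (R₁.card : ℝ) ≤ R.card + 2 := by exact_mod_cast hR₁c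
  by_cases hs : Solved (reveal A loc R₁) C
  · rw [wp_rand3_of_solved hs]
    refine (hK R₁ hRR₁ hR₁U hs).trans (ENNReal.ofReal_le_ofReal ?_)
    have h2 : (1 : ℝ) ≤ Q.card := by exact_mod_cast hQpos
    linarith
  have hK' : ∀ S, R₁ ⊆ S → S ⊆ U → Solved (reveal A loc S) C →
      K (reveal A loc S) S ≤ ENNReal.ofReal (d + S.card) := fun S hS => hK S (hRR₁.trans hS)
  by_cases hfQ : Disjoint (ends A f) Q
  · have hcov := t.isCover_of_disjoint hQ hQn hfQ
    have hQ3 : 3 ≤ Q.card := by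
      rcases ha with ha | ha
      · exact_mod_cast ha.trans (coverNumber_le hcov)
      · exfalso
        rw [t.lower_reveal_eq hfR₁] at ha
        have h2 := t.trueLength_lt_of_disjoint hQ hfQ hg.1 (t.ne_of_mem_maxUpperEdges hfR₁ hs hg)
        have h3 := ha.trans (lower_le_trueLength (h.reveal R₁) g)
        exact (EReal.coe_le_coe_iff.1 h3).not_gt h2
    have hm := t.missBound_zero_of_disjoint hQ hfQ hfR₁
    have hQR : (Q \ R₁).card ≤ Q.card := Finset.card_le_card Finset.sdiff_subset
    by_cases hQ4 : Q.card = 3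
    · refine (wp_rand3_le_of_card_eq_three h hQ hU hR₁U hd hm (by omega) hK').trans
        (ENNReal.ofReal_le_ofReal ?_)
      rw [hQ4]
      push_cast
      linarith
    · refine (VMST.wp_rand3_le h t.isCycleSet hQ hU hR₁U hd hm hK').trans
        (ENNReal.ofReal_le_ofReal ?_)
      have h2 : ((Q \ R₁).card : ℝ) ≤ Q.card := by exact_mod_cast hQR
      have h3 : (4 : ℝ) ≤ Q.card := by
        exact_mod_cast (by omega : 4 ≤ Q.card)
      push_cast
      linarith
  · have hQ2 := t.one_lt_card hQ hfR₁ hs hfQ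
    have hsd := t.card_sdiff_lt hfR₁ hfQ
    refine (VMST.wp_rand3_le h t.isCycleSet hQ hU hR₁U hd (t.missBound_one hQ hfR₁) hK').trans
        (ENNReal.ofReal_le_ofReal ?_)
    have h2 : ((Q \ R₁).card : ℝ) + 1 ≤ Q.card := by exact_mod_cast hsd
    have h3 : (2 : ℝ) ≤ Q.card := by exact_mod_cast hQ2
    push_cast
    linarith

end IsTop

/-- The treatment of one cycle is `5/2`-competitive. -/
theorem wp_cycleStep_le {T : Finset (Sym2 V)} (h : Admissible A loc)
    (hC : IsCycleSet (cycleEdges T f)) (hf : f ∈ maxUpperEdges A (cycleEdges T f))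
    (hlow : ∀ e ∈ cycleEdges T f, lower A e ≤ lower A f)
    (hQ : Solved (reveal A loc Q) (cycleEdges T f)) (hQn : ∀ v ∈ Q, (A v).Nontrivial)
    (hU : ∀ e ∈ cycleEdges T f, ends A e ⊆ U) (hRU : R ⊆ U) (hRA : reveal A loc R = A)
    (hd : 0 ≤ d)
    (hK : ∀ S, R ⊆ S → S ⊆ U → Solved (reveal A loc S) (cycleEdges T f) →
      K (reveal A loc S) S ≤ ENNReal.ofReal (d + S.card)) :
    wp loc (cycleStep tb T A f) K R ≤ ENNReal.ofReal (d + R.card + 5 / 2 * Q.card) := by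
  rw [cycleStep]
  dsimp only
  split_ifs with hs ha
  · have h1 := hK R subset_rfl hRU (by rwa [hRA])
    rw [hRA] at h1
    rw [wp_done]
    refine h1.trans (ENNReal.ofReal_le_ofReal ?_)
    have : (0 : ℝ) ≤ Q.card := by positivity
    linarith
  · have t : IsTop A loc (cycleEdges T f) f := ⟨h, hC, hs, hf, hlow⟩
    exact t.wp_rand1_le hQ hQn hU hRU hRA hd ha hK
  · have t : IsTop A loc (cycleEdges T f) f := ⟨h, hC, hs, hf, hlow⟩
    rw [wp_bind]
    have h1 := wp_querySet (A := A) (loc := loc) (R := R) (S := ends A f)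
      (K := fun a P => wp loc (if 3 ≤ coverNumber A (neighbors A (cycleEdges T f) f) f ∨
        lower a f ≤ lower a (tb.pick a (maxUpperEdges a (cycleEdges T f))) then
        rand3 tb (cycleEdges T f) a else
        rand2 tb (cycleEdges T f) (smallestCovers A (neighbors A (cycleEdges T f) f) f)
          (tb.pick a (maxUpperEdges a (cycleEdges T f))) a) K P)
    rw [hRA] at h1
    refine (le_of_eq h1).trans ?_
    have hg := pick_maxUpperEdges_mem (tb := tb) (A := reveal A loc (R ∪ ends A f))
      ⟨f, t.mem_maxUpper.1⟩
    split_ifs with hc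
    · exact t.wp_rand3_le hQ hQn hU hRU hd hg hc hK
    · refine t.wp_rand2_le hQ hQn hU hRU hd ?_ hg hK
      have h0 := t.coverNumber_ne_zero
      push Not at hc
      have h3 := hc.1
      generalize coverNumber A (neighbors A (cycleEdges T f) f) f = a at *
      lift a to ℕ using h3.ne_top
      norm_cast at *
      omega

end Step

/-! ### Feasibility and conflict edges in cactus-like instances. -/

section Cactus

variable {V : Type} [Fintype V] [DecidableEq V] {I : Input V} {loc : V → Plane}
  {T T' : Finset (Sym2 V)} {e f f' : Sym2 V} {Q R S : Finset V} {x : V}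

theorem Input.CactusLike.cycleEdges_eq (hI : I.CactusLike) (hT : IsSpanningTree I.graph T)
    (hf : f ∈ I.graph.edgeSet) (hfT : f ∉ T) (hT' : IsSpanningTree I.graph T')
    (hf' : f' ∈ I.graph.edgeSet) (hfT' : f' ∉ T') {e' : Sym2 V} (he : e ∈ cycleEdges T f)
    (he' : e' ∈ cycleEdges T' f') (hx : x ∈ e) (hx' : x ∈ e') (hn : (I.area x).Nontrivial) :
    cycleEdges T f = cycleEdges T' f' := by
  obtain ⟨u, p, hp, hpC⟩ := exists_cycle_eq_cycleEdges hT hf hfT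
  obtain ⟨v, q, hq, hqC⟩ := exists_cycle_eq_cycleEdges hT' hf' hfT'
  have key : ∀ {a : V} {r : I.graph.Walk a a} {e : Sym2 V}, e ∈ r.edges → x ∈ e →
      x ∈ r.support := by
    intro a r e he hx
    obtain ⟨y, rfl⟩ := Sym2.mem_iff_exists.1 hx
    exact r.fst_mem_support_of_mem_edges he
  ext k
  rw [hpC, hqC]
  exact hI u v p q hp hq ⟨x, key ((hpC e).1 he) hx, key ((hqC e').1 he') hx', hn⟩ k

/-- A cycle with a non-trivial vertex is a fundamental cycle of every spanning tree. -/
theorem Input.CactusLike.exists_cycleEdges_eq (hI : I.CactusLike)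
    (hT : IsSpanningTree I.graph T) (hf : f ∈ I.graph.edgeSet) (hfT : f ∉ T)
    (hT' : IsSpanningTree I.graph T') (he : e ∈ cycleEdges T f) (hx : x ∈ e)
    (hn : (I.area x).Nontrivial) :
    ∃ f' ∈ I.graph.edgeSet, f' ∉ T' ∧ cycleEdges T' f' = cycleEdges T f := by
  have heG := cycleEdges_subset_edgeSet hT hf he
  -- If `e` is in `T'`, comparing `T'` with a tree without `e` yields a non-tree edge of `T'` whose
  -- cycle passes through `e`; otherwise `e` closes the cycle itself. Either cycle contains `x`, so
  -- it is the given one.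
  by_cases heT' : e ∈ T'
  · have hT'' := hT.exchange hf hfT he
    obtain ⟨f', hf', hfT', hef, -⟩ := exists_symm_exchange hT' hT'' heT' (by simp)
    exact ⟨f', hT''.1 hf', hfT', hI.cycleEdges_eq hT' (hT''.1 hf') hfT' hT hf hfT hef he hx hx hn⟩
  · exact ⟨e, heG, heT', hI.cycleEdges_eq hT' heG heT' hT hf hfT
      (self_mem_cycleEdges hT' heG heT') he hx hx hn⟩

/-- Edge weights may be chosen independently of each other: if an edge could be longer than `f`,
giving both suitable weights and all others their true lengths would violate minimality of the tree.
-/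
theorem Input.Feasible.exists_alwaysMaximal (h : Admissible I.area loc) (hQ : I.Feasible loc Q) :
    ∃ T, IsSpanningTree I.graph T ∧ ∀ f ∈ I.graph.edgeSet, f ∉ T →
      AlwaysMaximal (reveal I.area loc Q) (cycleEdges T f) f := by
  obtain ⟨T, hT⟩ := hQ
  have hT₀ := (hT (trueLength loc) fun e _ => trueLength_mem (h.reveal Q) e).1
  refine ⟨T, hT₀, fun f hf hfT => ⟨self_mem_cycleEdges hT₀ hf hfT, fun e he hef => ?_⟩⟩
  by_contra hlt
  rw [not_le] at hlt
  obtain ⟨a, ha⟩ := lt_iSup_iff.1 hlt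
  obtain ⟨haA, ha⟩ := lt_iSup_iff.1 ha
  obtain ⟨b, hb⟩ := iInf_lt_iff.1 ha
  obtain ⟨hbA, hb⟩ := iInf_lt_iff.1 hb
  have hw : ∀ k ∈ I.graph.edgeSet,
      (Function.update (Function.update (trueLength loc) e a) f b) k ∈
        edgeArea (reveal I.area loc Q) k := by
    intro k _
    by_cases hkf : k = f
    · rw [hkf, Function.update_self]
      exact hbA
    · rw [Function.update_of_ne hkf]
      by_cases hke : k = e
      · rw [hke, Function.update_self]
        exact haA
      · rw [Function.update_of_ne hke]
        exact trueLength_mem (h.reveal Q) k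
  have hle := (hT _ hw).le_of_mem_cycleEdges hf hfT he
  rw [Function.update_self, Function.update_of_ne hef, Function.update_self] at hle
  exact (EReal.coe_lt_coe_iff.1 hb).not_ge hle

/-- The tree certifying feasibility need not be `T`, but a cycle with a non-trivial vertex is
fundamental for both. -/
theorem Input.Feasible.solved (hI : I.CactusLike) (h : Admissible I.area loc)
    (hQ : I.Feasible loc Q) (hT : IsSpanningTree I.graph T) (hf : f ∈ I.graph.edgeSet)
    (hfT : f ∉ T) (he : e ∈ cycleEdges T f) (hx : x ∈ e) (hn : (I.area x).Nontrivial) :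
    Solved (reveal I.area loc Q) (cycleEdges T f) := by
  obtain ⟨T', hT', hmax⟩ := hQ.exists_alwaysMaximal h
  obtain ⟨f', hf', hfT', heq⟩ := hI.exists_cycleEdges_eq hT hf hfT hT' he hx hn
  exact heq ▸ ⟨f', hmax f' hf' hfT'⟩

theorem nontrivial_of_reveal (h : (reveal I.area loc R x).Nontrivial) : (I.area x).Nontrivial := by
  unfold reveal at h
  split_ifs at h
  · exact absurd h Set.not_nontrivial_singleton
  · exact h

/-- A conflict edge lies on an unsolved cycle, where it has the largest, but another edge has a
larger lower limit. -/
theorem exists_cycle_of_mem_conflictEdges (hI : I.CactusLike) (h : Admissible I.area loc)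
    (he : e ∈ conflictEdges I.graph (reveal I.area loc R)) :
    ∃ T f, IsSpanningTree I.graph T ∧ f ∈ I.graph.edgeSet ∧ f ∉ T ∧
      ¬ Solved (reveal I.area loc R) (cycleEdges T f) ∧
      e ∈ maxUpperEdges (reveal I.area loc R) (cycleEdges T f) ∧
      (ends (reveal I.area loc R) e).Nonempty ∧
      lower (reveal I.area loc R) e < lower (reveal I.area loc R) f := by
  have hR := h.reveal R
  obtain ⟨S, T, hS, hT, hmin, heST⟩ := he
  obtain ⟨f, hfT, hfS, hef, hfe, hlow, hupp⟩ := exists_conflict_partner (lower_ne_bot _)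
    (upper_ne_bot hR) hS hT hmin heST
  obtain ⟨hS', hSl⟩ := (isLimitTree_iff (lower_ne_bot _)).1 hS
  obtain ⟨hT', hTu⟩ := (isLimitTree_iff (upper_ne_bot hR)).1 hT
  obtain ⟨heS, heT⟩ := Finset.mem_sdiff.1 heST
  have hne : (ends (reveal I.area loc R) e).Nonempty := by
    by_contra hne
    rw [Finset.not_nonempty_iff_eq_empty] at hne
    have h1 := lower_eq_trueLength hR hne
    have h2 := upper_eq_trueLength hR hne
    rw [h1] at hlow
    rw [h2] at hupp
    exact (hlow.trans_le (lower_le_upper hR f)).not_gt hupp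
  obtain ⟨x, hx⟩ := hne
  have hC : cycleEdges S f = cycleEdges T e :=
    hI.cycleEdges_eq hS' (hT'.1 hfT) hfS hT' (hS'.1 heS) heT hef
      (self_mem_cycleEdges hT' (hS'.1 heS) heT) (mem_ends.1 hx).1 (mem_ends.1 hx).1
      (nontrivial_of_reveal (mem_ends.1 hx).2)
  refine ⟨S, f, hS', hT'.1 hfT, hfS, ?_, ⟨hef, ?_⟩, ⟨x, hx⟩, hlow⟩
  · rintro ⟨g, hg⟩
    by_cases hge : g = e
    · subst hge
      have h1 := hg.2 f (self_mem_cycleEdges hS' (hT'.1 hfT) hfS) (fun h => hfS (h ▸ heS))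
      exact absurd hlow ((lower_le_upper hR f).trans h1).not_gt
    · have h1 := hg.2 e hef (Ne.symm hge)
      have h2 := hSl f (hT'.1 hfT) hfS g hg.1
      exact absurd hupp ((h1.trans h2).trans (lower_le_upper hR f)).not_gt
  · intro k hk
    rw [hC] at hk
    exact hTu e (hS'.1 heS) heT k hk

/-- Every feasible query set contains an unqueried end vertex of a conflict edge. -/
theorem not_disjoint_conflictEdge (hI : I.CactusLike) (h : Admissible I.area loc)
    (hQ : I.Feasible loc Q) (he : e ∈ conflictEdges I.graph (reveal I.area loc R)) :
    ¬ Disjoint (ends (reveal I.area loc R) e) Q := by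
  intro hd
  have hR := h.reveal R
  obtain ⟨T, f, hT, hf, hfT, hs, hmax, ⟨x, hx⟩, hlt⟩ := exists_cycle_of_mem_conflictEdges hI h he
  have hsQ := hQ.solved hI h hT hf hfT hmax.1 (mem_ends.1 hx).1
    (nontrivial_of_reveal (mem_ends.1 hx).2)
  have hsQ' : Solved (reveal (reveal I.area loc R) loc Q) (cycleEdges T f) := by
    rw [reveal_reveal]
    exact hsQ.reveal_mono h Finset.subset_union_right
  obtain ⟨h1, -, -⟩ := alwaysMaximal_of_disjoint hR (isCycleSet_cycleEdges hT hf hfT) hs hmax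
    hsQ' hd
  have h2 := h1.2 f (self_mem_cycleEdges hT hf hfT) (fun hfe => by
    subst hfe
    exact lt_irrefl _ hlt)
  rw [lower_reveal_of_disjoint hR hd] at h2
  have h3 := lower_le_lower_reveal hR Q f
  have h4 := lower_le_upper (hR.reveal Q) f
  exact absurd hlt ((h3.trans h4).trans h2).not_gt

/-- For a pair of limit trees at minimum distance, an empty difference would make the trees equal,
as they have the same number of edges. -/
theorem conflictEdges_nonempty (h : Admissible I.area loc)
    (hc : ¬ (commonTrees I.graph (reveal I.area loc R)).Nonempty) :
    (conflictEdges I.graph (reveal I.area loc R)).Nonempty := by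
  classical
  have hR := h.reveal R
  obtain ⟨S₀, hS₀⟩ := exists_isLimitTree I.connected (lower_ne_bot (reveal I.area loc R))
  obtain ⟨T₀, hT₀⟩ := exists_isLimitTree I.connected (upper_ne_bot hR)
  have hex : ∃ n, ∃ S T, IsLimitTree I.graph (lower (reveal I.area loc R)) S ∧
      IsLimitTree I.graph (upper (reveal I.area loc R)) T ∧ (S \ T).card = n :=
    ⟨_, S₀, T₀, hS₀, hT₀, rfl⟩
  obtain ⟨S, T, hS, hT, hn⟩ := Nat.find_spec hex
  have hmin : ∀ S' T', IsLimitTree I.graph (lower (reveal I.area loc R)) S' →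
      IsLimitTree I.graph (upper (reveal I.area loc R)) T' →
      (S \ T).card ≤ (S' \ T').card := by
    intro S' T' hS' hT'
    rw [hn]
    exact Nat.find_min' hex ⟨S', T', hS', hT', rfl⟩
  have hne : (S \ T).Nonempty := by
    rw [Finset.sdiff_nonempty]
    intro hsub
    have := I.connected.nonempty
    have h1 := (isSpanningTree_iff_card.1 ((isLimitTree_iff (lower_ne_bot _)).1 hS).1).2.2
    have h2 := (isSpanningTree_iff_card.1 ((isLimitTree_iff (upper_ne_bot hR)).1 hT).1).2.2
    have hST : S = T := Finset.eq_of_subset_of_card_le hsub (by omega)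
    exact hc ⟨S, hS, hST ▸ hT⟩
  obtain ⟨e, he⟩ := hne
  exact ⟨e, S, T, hS, hT, hmin, he⟩

theorem solved_of_forall_trivial (h : Admissible I.area loc)
    (hT : IsLimitTree I.graph (lower (reveal I.area loc R)) T) (hf : f ∈ I.graph.edgeSet)
    (hfT : f ∉ T) (ht : ∀ e ∈ cycleEdges T f, ∀ v ∈ e, ¬ (I.area v).Nontrivial) :
    AlwaysMaximal (reveal I.area loc R) (cycleEdges T f) f := by
  obtain ⟨hT', hTl⟩ := (isLimitTree_iff (lower_ne_bot _)).1 hT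
  refine ⟨self_mem_cycleEdges hT' hf hfT, fun e he _ => ?_⟩
  have hends : ends (reveal I.area loc R) e = ∅ := by
    refine Finset.eq_empty_of_forall_notMem fun v hv => ?_
    exact ht e he v (mem_ends.1 hv).1 (nontrivial_of_reveal (mem_ends.1 hv).2)
  have h1 := hTl f hf hfT e he
  rwa [lower_eq_trueLength (h.reveal R) hends, ← upper_eq_trueLength (h.reveal R) hends] at h1

/-- A query set that solves all fundamental cycles of some spanning tree is feasible. -/
theorem feasible_of_forall_solved (hI : I.CactusLike) (h : Admissible I.area loc)
    (hT : IsSpanningTree I.graph T)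
    (hs : ∀ f ∈ I.graph.edgeSet, f ∉ T → Solved (reveal I.area loc S) (cycleEdges T f)) :
    I.Feasible loc S := by
  have hS := h.reveal S
  -- A conflict edge would lie on an unsolved cycle with a non-trivial vertex, but that cycle is
  -- also fundamental for `T`.
  have hc : (commonTrees I.graph (reveal I.area loc S)).Nonempty := by
    by_contra hc
    obtain ⟨e, he⟩ := conflictEdges_nonempty h hc
    obtain ⟨T', f, hT', hf, hfT, hns, hmax, ⟨x, hx⟩, -⟩ :=
      exists_cycle_of_mem_conflictEdges hI h he
    obtain ⟨f', hf', hfT', heq⟩ := hI.exists_cycleEdges_eq hT' hf hfT hT hmax.1 (mem_ends.1 hx).1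
      (nontrivial_of_reveal (mem_ends.1 hx).2)
    exact hns (heq ▸ hs f' hf' hfT')
  obtain ⟨T₀, hL, hU⟩ := hc
  obtain ⟨hT₀, hTl⟩ := (isLimitTree_iff (lower_ne_bot _)).1 hL
  obtain ⟨-, hTu⟩ := (isLimitTree_iff (upper_ne_bot hS)).1 hU
  refine ⟨T₀, fun w hw => isMST_of_forall_cycleEdges hT₀ fun f hf hfT e he => ?_⟩
  have hmax : AlwaysMaximal (reveal I.area loc S) (cycleEdges T₀ f) f := by
    by_cases ht : ∀ e ∈ cycleEdges T₀ f, ∀ v ∈ e, ¬ (I.area v).Nontrivial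
    · exact solved_of_forall_trivial h hL hf hfT ht
    · push Not at ht
      obtain ⟨k, hk, v, hv, hvn⟩ := ht
      obtain ⟨f', hf', hfT', heq⟩ := hI.exists_cycleEdges_eq hT₀ hf hfT hT hk hv hvn
      obtain ⟨g, hg⟩ := hs f' hf' hfT'
      rw [heq] at hg
      -- The closing edge has the largest lower and upper limit, so it inherits maximality from any
      -- other always maximal edge `g`.
      by_cases hgf : g = f
      · exact hgf ▸ hg
      · refine ⟨self_mem_cycleEdges hT₀ hf hfT, fun k hk _ => ?_⟩
        have h1 := hTl f hf hfT g hg.1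
        by_cases hkg : k = g
        · rw [hkg]
          exact (hTu f hf hfT g hg.1).trans
            ((hg.2 f (self_mem_cycleEdges hT₀ hf hfT) (Ne.symm hgf)).trans h1)
        · exact (hg.2 k hk hkg).trans h1
  by_cases hef : e = f
  · rw [hef]
  · have h1 := le_upper_of_mem (hw e (cycleEdges_subset_edgeSet hT₀ hf he))
    have h2 := lower_le_of_mem (hw f hf)
    exact EReal.coe_le_coe_iff.1 (h1.trans ((hmax.2 e he hef).trans h2))

theorem exists_isSpanningTree (I : Input V) : ∃ T, IsSpanningTree I.graph T := by
  obtain ⟨T, hT⟩ := exists_isMST I.connected fun _ => 0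
  exact ⟨T, hT.1⟩

theorem feasible_univ (hI : I.CactusLike) (h : Admissible I.area loc) :
    I.Feasible loc Finset.univ := by
  have := I.connected.nonempty
  obtain ⟨T, hT⟩ := exists_isSpanningTree I
  exact feasible_of_forall_solved hI h hT fun f hf hfT =>
    solved_univ h ⟨f, self_mem_cycleEdges hT hf hfT⟩

end Cactus

/-! ### The preprocessing and the sequence of all cycles. -/

section UpperBound

variable {V : Type} [Fintype V] [DecidableEq V] [Nonempty V] {tb : TieBreak V} {I : Input V}
  {loc : V → Plane} {T : Finset (Sym2 V)} {e f : Sym2 V} {Q R R₀ S : Finset V}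
  {K : Areas V → Finset V → ℝ≥0∞}

/-- The preprocessing is `2`-competitive. -/
theorem wp_preprocess_le (hI : I.CactusLike) (h : Admissible I.area loc) (hQ : I.Feasible loc Q)
    {n : ℕ} (hn : Fintype.card V ≤ R.card + n)
    (hK : ∀ S, (commonTrees I.graph (reveal I.area loc S)).Nonempty →
      K (reveal I.area loc S) S ≤ ENNReal.ofReal (S.card + 5 / 2 * (Q \ S).card)) :
    wp loc (preprocess tb I.graph n (reveal I.area loc R)) K R ≤
      ENNReal.ofReal (R.card + 5 / 2 * (Q \ R).card) := by
  induction n generalizing R with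
  | zero =>
    rw [preprocess, wp_done]
    refine hK R ?_
    by_contra hc
    obtain ⟨e, he⟩ := conflictEdges_nonempty h hc
    obtain ⟨T, f, -, -, -, -, -, ⟨x, hx⟩, -⟩ := exists_cycle_of_mem_conflictEdges hI h he
    have hR : R = Finset.univ := by
      rw [← Finset.card_eq_iff_eq_univ]
      have := Finset.card_le_univ R
      omega
    rw [ends_reveal, hR] at hx
    simp at hx
  | succ n ih =>
    rw [preprocess]
    split_ifs with hc
    · rw [wp_done]
      exact hK R hc
    · rw [wp_bind, wp_querySet]
      have he := tb.pick_mem (reveal I.area loc R) _ (conflictEdges_nonempty h hc)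
      generalize tb.pick (reveal I.area loc R) (conflictEdges I.graph (reveal I.area loc R)) = e
        at *
      obtain ⟨x, hxe, hxQ⟩ := Finset.not_disjoint_iff.1 (not_disjoint_conflictEdge hI h hQ he)
      have hxR : x ∉ R := by
        rw [ends_reveal] at hxe
        exact (Finset.mem_sdiff.1 hxe).2
      have h1 : (R ∪ ends (reveal I.area loc R) e).card ≤ R.card + 2 :=
        (Finset.card_union_le _ _).trans (by gcongr; exact card_ends_le_two)
      have h2 : R.card < (R ∪ ends (reveal I.area loc R) e).card :=
        Finset.card_lt_card ((Finset.ssubset_iff_of_subset Finset.subset_union_left).2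
          ⟨x, Finset.mem_union_right _ hxe, hxR⟩)
      have h3 : (Q \ (R ∪ ends (reveal I.area loc R) e)).card < (Q \ R).card := by
        refine Finset.card_lt_card ((Finset.ssubset_iff_of_subset
          (Finset.sdiff_subset_sdiff subset_rfl Finset.subset_union_left)).2
          ⟨x, Finset.mem_sdiff.2 ⟨hxQ, hxR⟩, ?_⟩)
        simp [hxe]
      refine (ih (by omega)).trans (ENNReal.ofReal_le_ofReal ?_)
      have h4 : ((R ∪ ends (reveal I.area loc R) e).card : ℝ) ≤ R.card + 2 := by
        exact_mod_cast h1
      have h5 : ((Q \ (R ∪ ends (reveal I.area loc R) e)).card : ℝ) + 1 ≤ (Q \ R).card := by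
        exact_mod_cast h3
      linarith

open Classical in
/-- The non-trivial vertices of a fundamental cycle. -/
noncomputable def cycleVertices (I : Input V) (T : Finset (Sym2 V)) (f : Sym2 V) : Finset V :=
  Finset.univ.filter fun v => (I.area v).Nontrivial ∧ ∃ e ∈ cycleEdges T f, v ∈ e

theorem mem_cycleVertices {v : V} :
    v ∈ cycleVertices I T f ↔ (I.area v).Nontrivial ∧ ∃ e ∈ cycleEdges T f, v ∈ e := by
  simp [cycleVertices]

theorem disjoint_cycleVertices (hI : I.CactusLike) (hT : IsSpanningTree I.graph T) {f' : Sym2 V}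
    (hf : f ∈ I.graph.edgeSet) (hfT : f ∉ T) (hf' : f' ∈ I.graph.edgeSet) (hfT' : f' ∉ T)
    (hne : f ≠ f') : Disjoint (cycleVertices I T f) (cycleVertices I T f') := by
  refine Finset.disjoint_left.2 fun v hv hv' => ?_
  obtain ⟨hn, e, he, hve⟩ := mem_cycleVertices.1 hv
  obtain ⟨-, e', he', hve'⟩ := mem_cycleVertices.1 hv'
  have heq := hI.cycleEdges_eq hT hf hfT hT hf' hfT' he he' hve hve' hn
  have h1 := self_mem_cycleEdges hT hf hfT
  rw [heq] at h1
  rcases Finset.mem_insert.1 (cycleEdges_subset hT hf' h1) with h2 | h2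
  · exact hne h2
  · exact hfT h2

/-- Queries of trivial vertices change nothing, so only the non-trivial part of a query set matters.
-/
theorem reveal_eq_reveal (h : Admissible I.area loc) {v : V}
    (hv : (I.area v).Nontrivial → (v ∈ R ↔ v ∈ S)) :
    reveal I.area loc R v = reveal I.area loc S v := by
  by_cases hn : (I.area v).Nontrivial
  · simp only [reveal, hv hn]
  · simp only [reveal, h.eq_singleton hn, ite_self]

/-- The total cost for treating all remaining cycles. -/
theorem wp_foldlM_cycleStep_le (hI : I.CactusLike) (h : Admissible I.area loc)
    (hT : T ∈ commonTrees I.graph (reveal I.area loc R₀))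
    (hQ : ∀ f ∈ I.graph.edgeSet, f ∉ T →
      Solved (reveal I.area loc (R₀ ∪ Q)) (cycleEdges T f))
    (hK : ∀ S, (∀ f ∈ I.graph.edgeSet, f ∉ T → Solved (reveal I.area loc S) (cycleEdges T f)) →
      K (reveal I.area loc S) S ≤ ENNReal.ofReal S.card)
    (l : List (Sym2 V)) (hl : l.Nodup) (hlT : ∀ f ∈ l, f ∈ I.graph.edgeSet ∧ f ∉ T)
    (hR₀ : R₀ ⊆ R) (hR : ∀ f ∈ l, ∀ v ∈ cycleVertices I T f, v ∈ R → v ∈ R₀)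
    (hdone : ∀ f ∈ I.graph.edgeSet, f ∉ T → f ∉ l →
      Solved (reveal I.area loc R) (cycleEdges T f)) :
    wp loc (l.foldlM (cycleStep tb T) (reveal I.area loc R)) K R ≤
      ENNReal.ofReal (R.card +
        5 / 2 * (l.map fun f => ((Q \ R₀) ∩ cycleVertices I T f).card).sum) := by
  induction l generalizing R with
  | nil =>
    simpa [wp_done, pure] using hK R fun f hf hfT => hdone f hf hfT (by simp)
  | cons f l ih =>
    obtain ⟨hfl, hl⟩ := List.nodup_cons.1 hl
    obtain ⟨hf, hfT⟩ := hlT f (by simp)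
    obtain ⟨hTs, hTl⟩ := (isLimitTree_iff (lower_ne_bot _)).1 hT.1
    obtain ⟨-, hTu⟩ := (isLimitTree_iff (upper_ne_bot (h.reveal R₀))).1 hT.2
    have hsame : ∀ e ∈ cycleEdges T f, ∀ v ∈ e,
        reveal I.area loc R v = reveal I.area loc R₀ v := fun e he v hv =>
      reveal_eq_reveal h fun hn => ⟨hR f (by simp) v (mem_cycleVertices.2 ⟨hn, e, he, hv⟩),
        fun hv => hR₀ hv⟩
    have hfC := self_mem_cycleEdges hTs hf hfT
    -- The reserve for the cycles still to come. It does not depend on the queries made in the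
    -- current cycle, as the cycles share no non-trivial vertices.
    set d : ℝ := 5 / 2 * (l.map fun f => ((Q \ R₀) ∩ cycleVertices I T f).card).sum with hd
    have hd0 : 0 ≤ d := by positivity
    set Q' := (Q ∩ cycleVertices I T f) \ R with hQ'
    have hRS : ∀ {S}, R ⊆ S → reveal (reveal I.area loc R) loc S = reveal I.area loc S :=
      fun hRS => by rw [reveal_reveal, Finset.union_eq_right.2 hRS]
    rw [List.foldlM_cons, wp_bind]
    refine (wp_cycleStep_le (Q := Q') (U := R ∪ cycleVertices I T f) (d := d) (h.reveal R)
      (isCycleSet_cycleEdges hTs hf hfT) ⟨hfC, fun e he => ?_⟩ (fun e he => ?_) ?_ ?_ ?_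
      Finset.subset_union_left (hRS subset_rfl) hd0 ?_).trans (ENNReal.ofReal_le_ofReal ?_)
    · rw [upper_congr (hsame e he), upper_congr (hsame f hfC)]
      exact hTu f hf hfT e he
    · rw [lower_congr (hsame e he), lower_congr (hsame f hfC)]
      exact hTl f hf hfT e he
    · rw [reveal_reveal]
      have h1 : Solved (reveal I.area loc (R ∪ Q)) (cycleEdges T f) :=
        (hQ f hf hfT).reveal_mono h (Finset.union_subset_union_left hR₀)
      refine (solved_congr fun e he v hv => reveal_eq_reveal h fun hn => ?_).2 h1
      have hvC := mem_cycleVertices.2 ⟨hn, e, he, hv⟩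
      simp only [hQ', Finset.mem_union, Finset.mem_sdiff, Finset.mem_inter, hvC]
      tauto
    · intro v hv
      rw [hQ', Finset.mem_sdiff, Finset.mem_inter, mem_cycleVertices] at hv
      simp only [reveal, hv.2, if_false]
      exact hv.1.2.1
    · intro e he v hv
      exact Finset.mem_union_right _ (mem_cycleVertices.2
        ⟨nontrivial_of_reveal (mem_ends.1 hv).2, e, he, (mem_ends.1 hv).1⟩)
    · intro S hRS' hSU hs
      rw [hRS hRS'] at hs ⊢
      rw [add_comm d]
      refine ih hl (fun f' hf' => hlT f' (List.mem_cons_of_mem _ hf')) (hR₀.trans hRS') ?_ ?_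
      · intro f' hf' v hv hvS
        obtain ⟨hf'G, hf'T⟩ := hlT f' (List.mem_cons_of_mem _ hf')
        rcases Finset.mem_union.1 (hSU hvS) with hvR | hvC
        · exact hR f' (List.mem_cons_of_mem _ hf') v hv hvR
        · exact absurd hv (Finset.disjoint_left.1 (disjoint_cycleVertices hI hTs hf hfT hf'G hf'T
            (fun hff => hfl (hff ▸ hf'))) hvC)
      · intro f' hf' hf'T hf'l
        by_cases hff : f' = f
        · rw [hff]
          exact hs
        · refine (hdone f' hf' hf'T ?_).reveal_mono h hRS'
          simp [hff, hf'l]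
    · have h1 : Q'.card ≤ ((Q \ R₀) ∩ cycleVertices I T f).card := by
        refine Finset.card_le_card fun v hv => ?_
        rw [hQ', Finset.mem_sdiff, Finset.mem_inter] at hv
        exact Finset.mem_inter.2 ⟨Finset.mem_sdiff.2 ⟨hv.1.1, fun h => hv.2 (hR₀ h)⟩, hv.1.2⟩
      have h2 : (Q'.card : ℝ) ≤ ((Q \ R₀) ∩ cycleVertices I T f).card := by exact_mod_cast h1
      rw [List.map_cons, List.sum_cons]
      push_cast at hd ⊢
      linarith

open Classical in
/-- The number of queried vertices, or `∞` if the query set is not feasible. -/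
noncomputable def feasibleCard (I : Input V) (loc : V → Plane) (S : Finset V) : ℝ≥0∞ :=
  if I.Feasible loc S then ENNReal.ofReal S.card else ⊤

/-- The parts of `Q` left over by the preprocessing that lie in different cycles are disjoint, so
the bounds per cycle sum to at most `5/2 * |Q \ R₀|`. -/
theorem wp_vRandomCOn_le (hI : I.CactusLike) (h : Admissible I.area loc)
    (hQ : I.Feasible loc Q) :
    wp loc (vRandomCOn tb I) (fun _ => feasibleCard I loc) ∅ ≤
      ENNReal.ofReal (5 / 2 * Q.card) := by
  rw [vRandomCOn, wp_bind]
  have h0 := wp_preprocess_le (tb := tb) (R := ∅) (n := Fintype.card V)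
    (K := fun a P => wp loc (do
      let _ ← (tb.pick a {l : List (Sym2 V) | l.Nodup ∧ ∀ e, e ∈ l ↔ e ∈ I.graph.edgeSet ∧
        e ∉ tb.pick a (commonTrees I.graph a)}).foldlM
          (cycleStep tb (tb.pick a (commonTrees I.graph a))) a
      done ()) (fun _ => feasibleCard I loc) P) hI h hQ (by simp) ?_
  · rw [reveal_empty] at h0
    simpa using h0
  · intro R₀ hc
    have hT := tb.pick_mem (reveal I.area loc R₀) _ hc
    generalize tb.pick (reveal I.area loc R₀) (commonTrees I.graph (reveal I.area loc R₀)) = T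
      at *
    have hne : {l : List (Sym2 V) | l.Nodup ∧ ∀ e, e ∈ l ↔ e ∈ I.graph.edgeSet ∧
        e ∉ T}.Nonempty := by
      classical
      refine ⟨(Finset.univ.filter fun e => e ∈ I.graph.edgeSet ∧ e ∉ T).toList, ?_, ?_⟩
      · exact Finset.nodup_toList _
      · simp
    have hl := tb.pick_mem (reveal I.area loc R₀) _ hne
    generalize tb.pick (reveal I.area loc R₀) {l : List (Sym2 V) | l.Nodup ∧
      ∀ e, e ∈ l ↔ e ∈ I.graph.edgeSet ∧ e ∉ T} = l at *
    obtain ⟨hnodup, hmem⟩ := hl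
    obtain ⟨hTs, -⟩ := (isLimitTree_iff (lower_ne_bot _)).1 hT.1
    rw [wp_bind]
    refine (wp_foldlM_cycleStep_le (Q := Q) (R₀ := R₀) hI h hT ?_ ?_ l hnodup
      (fun f hf => (hmem f).1 hf) subset_rfl (fun _ _ _ _ hv => hv) ?_).trans
      (ENNReal.ofReal_le_ofReal ?_)
    · intro f hf hfT
      by_cases ht : ∀ e ∈ cycleEdges T f, ∀ v ∈ e, ¬ (I.area v).Nontrivial
      · have h1 : Solved (reveal I.area loc R₀) (cycleEdges T f) :=
          ⟨f, solved_of_forall_trivial h hT.1 hf hfT ht⟩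
        exact h1.reveal_mono h Finset.subset_union_left
      · push Not at ht
        obtain ⟨e, he, v, hv, hn⟩ := ht
        exact (hQ.solved hI h hTs hf hfT he hv hn).reveal_mono h Finset.subset_union_right
    · intro S hS
      rw [wp_done, feasibleCard, if_pos (feasible_of_forall_solved hI h hTs hS)]
    · exact fun f hf hfT hfl => absurd ((hmem f).2 ⟨hf, hfT⟩) hfl
    · have h1 : (l.map fun f => ((Q \ R₀) ∩ cycleVertices I T f).card).sum ≤ (Q \ R₀).card := by
        rw [← List.sum_toFinset _ hnodup, ← Finset.card_biUnion]
        · refine Finset.card_le_card fun v hv => ?_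
          obtain ⟨f, -, hf⟩ := Finset.mem_biUnion.1 hv
          exact (Finset.mem_inter.1 hf).1
        · intro f hf f' hf' hne
          rw [Finset.mem_coe, List.mem_toFinset] at hf hf'
          exact (disjoint_cycleVertices hI hTs ((hmem f).1 hf).1 ((hmem f).1 hf).2
            ((hmem f').1 hf').1 ((hmem f').1 hf').2 hne).mono Finset.inter_subset_right
            Finset.inter_subset_right
      have h2 : ((l.map fun f => ((Q \ R₀) ∩ cycleVertices I T f).card).sum : ℝ) ≤
          (Q \ R₀).card := by exact_mod_cast h1
      linarith

end UpperBound

/-! ### From the number of queries to the expected cost. -/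

section Cost

variable {V : Type} [Fintype V] [DecidableEq V] {I : Input V} {loc : V → Plane}

theorem Input.UniformCost.queryCost_eq (hc : I.UniformCost) (v : V) (Q : Finset V) :
    I.queryCost Q = I.cost v * Q.card := by
  rw [Input.queryCost, Finset.sum_congr rfl fun u _ => hc u v, Finset.sum_const, nsmul_eq_mul,
    mul_comm]

/-- The algorithm V-Random_C is `5/2`-competitive. -/
theorem competitive_vRandomC (tb : ∀ V : Type, TieBreak V) :
    (vRandomC tb).CompetitiveOnCactusLike (5 / 2) := by
  intro V _ _ I loc hI hc hr
  have h := Input.admissible hr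
  have := I.connected.nonempty
  obtain ⟨v⟩ := this
  have hq := I.cost_pos v
  have hbound : ∀ Q, I.Feasible loc Q →
      ∑ P, (vRandomC tb).output I loc P * feasibleCard I loc P ≤
        ENNReal.ofReal (5 / 2 * Q.card) := by
    intro Q hQ
    have := I.connected.nonempty
    have h1 := wp_vRandomCOn_le (tb := tb V) hI h hQ
    rw [wp_law, tsum_fintype] at h1
    exact h1
  have hsupp : ∀ P ∈ ((vRandomC tb).output I loc).support, I.Feasible loc P := by
    intro P hP
    by_contra hnf
    -- An infeasible outcome of positive probability would make the expectation infinite, but the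
    -- set of all vertices is feasible and gives a finite bound.
    have h1 := (Finset.single_le_sum (f := fun P => (vRandomC tb).output I loc P *
      feasibleCard I loc P) (fun _ _ => zero_le) (Finset.mem_univ P)).trans
      (hbound _ (feasible_univ hI h))
    simp only [feasibleCard, if_neg hnf] at h1
    rw [ENNReal.mul_top ((PMF.mem_support_iff _ _).1 hP), top_le_iff] at h1
    exact ENNReal.ofReal_ne_top h1
  refine ⟨hsupp, ?_⟩
  have hcost : ENNReal.ofReal ((vRandomC tb).expectedCost I loc) = ENNReal.ofReal (I.cost v) *
      ∑ P, (vRandomC tb).output I loc P * feasibleCard I loc P := by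
    rw [RandomizedAlgorithm.expectedCost, ENNReal.ofReal_sum_of_nonneg, Finset.mul_sum]
    · refine Finset.sum_congr rfl fun P _ => ?_
      by_cases hP : (vRandomC tb).output I loc P = 0
      · simp [hP]
      · rw [feasibleCard, if_pos (hsupp P ((PMF.mem_support_iff _ _).2 hP)),
          hc.queryCost_eq v, ENNReal.ofReal_mul ENNReal.toReal_nonneg,
          ENNReal.ofReal_toReal (PMF.apply_ne_top _ _), ENNReal.ofReal_mul hq.le]
        ring
    · intro P _
      rw [hc.queryCost_eq v]
      positivity
  have hle : ∀ Q, I.Feasible loc Q →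
      (vRandomC tb).expectedCost I loc ≤ 5 / 2 * I.queryCost Q := by
    intro Q hQ
    have hpos : (0 : ℝ) ≤ 5 / 2 * (I.cost v * Q.card) := by positivity
    rw [hc.queryCost_eq v, ← ENNReal.ofReal_le_ofReal_iff hpos, hcost]
    refine (mul_le_mul_right (hbound Q hQ) _).trans (le_of_eq ?_)
    rw [← ENNReal.ofReal_mul hq.le]
    congr 1
    ring
  have hinf : 2 / 5 * (vRandomC tb).expectedCost I loc ≤ I.opt loc := by
    refine le_csInf ⟨_, _, feasible_univ hI h, rfl⟩ ?_
    rintro c ⟨Q, hQ, rfl⟩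
    have := hle Q hQ
    linarith
  linarith

end Cost

/-! ### Searching for a hidden vertex. -/

section HiddenVertex

variable {V : Type} [Fintype V] [DecidableEq V] {α : Type}

open Classical in
/-- The number of queried vertices, or `∞` if `i` has not been queried. -/
noncomputable def cardIfMem (i : V) (Q : Finset V) : ℝ≥0∞ := if i ∈ Q then (Q.card : ℝ≥0∞) else ⊤

/-- A strategy that has to find the only vertex that is not at its default position queries, on
average over all such vertices, half of all vertices. -/
theorem sum_range_le_sum_wp (D S : V → Plane) (m : QueryAlg V α) (R : Finset V) :
    ∑ k ∈ Finset.range Rᶜ.card, ((R.card + 1 + k : ℕ) : ℝ≥0∞) ≤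
      ∑ i ∈ Rᶜ, wp (Function.update D i (S i)) m (fun _ => cardIfMem i) R := by
  induction m generalizing R with
  | done a =>
    rcases Rᶜ.eq_empty_or_nonempty with h | ⟨i, hi⟩
    · simp [h]
    -- Stopping with some vertex unqueried has infinite cost in the realization that hides this
    -- vertex.
    · refine le_top.trans (le_trans (le_of_eq ?_) (Finset.single_le_sum
        (f := fun i => wp (Function.update D i (S i)) (done a) (fun _ => cardIfMem i) R)
        (fun _ _ => zero_le) hi))
      rw [wp_done, cardIfMem, if_neg (Finset.mem_compl.1 hi)]
  | query v k ih =>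
    by_cases hv : v ∈ R
    · refine (ih (D v) R).trans (le_of_eq (Finset.sum_congr rfl fun i hi => ?_))
      have hvi : v ≠ i := fun h => Finset.mem_compl.1 hi (h ▸ hv)
      rw [wp_query, Function.update_of_ne hvi, Finset.insert_eq_of_mem hv]
    · have hR : Rᶜ = insert v (insert v R)ᶜ := by
        ext x
        simp only [Finset.mem_compl, Finset.mem_insert]
        by_cases hx : x = v
        · simp [hx, hv]
        · simp [hx]
      have hn : v ∉ (insert v R)ᶜ := by simp
      -- If `v` is the hidden vertex, at least `|R| + 1` vertices get queried, which pays for the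
      -- first summand. In all other realizations the answer is the default, and the induction
      -- hypothesis for this single continuation covers the rest.
      rw [hR, Finset.sum_insert hn, Finset.card_insert_of_notMem hn, Finset.sum_range_succ',
        add_comm]
      refine add_le_add ?_ ?_
      · rw [wp_query]
        refine le_wp (fun _ Q hQ => ?_) _
        rw [cardIfMem, if_pos (hQ (Finset.mem_insert_self _ _))]
        have h1 := Finset.card_le_card hQ
        rw [Finset.card_insert_of_notMem hv] at h1
        exact_mod_cast h1
      · refine le_trans (le_of_eq ?_) ((ih (D v) (insert v R)).trans
          (le_of_eq (Finset.sum_congr rfl fun i hi => ?_)))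
        · refine Finset.sum_congr rfl fun k _ => ?_
          rw [Finset.card_insert_of_notMem hv]
          congr 1
          omega
        · have hvi : v ≠ i := fun h => hn (h ▸ hi)
          rw [wp_query, Function.update_of_ne hvi]
  | rand γ p k ih =>
    simp only [wp_rand]
    rw [← Summable.tsum_finsetSum fun _ _ => ENNReal.summable]
    simp only [← Finset.mul_sum]
    calc ∑ k ∈ Finset.range Rᶜ.card, ((R.card + 1 + k : ℕ) : ℝ≥0∞)
        = ∑' b, p b * ∑ k ∈ Finset.range Rᶜ.card, ((R.card + 1 + k : ℕ) : ℝ≥0∞) := by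
          rw [ENNReal.tsum_mul_right, p.tsum_coe, one_mul]
      _ ≤ _ := ENNReal.tsum_le_tsum fun b => mul_le_mul_right (ih b R) _

end HiddenVertex

/-! ### The lower bound on a cycle of length four. -/

section FourCycle

/-- A point on the horizontal axis. -/
noncomputable def axisPoint (x : ℝ) : Plane := !₂[x, 0]

theorem dist_axisPoint (x y : ℝ) : dist (axisPoint x) (axisPoint y) = |x - y| := by
  rw [EuclideanSpace.dist_eq]
  simp [axisPoint, Real.dist_eq, Real.sqrt_sq_eq_abs]

variable {V : Type} [Fintype V] [DecidableEq V]

theorem abs_sub_mem_edgeArea {A : Areas V} {y : V → ℝ} (hy : ∀ v, axisPoint (y v) ∈ A v)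
    (u v : V) : |y u - y v| ∈ edgeArea A s(u, v) :=
  ⟨u, v, rfl, _, hy u, _, hy v, (dist_axisPoint _ _).symm⟩

theorem dist_bounds {x y : Plane} {a b r s : ℝ} (hx : dist x (axisPoint a) ≤ r)
    (hy : dist y (axisPoint b) ≤ s) :
    |a - b| - r - s ≤ dist x y ∧ dist x y ≤ |a - b| + r + s := by
  rw [← dist_axisPoint]
  have h1 := dist_triangle4 (axisPoint a) x y (axisPoint b)
  have h2 := dist_triangle4 x (axisPoint a) (axisPoint b) y
  rw [dist_comm (axisPoint a) x] at h1
  rw [dist_comm (axisPoint b) y] at h2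
  constructor <;> linarith

theorem bounds_of_mem_edgeArea {A : Areas V} {u v : V} {a b r s d : ℝ}
    (hu : ∀ x ∈ A u, dist x (axisPoint a) ≤ r) (hv : ∀ x ∈ A v, dist x (axisPoint b) ≤ s)
    (hd : d ∈ edgeArea A s(u, v)) : |a - b| - r - s ≤ d ∧ d ≤ |a - b| + r + s := by
  obtain ⟨u', v', he, x, hx, y, hy, rfl⟩ := hd
  rcases Sym2.eq_iff.1 he with ⟨rfl, rfl⟩ | ⟨rfl, rfl⟩
  · exact dist_bounds (hu x hx) (hv y hy)
  · rw [dist_comm]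
    exact dist_bounds (hu y hy) (hv x hx)

theorem upper_le_of_bounds {A : Areas V} {u v : V} {a b r s c : ℝ}
    (hu : ∀ x ∈ A u, dist x (axisPoint a) ≤ r) (hv : ∀ x ∈ A v, dist x (axisPoint b) ≤ s)
    (hc : |a - b| + r + s ≤ c) : upper A s(u, v) ≤ (c : EReal) :=
  iSup₂_le fun _ hd => EReal.coe_le_coe_iff.2 ((bounds_of_mem_edgeArea hu hv hd).2.trans hc)

theorem le_lower_of_bounds {A : Areas V} {u v : V} {a b r s c : ℝ}
    (hu : ∀ x ∈ A u, dist x (axisPoint a) ≤ r) (hv : ∀ x ∈ A v, dist x (axisPoint b) ≤ s)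
    (hc : c ≤ |a - b| - r - s) : (c : EReal) ≤ lower A s(u, v) :=
  le_iInf₂ fun _ hd => EReal.coe_le_coe_iff.2 (hc.trans (bounds_of_mem_edgeArea hu hv hd).1)

/-- A path on four vertices. -/
def pathEdges : Finset (Sym2 (Fin 4)) := {s(1, 2), s(2, 3), s(3, 0)}

/-- The edge that closes the path to a cycle. -/
def closingEdge : Sym2 (Fin 4) := s(0, 1)

theorem closingEdge_notMem : closingEdge ∉ pathEdges := by decide

theorem mem_edgeSet_fourCycle {e : Sym2 (Fin 4)} :
    e ∈ (graphOf (insert closingEdge pathEdges)).edgeSet ↔ e ∈ insert closingEdge pathEdges := by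
  rw [graphOf, SimpleGraph.edgeSet_fromEdgeSet, Set.mem_sdiff, Finset.mem_coe, and_iff_left_iff_imp]
  revert e
  decide

theorem isSpanningTree_pathEdges :
    IsSpanningTree (graphOf (insert closingEdge pathEdges)) pathEdges := by
  refine isSpanningTree_iff_card.2 ⟨?_, ?_, by decide⟩
  · intro e he
    exact mem_edgeSet_fourCycle.2 (Finset.mem_insert_of_mem he)
  · have h32 : (graphOf pathEdges).Adj 3 2 := by
      simp [graphOf, pathEdges, Sym2.eq_swap]
    have h21 : (graphOf pathEdges).Adj 2 1 := by
      simp [graphOf, pathEdges, Sym2.eq_swap]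
    have h30 : (graphOf pathEdges).Adj 3 0 := by
      simp [graphOf, pathEdges]
    refine (SimpleGraph.connected_iff_exists_forall_reachable _).2 ⟨3, fun w => ?_⟩
    fin_cases w
    · exact h30.reachable
    · exact h32.reachable.trans h21.reachable
    · exact h32.reachable
    · exact SimpleGraph.Reachable.refl _

theorem closingEdge_mem_edgeSet :
    closingEdge ∈ (graphOf (insert closingEdge pathEdges)).edgeSet :=
  mem_edgeSet_fourCycle.2 (Finset.mem_insert_self _ _)

theorem connected_fourCycle : (graphOf (insert closingEdge pathEdges)).Connected :=
  isSpanningTree_pathEdges.2.connected.mono (graphOf_mono (Finset.subset_insert _ _))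

/-- The centers of the uncertainty sets. -/
noncomputable def center : Fin 4 → ℝ := ![-1 / 2, 21 / 2, 19 / 2, 1 / 2]

theorem center_eq : center 0 = -1 / 2 ∧ center 1 = 21 / 2 ∧ center 2 = 19 / 2 ∧ center 3 = 1 / 2 :=
  ⟨rfl, rfl, rfl, rfl⟩

/-- The default positions. -/
noncomputable def defaultPos : Fin 4 → ℝ := ![0, 10, 10, 0]

theorem defaultPos_eq :
    defaultPos 0 = 0 ∧ defaultPos 1 = 10 ∧ defaultPos 2 = 10 ∧ defaultPos 3 = 0 :=
  ⟨rfl, rfl, rfl, rfl⟩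

/-- The positions that reveal which edge is longer. -/
noncomputable def specialPos : Fin 4 → ℝ := ![-1, 11, 9, 1]

theorem specialPos_eq :
    specialPos 0 = -1 ∧ specialPos 1 = 11 ∧ specialPos 2 = 9 ∧ specialPos 3 = 1 :=
  ⟨rfl, rfl, rfl, rfl⟩

theorem eq_zero_or_one_or_two_or_three (i : Fin 4) : i = 0 ∨ i = 1 ∨ i = 2 ∨ i = 3 := by
  revert i
  decide

/-- A cycle of length four with uncertain vertices on which no algorithm can find out which of the
two long edges is longer before it hits the only vertex that is not at its default position. -/
noncomputable def fourCycle : Input (Fin 4) where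
  graph := graphOf (insert closingEdge pathEdges)
  connected := connected_fourCycle
  area v := Metric.ball (axisPoint (center v)) (3 / 5)
  area_nonempty v := ⟨_, Metric.mem_ball_self (by norm_num)⟩
  area_spec v := Or.inr Metric.isOpen_ball
  cost _ := 1
  cost_pos _ := one_pos

/-- The graph is a tree with one additional edge, so all its cycles have the same edge set. -/
theorem cactusLike_fourCycle : fourCycle.CactusLike := by
  have key : ∀ {u : Fin 4} {p : fourCycle.graph.Walk u u}, p.IsCycle → ∀ e,
      e ∈ p.edges ↔ e ∈ cycleEdges pathEdges closingEdge := by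
    intro u p hp e
    refine ⟨fun he => ?_, fun he => mem_edges_of_mem_cycleEdges isSpanningTree_pathEdges
      closingEdge_mem_edgeSet closingEdge_notMem hp he⟩
    simp only [cycleEdges, Finset.mem_filter, Finset.mem_univ, true_and]
    exact ⟨u, p, hp, he⟩
  intro u v p q hp hq _ e
  rw [key hp, key hq]

/-- The realization in which only `i` is not at its default position. -/
noncomputable def fourCyclePos (i : Fin 4) : Fin 4 → Plane :=
  Function.update (fun v => axisPoint (defaultPos v)) i (axisPoint (specialPos i))

theorem axisPoint_mem_area {v : Fin 4} {x : ℝ} (h : |x - center v| < 3 / 5) :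
    axisPoint x ∈ fourCycle.area v := by
  change dist _ _ < _
  rwa [dist_axisPoint]

theorem defaultPos_mem (v : Fin 4) : axisPoint (defaultPos v) ∈ fourCycle.area v := by
  refine axisPoint_mem_area ?_
  rcases eq_zero_or_one_or_two_or_three v with rfl | rfl | rfl | rfl <;>
    norm_num [defaultPos_eq, center_eq, abs_lt]

theorem specialPos_mem (v : Fin 4) : axisPoint (specialPos v) ∈ fourCycle.area v := by
  refine axisPoint_mem_area ?_
  rcases eq_zero_or_one_or_two_or_three v with rfl | rfl | rfl | rfl <;>
    norm_num [specialPos_eq, center_eq, abs_lt]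

theorem realizes_fourCyclePos (i : Fin 4) : fourCycle.Realizes (fourCyclePos i) := by
  intro v
  by_cases hv : v = i
  · subst hv
    rw [fourCyclePos, Function.update_self]
    exact specialPos_mem v
  · rw [fourCyclePos, Function.update_of_ne hv]
    exact defaultPos_mem v

/-- The long edges have ranges 11 ± 1.2 (closing edge) and 9 ± 1.2, overlapping only between 9.8 and
10.2; the short ones stay below 2.2. The special position of `i` moves its long edge out of the
overlap, so the closing edge is always maximal. -/
theorem feasible_fourCycle (i : Fin 4) : fourCycle.Feasible (fourCyclePos i) {i} := by
  have h := Input.admissible (realizes_fourCyclePos i)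
  refine feasible_of_forall_solved cactusLike_fourCycle h isSpanningTree_pathEdges
    fun f hf hfT => ?_
  have hf' := mem_edgeSet_fourCycle.1 hf
  rcases Finset.mem_insert.1 hf' with rfl | hf'
  swap
  · exact absurd hf' hfT
  set A := reveal fourCycle.area (fourCyclePos i) {i} with hA
  have hball : ∀ v, ∀ x ∈ A v, dist x (axisPoint (center v)) ≤ 3 / 5 := fun v x hx =>
    (Metric.mem_ball.1 (h.reveal_subset {i} v hx)).le
  have hi : ∀ x ∈ A i, dist x (axisPoint (specialPos i)) ≤ 0 := by
    intro x hx
    simp only [hA, reveal, Finset.mem_singleton, if_true, fourCyclePos, Function.update_self,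
      Set.mem_singleton_iff] at hx
    rw [hx, dist_self]
  have h12 : upper A s(1, 2) ≤ ((22 / 10 : ℝ) : EReal) := by
    refine upper_le_of_bounds (hball 1) (hball 2) ?_
    norm_num [center_eq, abs_of_pos]
  have h30 : upper A s(3, 0) ≤ ((22 / 10 : ℝ) : EReal) := by
    refine upper_le_of_bounds (hball 3) (hball 0) ?_
    norm_num [center_eq, abs_of_pos]
  have key : ∃ c : ℝ, 22 / 10 ≤ c ∧ upper A s(2, 3) ≤ (c : EReal) ∧
      (c : EReal) ≤ lower A s(0, 1) := by
    -- For `i = 0, 1` the closing edge rises above 10.2, the old upper limit of `s(2, 3)`; for `i =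
    -- 2, 3` the latter falls below 9.8, the old lower limit of the closing edge.
    rcases eq_zero_or_one_or_two_or_three i with rfl | rfl | rfl | rfl
    · refine ⟨102 / 10, by norm_num, upper_le_of_bounds (hball 2) (hball 3) ?_,
        le_lower_of_bounds hi (hball 1) ?_⟩ <;> norm_num [center_eq, specialPos_eq, abs_of_pos, abs_of_neg]
    · refine ⟨102 / 10, by norm_num, upper_le_of_bounds (hball 2) (hball 3) ?_,
        le_lower_of_bounds (hball 0) hi ?_⟩ <;> norm_num [center_eq, specialPos_eq, abs_of_pos, abs_of_neg]
    · refine ⟨98 / 10, by norm_num, upper_le_of_bounds hi (hball 3) ?_,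
        le_lower_of_bounds (hball 0) (hball 1) ?_⟩ <;>
        norm_num [center_eq, specialPos_eq, abs_of_pos, abs_of_neg]
    · refine ⟨98 / 10, by norm_num, upper_le_of_bounds (hball 2) hi ?_,
        le_lower_of_bounds (hball 0) (hball 1) ?_⟩ <;>
        norm_num [center_eq, specialPos_eq, abs_of_pos, abs_of_neg]
  obtain ⟨c, hc, h23, h01⟩ := key
  have hc' : ((22 / 10 : ℝ) : EReal) ≤ (c : EReal) := EReal.coe_le_coe_iff.2 hc
  refine ⟨closingEdge, self_mem_cycleEdges isSpanningTree_pathEdges closingEdge_mem_edgeSet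
    closingEdge_notMem, fun e he hne => ?_⟩
  have he' := (Finset.mem_insert.1 (cycleEdges_subset isSpanningTree_pathEdges
    closingEdge_mem_edgeSet he)).resolve_left hne
  simp only [pathEdges, Finset.mem_insert, Finset.mem_singleton] at he'
  rcases he' with rfl | rfl | rfl
  · exact (h12.trans hc').trans h01
  · exact h23.trans h01
  · exact (h30.trans hc').trans h01

/-- While `i` is unqueried, all other vertices may be at default positions, where both long edges
have length 10. Varying only `i` can then make either long edge the longer one, so no edge is always
maximal. -/
theorem mem_of_feasible_fourCycle {i : Fin 4} {Q : Finset (Fin 4)}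
    (hQ : fourCycle.Feasible (fourCyclePos i) Q) : i ∈ Q := by
  by_contra hiQ
  have h := Input.admissible (realizes_fourCyclePos i)
  have hC := isCycleSet_cycleEdges isSpanningTree_pathEdges closingEdge_mem_edgeSet
    closingEdge_notMem
  have hsub := cycleEdges_subset isSpanningTree_pathEdges closingEdge_mem_edgeSet
  have h01 := self_mem_cycleEdges isSpanningTree_pathEdges closingEdge_mem_edgeSet
    closingEdge_notMem
  have h12 : s(1, 2) ∈ cycleEdges pathEdges closingEdge := by
    obtain ⟨e, he, hne, h1⟩ := hC.exists_ne closingEdge h01 1 (by decide)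
    have : e = s(1, 2) := by
      have h2 := hsub he
      clear he
      revert e
      decide
    exact this ▸ he
  have h23 : s(2, 3) ∈ cycleEdges pathEdges closingEdge := by
    obtain ⟨e, he, hne, h1⟩ := hC.exists_ne s(1, 2) h12 2 (by decide)
    have : e = s(2, 3) := by
      have h2 := hsub he
      clear he
      revert e
      decide
    exact this ▸ he
  have hn : (fourCycle.area 0).Nontrivial := by
    refine ⟨_, defaultPos_mem 0, _, specialPos_mem 0, fun heq => ?_⟩
    have := dist_axisPoint (defaultPos 0) (specialPos 0)
    rw [heq, dist_self] at this
    norm_num [defaultPos_eq, specialPos_eq] at this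
  obtain ⟨g, hg⟩ := hQ.solved cactusLike_fourCycle h isSpanningTree_pathEdges
    closingEdge_mem_edgeSet closingEdge_notMem h01 (by decide : (0 : Fin 4) ∈ closingEdge) hn
  set A := reveal fourCycle.area (fourCyclePos i) Q with hA
  have hy : ∀ t : ℝ, |t - center i| < 3 / 5 →
      ∀ v, axisPoint (Function.update defaultPos i t v) ∈ A v := by
    intro t ht v
    by_cases hv : v = i
    · subst hv
      rw [Function.update_self, hA, reveal, if_neg hiQ]
      exact axisPoint_mem_area ht
    · rw [Function.update_of_ne hv, hA, reveal]
      split_ifs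
      · rw [fourCyclePos, Function.update_of_ne hv]
        rfl
      · exact defaultPos_mem v
  have key : ∀ {u v u' v' : Fin 4}, g = s(u', v') → s(u, v) ∈ cycleEdges pathEdges closingEdge →
      s(u, v) ≠ g → ∀ t, |t - center i| < 3 / 5 →
      |Function.update defaultPos i t u - Function.update defaultPos i t v| ≤
        |Function.update defaultPos i t u' - Function.update defaultPos i t v'| := by
    intro u v u' v' hgu he hne t ht
    have h1 := le_upper_of_mem (abs_sub_mem_edgeArea (hy t ht) u v)
    have h2 := lower_le_of_mem (abs_sub_mem_edgeArea (hy t ht) u' v')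
    rw [← hgu] at h2
    exact EReal.coe_le_coe_iff.1 (h1.trans ((hg.2 _ he hne).trans h2))
  have hgm := hsub hg.1
  simp only [closingEdge, pathEdges, Finset.mem_insert, Finset.mem_singleton] at hgm
  rcases hgm with hg' | hg' | hg' | hg'
  -- Moving `i` by 1/20 from its default position, away from its special one, makes `s(2, 3)` longer
  -- than the closing edge.
  · have := key hg' h23 (by rw [hg']; decide)
    rcases eq_zero_or_one_or_two_or_three i with rfl | rfl | rfl | rfl
    · have := this (1 / 20) (by norm_num [center_eq, abs_of_pos])
      norm_num [defaultPos_eq, Function.update_apply, Fin.ext_iff, abs_of_pos, abs_of_neg] at this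
    · have := this (199 / 20) (by norm_num [center_eq, abs_of_neg])
      norm_num [defaultPos_eq, Function.update_apply, Fin.ext_iff, abs_of_pos, abs_of_neg] at this
    · have := this (201 / 20) (by norm_num [center_eq, abs_of_pos])
      norm_num [defaultPos_eq, Function.update_apply, Fin.ext_iff, abs_of_pos, abs_of_neg] at this
    · have := this (-1 / 20) (by norm_num [center_eq, abs_of_neg])
      norm_num [defaultPos_eq, Function.update_apply, Fin.ext_iff, abs_of_pos, abs_of_neg] at this
  · have := key hg' h01 (by rw [hg']; decide) (defaultPos i)
      (by have := defaultPos_mem i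
          change dist _ _ < _ at this
          rwa [dist_axisPoint] at this)
    rw [Function.update_eq_self] at this
    norm_num [defaultPos_eq] at this
  · have := key hg' h01 (by rw [hg']; decide) (specialPos i)
      (by have := specialPos_mem i
          change dist _ _ < _ at this
          rwa [dist_axisPoint] at this)
    rcases eq_zero_or_one_or_two_or_three i with rfl | rfl | rfl | rfl <;>
      norm_num [defaultPos_eq, specialPos_eq, Function.update_apply, Fin.ext_iff] at this
  · have := key hg' h01 (by rw [hg']; decide) (defaultPos i)
      (by have := defaultPos_mem i
          change dist _ _ < _ at this
          rwa [dist_axisPoint] at this)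
    rw [Function.update_eq_self] at this
    norm_num [defaultPos_eq] at this

theorem opt_nonneg {I : Input V} {loc : V → Plane} : 0 ≤ I.opt loc := by
  refine Real.sInf_nonneg ?_
  rintro c ⟨Q, -, rfl⟩
  exact Finset.sum_nonneg fun v _ => (I.cost_pos v).le

theorem opt_fourCycle_le (i : Fin 4) : fourCycle.opt (fourCyclePos i) ≤ 1 := by
  refine csInf_le ⟨0, ?_⟩ ⟨{i}, feasible_fourCycle i, ?_⟩
  · rintro c ⟨Q, -, rfl⟩
    exact Finset.sum_nonneg fun v _ => (fourCycle.cost_pos v).le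
  · simp [Input.queryCost, fourCycle]

/-- No randomized algorithm has a competitive ratio below `5/2`. -/
theorem le_of_competitiveOnCactusLike (ALG : RandomizedAlgorithm) (c : ℝ)
    (hc : ALG.CompetitiveOnCactusLike c) : 5 / 2 ≤ c := by
  -- `max c 0` rules out a negative factor, for which `opt ≤ 1` could not be used.
  have hcost : ∀ i, wp (fourCyclePos i) (ALG (Fin 4) fourCycle) (fun _ => cardIfMem i) ∅ ≤
      ENNReal.ofReal (max c 0) := by
    intro i
    obtain ⟨h1, h2⟩ := hc (Fin 4) fourCycle (fourCyclePos i) cactusLike_fourCycle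
      (fun _ _ => rfl) (realizes_fourCyclePos i)
    have h3 : ALG.expectedCost fourCycle (fourCyclePos i) ≤ max c 0 := by
      refine h2.trans ((mul_le_mul_of_nonneg_right (le_max_left c 0) opt_nonneg).trans ?_)
      exact mul_le_of_le_one_right (le_max_right _ _) (opt_fourCycle_le i)
    refine le_trans (le_of_eq ?_) (ENNReal.ofReal_le_ofReal h3)
    rw [wp_law, tsum_fintype, RandomizedAlgorithm.expectedCost, ENNReal.ofReal_sum_of_nonneg]
    · refine Finset.sum_congr rfl fun P _ => ?_
      change ALG.output fourCycle (fourCyclePos i) P * _ = _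
      by_cases hP : ALG.output fourCycle (fourCyclePos i) P = 0
      · simp [hP]
      · have hiP := mem_of_feasible_fourCycle (h1 P ((PMF.mem_support_iff _ _).2 hP))
        rw [cardIfMem, if_pos hiP, ENNReal.ofReal_mul ENNReal.toReal_nonneg,
          ENNReal.ofReal_toReal (PMF.apply_ne_top _ _)]
        congr 1
        simp [Input.queryCost, fourCycle]
    · intro P _
      exact mul_nonneg ENNReal.toReal_nonneg
        (Finset.sum_nonneg fun v _ => (fourCycle.cost_pos v).le)
  have hsum := sum_range_le_sum_wp (fun v => axisPoint (defaultPos v))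
    (fun v => axisPoint (specialPos v)) (ALG (Fin 4) fourCycle) ∅
  -- The four realizations together require `1 + 2 + 3 + 4` expected queries.
  have h10 : (10 : ℝ≥0∞) ≤ ∑ _i : Fin 4, ENNReal.ofReal (max c 0) := by
    refine le_trans (le_of_eq ?_) (hsum.trans ?_)
    · simp [Finset.sum_range_succ]
      norm_num
    · rw [Finset.compl_empty]
      exact Finset.sum_le_sum fun i _ => hcost i
  rw [Finset.sum_const, Finset.card_univ, Fintype.card_fin, nsmul_eq_mul,
    ← ENNReal.ofReal_natCast, ← ENNReal.ofReal_mul (by positivity),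
    show (10 : ℝ≥0∞) = ENNReal.ofReal 10 by simp,
    ENNReal.ofReal_le_ofReal_iff (by positivity)] at h10
  by_contra hlt
  rw [not_le] at hlt
  rcases max_cases c 0 with ⟨h, -⟩ | ⟨h, -⟩ <;> rw [h] at h10 <;> norm_num at h10
  linarith

end FourCycle
end VMST

theorem theorem3 :
    (∀ tb : (∀ V : Type, VMST.TieBreak V),
      (VMST.vRandomC tb).CompetitiveOnCactusLike (5 / 2)) ∧
    (∀ (ALG : VMST.RandomizedAlgorithm) (c : ℝ),
      ALG.CompetitiveOnCactusLike c → 5 / 2 ≤ c) :=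
  ⟨VMST.competitive_vRandomC, VMST.le_of_competitiveOnCactusLike⟩
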